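/- Let $Q$ be a smooth finite-dimensional manifold without boundary, $T^*Q$ its cotangent bundle with Liouville form $\theta_Q$ and canonical symplectic form $\omega=-d\theta_Q$, and let $\omega^\sharp$ be the inverse of $\omega^\flat\colon X\mapsto i_X\omega$. A *discretization map* on $Q$ is a smooth map $R_d=(R^1,R^2)\colon U\to Q\times Q$ on an open neighbourhood $U\subseteq TQ$ of the zero section such that $R_d(0_x)=(x,x)$ and $T_{0_x}R^2_x-T_{0_x}R^1_x=\mathrm{Id}_{T_xQ}$ for all $x\in Q$, where $R^a_x$ is the restriction of $R^a$ to $T_xQ$. Its *cotangent lift* is $R_d^{T^*}=\Phi^{-1}\circ\widehat{R_d}\circ\alpha_Q$, a map from (an open part of) $TT^*Q$ to $T^*Q\times T^*Q$, where $\alpha_Q\colon TT^*Q\to T^*TQ$, $(q,p,\dot q,\dot p)\mapsto(q,\dot q,\dot p,p)$, where $\widehat{R_d}(\beta_v)=\beta_v\circ(T_vR_d)^{-1}\in T^*_{R_d(v)}(Q\times Q)$, and where $\Phi\colon T^*Q\times T^*Q\to T^*(Q\times Q)$, $(q_0,p_0;q_1,p_1)\mapsto(q_0,q_1,-p_0,p_1)$.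 Let $\tau\colon TT^*Q\to T^*Q$ be the projection. Let $R_d\colon U\to Q\times Q$ be a discretization map on $Q$ and $H\colon T^*Q\to\mathbb R$ a smooth function, with Hamiltonian vector field $X_H=\omega^\sharp(dH)$. Then every zero vector $0_q$ has an open neighbourhood $V\subseteq U$ that $R_d$ maps diffeomorphically onto an open subset of $Q\times Q$. Let $V\subseteq U$ be any open set that $R_d$ maps diffeomorphically onto an open subset of $Q\times Q$, and let $(R_d^{T^*})^{-1}$ be the inverse of the cotangent lift of $R_d|_V$. For $h\in\mathbb R$ let $S_h\subseteq T^*Q\times T^*Q$ be the set of pairs $(z_0,z_1)$ at which this inverse is defined and $$(R_d^{T^*})^{-1}(z_0,z_1)=\omega^\sharp\Big(h\,dH\big(\tau((R_d^{T^*})^{-1}(z_0,z_1))\big)\Big).$$ Then this implicit scheme defines a symplectic integrator of $(T^*Q,\omega,H)$, in the following sense. 1. For every $h\in\mathbb R$ the set $S_h$ is a Lagrangian submanifold of $(T^*Q\times T^*Q,\ \mathrm{pr}_2^*\omega-\mathrm{pr}_1^*\omega)$. 2. For every $h\in\mathbb R$, every smooth map $\varphi\colon D\to T^*Q$ on an open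 set $D\subseteq T^*Q$ whose graph is contained in $S_h$ is a local diffeomorphism with $\varphi^*\omega=\omega$. 3. For every $x\in T^*Q$ over a point $q\in Q$ with $0_q\in V$ there are $\varepsilon>0$, open neighbourhoods $A,B$ of $x$ in $T^*Q$ and a smooth map $(-\varepsilon,\varepsilon)\times A\to B$, $(h,z)\mapsto\varphi_h(z)$, such that for $|h|<\varepsilon$ one has $S_h\cap(A\times B)=\{(z,\varphi_h(z)):z\in A\}$ and $\varphi_h$ is a symplectomorphism of $A$ onto an open subset of $T^*Q$; moreover $\varphi_0(z)=z$ and $\frac{d}{dh}\big|_{h=0}\varphi_h(z)=X_H(z)$ for all $z\in A$. -/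

import Mathlib

open scoped Manifold ContDiff Topology

noncomputable section

namespace Discretization

variable {E : Type*} [NormedAddCommGroup E] [NormedSpace ℝ E]
  {Q : Type*} [TopologicalSpace Q] [ChartedSpace E Q]

/-- A cotangent vector at `x`, for a manifold `M` with model `I`. -/
abbrev CotangentSpace {F : Type*} [NormedAddCommGroup F] [NormedSpace ℝ F]
    {K : Type*} [TopologicalSpace K] (I : ModelWithCorners ℝ F K)
    {M : Type*} [TopologicalSpace M] [ChartedSpace K M] (x : M) : Type _ :=
  TangentSpace I x →L[ℝ] Bundle.Trivial M ℝ x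

/-- The cotangent bundle `T*M`, as the vector bundle of homomorphisms from the tangent bundle to
the trivial line bundle.  Its manifold structure is Mathlib's structure on the total space of a
bundle of homomorphisms. -/
abbrev CotangentBundle {F : Type*} [NormedAddCommGroup F] [NormedSpace ℝ F]
    {K : Type*} [TopologicalSpace K] (I : ModelWithCorners ℝ F K)
    (M : Type*) [TopologicalSpace M] [ChartedSpace K M] : Type _ :=
  Bundle.TotalSpace (F →L[ℝ] ℝ) (fun x : M => CotangentSpace I x)

/-- The model with corners of `TQ`, for `Q` modelled on `E`. -/
abbrev tModel (E : Type*) [NormedAddCommGroup E] [NormedSpace ℝ E] :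
    ModelWithCorners ℝ (E × E) (ModelProd E E) :=
  𝓘(ℝ, E).prod 𝓘(ℝ, E)

/-- The model with corners of `T*Q`, for `Q` modelled on `E`. -/
abbrev cModel (E : Type*) [NormedAddCommGroup E] [NormedSpace ℝ E] :
    ModelWithCorners ℝ (E × (E →L[ℝ] ℝ)) (ModelProd E (E →L[ℝ] ℝ)) :=
  𝓘(ℝ, E).prod 𝓘(ℝ, E →L[ℝ] ℝ)

variable (E Q) in
/-- `TQ`. -/
abbrev TQ : Type _ := TangentBundle 𝓘(ℝ, E) Q

variable (E Q) in
/-- `T*Q`. -/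
abbrev CQ : Type _ := CotangentBundle 𝓘(ℝ, E) Q

variable [IsManifold 𝓘(ℝ, E) ∞ Q]

/-- The Liouville one-form of `T*Q`. -/
def liouville (z : CQ E Q) : TangentSpace (cModel E) z →L[ℝ] ℝ :=
  z.2 ∘L mfderiv (cModel E) 𝓘(ℝ, E) (Bundle.TotalSpace.proj : CQ E Q → Q) z

/-- The Liouville one-form, read in the preferred chart of `T*Q` at `z`. -/
def liouvilleInChart (z : CQ E Q) (u : E × (E →L[ℝ] ℝ)) : (E × (E →L[ℝ] ℝ)) →L[ℝ] ℝ :=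
  liouville ((extChartAt (cModel E) z).symm u) ∘L
    mfderiv 𝓘(ℝ, E × (E →L[ℝ] ℝ)) (cModel E) (extChartAt (cModel E) z).symm u

/-- In induced coordinates `(q, p)`, the Liouville form is `p dq`. -/
theorem liouvilleInChart_eq (z : CQ E Q) (u : E × (E →L[ℝ] ℝ))
    (hu : u ∈ (extChartAt (cModel E) z).target) :
    liouvilleInChart z u = u.2 ∘L ContinuousLinearMap.fst ℝ E (E →L[ℝ] ℝ) := by
  have hM : IsManifold (cModel E) 1 (CQ E Q) := inferInstance
  have hM0 : IsManifold 𝓘(ℝ, E) 1 Q := IsManifold.of_le (n := ∞) (by exact_mod_cast le_top)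
  obtain ⟨w, hw⟩ : ∃ w, w = (extChartAt (cModel E) z).symm u := ⟨_, rfl⟩
  have hws : w ∈ (extChartAt (cModel E) z).source := by
    rw [hw]; exact (extChartAt (cModel E) z).map_target hu
  have hwu : extChartAt (cModel E) z w = u := by
    rw [hw]; exact (extChartAt (cModel E) z).right_inv hu
  have htu : (extChartAt (cModel E) z).target ∈ 𝓝 u :=
    (isOpen_extChartAt_target (I := cModel E) z).mem_nhds hu
  rw [FiberBundle.extChartAt] at hws hwu
  have hq : w.proj ∈ (chartAt E z.proj).source := by
    have h1 := hws.1
    simpa using h1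
  have hwu1 : extChartAt 𝓘(ℝ, E) z.proj w.proj = u.1 := by
    rw [← hwu]; rfl
  have hwu2 : (w.2 : TangentSpace 𝓘(ℝ, E) w.proj →L[ℝ] ℝ) ∘L
      (trivializationAt E (TangentSpace 𝓘(ℝ, E)) z.proj).symmL ℝ w.proj = u.2 := by
    rw [← hwu]
    ext v
    simp [hom_trivializationAt_apply, ContinuousLinearMap.inCoordinates]
  have hwit : (Bundle.TotalSpace.proj : CQ E Q → Q) ∘ (extChartAt (cModel E) z).symm =ᶠ[𝓝 u]
      (extChartAt 𝓘(ℝ, E) z.proj).symm ∘ Prod.fst := by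
    filter_upwards [htu] with y hy
    obtain ⟨x, hx⟩ : ∃ x, x = (extChartAt (cModel E) z).symm y := ⟨_, rfl⟩
    have hxs : x ∈ (extChartAt (cModel E) z).source := by
      rw [hx]; exact (extChartAt (cModel E) z).map_target hy
    have hxy : extChartAt (cModel E) z x = y := by
      rw [hx]; exact (extChartAt (cModel E) z).right_inv hy
    rw [FiberBundle.extChartAt] at hxs hxy
    have h1 := hxs.1
    have hq' : x.proj ∈ (extChartAt 𝓘(ℝ, E) z.proj).source := by simpa using h1
    have h2 : extChartAt 𝓘(ℝ, E) z.proj x.proj = y.1 := by rw [← hxy]; rfl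
    simp only [Function.comp_apply, ← hx, ← h2]
    exact ((extChartAt 𝓘(ℝ, E) z.proj).left_inv hq').symm
  have hs : MDifferentiableAt 𝓘(ℝ, E × (E →L[ℝ] ℝ)) (cModel E)
      (extChartAt (cModel E) z).symm u := by
    have := mdifferentiableWithinAt_extChartAt_symm (I := cModel E) hu
    rwa [ModelWithCorners.range_eq_univ, mdifferentiableWithinAt_univ] at this
  have hpr : MDifferentiableAt (cModel E) 𝓘(ℝ, E) (Bundle.TotalSpace.proj : CQ E Q → Q)
      ((extChartAt (cModel E) z).symm u) := Bundle.mdifferentiableAt_proj _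
  have hu1 : u.1 ∈ (extChartAt 𝓘(ℝ, E) z.proj).target := by
    rw [← hwu1]; exact (extChartAt 𝓘(ℝ, E) z.proj).map_source (by simpa using hq)
  have hs0 : MDifferentiableAt 𝓘(ℝ, E) 𝓘(ℝ, E) (extChartAt 𝓘(ℝ, E) z.proj).symm u.1 := by
    have := mdifferentiableWithinAt_extChartAt_symm (I := 𝓘(ℝ, E)) hu1
    rwa [ModelWithCorners.range_eq_univ, mdifferentiableWithinAt_univ] at this
  have hfs : HasMFDerivAt 𝓘(ℝ, E × (E →L[ℝ] ℝ)) 𝓘(ℝ, E) (Prod.fst : E × (E →L[ℝ] ℝ) → E) u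
      (ContinuousLinearMap.fst ℝ E (E →L[ℝ] ℝ)) :=
    (ContinuousLinearMap.fst ℝ E (E →L[ℝ] ℝ)).hasMFDerivAt
  have hA := (hpr.hasMFDerivAt.comp u hs.hasMFDerivAt).mfderiv
  have hB := (hs0.hasMFDerivAt.comp u hfs).mfderiv
  have hC := TangentBundle.symmL_trivializationAt (I := 𝓘(ℝ, E)) (x₀ := z.proj) hq
  have hD := hwit.mfderiv_eq (I := 𝓘(ℝ, E × (E →L[ℝ] ℝ))) (I' := 𝓘(ℝ, E))
  rw [hwu1, ModelWithCorners.range_eq_univ, mfderivWithin_univ] at hC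
  have hE := hA.symm.trans (hD.trans hB)
  refine ContinuousLinearMap.ext fun δ => ?_
  have hEδ := DFunLike.congr_fun hE δ
  have h2 := DFunLike.congr_fun hwu2 δ.1
  have hCδ := DFunLike.congr_fun hC δ.1
  subst hw
  refine Eq.trans ?_ h2
  refine congrArg ((extChartAt (cModel E) z).symm u).2 ?_
  exact hEδ.trans hCδ.symm

/-- The canonical symplectic form `ω = -dθ` of `T*Q`. -/
def omega (z : CQ E Q) (ξ η : TangentSpace (cModel E) z) : ℝ :=
  - extDeriv (fun u => ContinuousAlternatingMap.ofSubsingleton ℝ (E × (E →L[ℝ] ℝ)) ℝ (0 : Fin 1)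
      (liouvilleInChart z u)) (extChartAt (cModel E) z z) ![ξ, η]

/-- The exterior derivative of a one-form with linear coefficients. -/
theorem extDeriv_linear {V : Type*} [NormedAddCommGroup V] [NormedSpace ℝ V]
    (L : V →L[ℝ] V →L[ℝ] ℝ) (x v w : V) :
    extDeriv (fun u => ContinuousAlternatingMap.ofSubsingleton ℝ V ℝ (0 : Fin 1) (L u)) x
      ![v, w] = L v w - L w v := by
  let L' : V →L[ℝ] (V [⋀^Fin 1]→L[ℝ] ℝ) :=
    ((ContinuousAlternatingMap.ofSubsingletonLIE (𝕜 := ℝ) (E := V) (F := ℝ) (0 : Fin 1)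
      ).toContinuousLinearEquiv : _ →L[ℝ] _) ∘L L
  have h : (fun u => ContinuousAlternatingMap.ofSubsingleton ℝ V ℝ (0 : Fin 1) (L u)) = L' := rfl
  have h' : DifferentiableAt ℝ
      (fun u => ContinuousAlternatingMap.ofSubsingleton ℝ V ℝ (0 : Fin 1) (L u)) x := by
    rw [h]; exact L'.differentiableAt
  have h2 (a : V) : fderiv ℝ (fun u => L u a) x = L.flip a := (L.flip a).hasFDerivAt.fderiv
  rw [extDeriv_apply h']
  simp [Fin.sum_univ_two, Fin.removeNth, h2, sub_eq_add_neg]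

/-- In the induced coordinates `(q, p)` on `T*Q`, the canonical form is `dq ∧ dp`. -/
theorem omega_apply (z : CQ E Q) (ξ η : E × (E →L[ℝ] ℝ)) :
    omega z ξ η = η.2 ξ.1 - ξ.2 η.1 := by
  have ht : (extChartAt (cModel E) z).target ∈ 𝓝 (extChartAt (cModel E) z z) :=
    (isOpen_extChartAt_target (I := cModel E) z).mem_nhds (mem_extChartAt_target z)
  let L : (E × (E →L[ℝ] ℝ)) →L[ℝ] (E × (E →L[ℝ] ℝ)) →L[ℝ] ℝ :=
    ((ContinuousLinearMap.compL ℝ (E × (E →L[ℝ] ℝ)) E ℝ).flip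
      (ContinuousLinearMap.fst ℝ E (E →L[ℝ] ℝ))) ∘L ContinuousLinearMap.snd ℝ E (E →L[ℝ] ℝ)
  have hL : (fun u => ContinuousAlternatingMap.ofSubsingleton ℝ (E × (E →L[ℝ] ℝ)) ℝ (0 : Fin 1)
      (liouvilleInChart z u)) =ᶠ[𝓝 (extChartAt (cModel E) z z)]
      fun u => ContinuousAlternatingMap.ofSubsingleton ℝ (E × (E →L[ℝ] ℝ)) ℝ (0 : Fin 1) (L u) := by
    filter_upwards [ht] with u hu
    rw [liouvilleInChart_eq z u hu]
    rfl
  unfold omega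
  rw [hL.extDeriv_eq]
  refine (congrArg Neg.neg (extDeriv_linear L _ ξ η)).trans ?_
  simp [L]

theorem omega_add_left (z : CQ E Q) (ξ ξ' η : TangentSpace (cModel E) z) :
    omega z (ξ + ξ') η = omega z ξ η + omega z ξ' η := by
  refine (omega_apply z _ _).trans ?_
  rw [omega_apply z ξ η, omega_apply z ξ' η]
  change η.2 (ξ.1 + ξ'.1) - (ξ.2 + ξ'.2) η.1 = _
  simp only [map_add, add_apply]
  ring

theorem omega_smul_left (z : CQ E Q) (c : ℝ) (ξ η : TangentSpace (cModel E) z) :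
    omega z (c • ξ) η = c * omega z ξ η := by
  refine (omega_apply z _ _).trans ?_
  rw [omega_apply z ξ η]
  change η.2 (c • ξ.1) - (c • ξ.2) η.1 = _
  simp only [map_smul, smul_apply, smul_eq_mul]
  ring

theorem omega_swap (z : CQ E Q) (ξ η : TangentSpace (cModel E) z) :
    omega z ξ η = - omega z η ξ := by
  rw [omega_apply z ξ η, omega_apply z η ξ]; ring

theorem omega_nondegenerate (z : CQ E Q) (ξ : TangentSpace (cModel E) z)
    (h : ∀ η, omega z ξ η = 0) : ξ = 0 := by
  have h' : ∀ η : E × (E →L[ℝ] ℝ), η.2 ξ.1 - ξ.2 η.1 = 0 :=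
    fun η => (omega_apply z ξ η).symm.trans (h η)
  refine Prod.ext ?_ (ContinuousLinearMap.ext fun e => ?_)
  · refine SeparatingDual.eq_zero_of_forall_dual_eq_zero (R := ℝ) (V := E) (x := ξ.1) fun g => ?_
    have h1 := h' (0, g)
    simpa using h1
  · have h1 := h' (e, 0)
    have h2 : ξ.2 e = 0 := by simpa using h1
    exact h2

section FiniteDim
variable [FiniteDimensional ℝ E]

/-- The map `ω^♭ : ξ ↦ i_ξ ω`. -/
def flat (z : CQ E Q) :
    TangentSpace (cModel E) z →ₗ[ℝ] (TangentSpace (cModel E) z →L[ℝ] ℝ) where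
  toFun ξ :=
    { toFun := fun η => omega z ξ η
      map_add' := fun η η' => by
        rw [omega_swap z ξ, omega_swap z ξ η, omega_swap z ξ η', omega_add_left]; ring
      map_smul' := fun c η => by
        rw [omega_swap z ξ, omega_swap z ξ η, omega_smul_left]; simp
      cont := by
        have : (fun η : E × (E →L[ℝ] ℝ) => omega z ξ η) = fun η => η.2 ξ.1 - ξ.2 η.1 :=
          funext fun η => omega_apply z ξ η
        change Continuous (fun η : E × (E →L[ℝ] ℝ) => omega z ξ η)
        rw [this]
        fun_prop }
  map_add' ξ ξ' := ContinuousLinearMap.ext fun η => omega_add_left z ξ ξ' η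
  map_smul' c ξ := ContinuousLinearMap.ext fun η => omega_smul_left z c ξ η

theorem flat_bijective (z : CQ E Q) : Function.Bijective (flat z) := by
  have hinj : Function.Injective (flat z) := by
    rw [injective_iff_map_eq_zero]
    intro ξ hξ
    exact omega_nondegenerate z ξ fun η => DFunLike.congr_fun hξ η
  have hfd : FiniteDimensional ℝ (TangentSpace (cModel E) z) :=
    inferInstanceAs (FiniteDimensional ℝ (E × (E →L[ℝ] ℝ)))
  have e : ((E × (E →L[ℝ] ℝ)) →ₗ[ℝ] ℝ) ≃ₗ[ℝ] ((E × (E →L[ℝ] ℝ)) →L[ℝ] ℝ) :=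
    LinearMap.toContinuousLinearMap
  have hr : Module.finrank ℝ ((E × (E →L[ℝ] ℝ)) →L[ℝ] ℝ) =
      Module.finrank ℝ (E × (E →L[ℝ] ℝ)) := by
    rw [← e.finrank_eq]
    exact Subspace.dual_finrank_eq
  have hfd' : FiniteDimensional ℝ (TangentSpace (cModel E) z →L[ℝ] ℝ) :=
    inferInstanceAs (FiniteDimensional ℝ ((E × (E →L[ℝ] ℝ)) →L[ℝ] ℝ))
  exact ⟨hinj, (LinearMap.injective_iff_surjective_of_finrank_eq_finrank hr.symm).1 hinj⟩

/-- The musical isomorphism `ω^♯ = (ω^♭)⁻¹`. -/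
def sharp (z : CQ E Q) :
    (TangentSpace (cModel E) z →L[ℝ] ℝ) ≃ₗ[ℝ] TangentSpace (cModel E) z :=
  (LinearEquiv.ofBijective (flat z) (flat_bijective z)).symm

/-- The differential `dH`. -/
def dH (H : CQ E Q → ℝ) (z : CQ E Q) : TangentSpace (cModel E) z →L[ℝ] ℝ :=
  mfderiv (cModel E) 𝓘(ℝ, ℝ) H z

/-- The Hamiltonian vector field `X_H = ω^♯(dH)`. -/
def hamiltonianVF (H : CQ E Q → ℝ) (z : CQ E Q) : TangentSpace (cModel E) z :=
  sharp z (dH H z)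

end FiniteDim

/-- The differential at `0_x` of the restriction of `f : TQ → Q` to the fibre `T_xQ`, as a map from
`T_{0_x}T_xQ ≃ T_xQ = E` to `T_{f(0_x)}Q = E`. -/
def fiberDeriv (f : TQ E Q → Q) (x : Q) : E →L[ℝ] E :=
  mfderiv 𝓘(ℝ, E) 𝓘(ℝ, E) (fun v : E => f ⟨x, v⟩) 0

/-- `R_d : U ⊆ TQ → Q × Q` is a (smooth) discretization map on `Q`; values off `U` are ignored. -/
structure IsDiscretizationMap (R : TQ E Q → Q × Q) (U : Set (TQ E Q)) : Prop where
  isOpen : IsOpen U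
  zero_mem : ∀ x : Q, (⟨x, 0⟩ : TQ E Q) ∈ U
  smooth : ContMDiffOn (tModel E) (𝓘(ℝ, E).prod 𝓘(ℝ, E)) ∞ R U
  map_zero : ∀ x : Q, R ⟨x, 0⟩ = (x, x)
  rigidity : ∀ x : Q,
    fiberDeriv (fun v => (R v).2) x - fiberDeriv (fun v => (R v).1) x = ContinuousLinearMap.id ℝ E

/-- `V ⊆ U` is open and `R_d` restricts to a diffeomorphism of `V` onto its (open) image, so that
`R_d⁻¹` makes sense on `R_d(V)`. -/
structure IsInvertibleOn (R : TQ E Q → Q × Q) (U V : Set (TQ E Q)) : Prop where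
  isOpen : IsOpen V
  subset : V ⊆ U
  injOn : Set.InjOn R V
  localDiffeo : ∀ v ∈ V, IsLocalDiffeomorphAt (tModel E) (𝓘(ℝ, E).prod 𝓘(ℝ, E)) ∞ R v

/-- The cotangent lift `F̂ = T*F⁻¹ : T*M₁ → T*M₂`, that is `α_x ↦ α_x ∘ (T_x F)⁻¹`, at points where
`T_x F` is invertible. -/
def hat {F₁ F₂ K₁ K₂ M₁ M₂ : Type*}
    [NormedAddCommGroup F₁] [NormedSpace ℝ F₁] [NormedAddCommGroup F₂] [NormedSpace ℝ F₂]
    [TopologicalSpace K₁] [TopologicalSpace K₂]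
    (I₁ : ModelWithCorners ℝ F₁ K₁) (I₂ : ModelWithCorners ℝ F₂ K₂)
    [TopologicalSpace M₁] [ChartedSpace K₁ M₁] [TopologicalSpace M₂] [ChartedSpace K₂ M₂]
    (F : M₁ → M₂) (β : CotangentBundle I₁ M₁) : CotangentBundle I₂ M₂ :=
  ⟨F β.proj, β.2 ∘L (mfderiv I₁ I₂ F β.proj).inverse⟩

theorem coprod_inl_inr (a b : E →L[ℝ] ℝ) (c : E × E →L[ℝ] ℝ) :
    (a.coprod b) ∘L ContinuousLinearMap.inl ℝ E E = a ∧
    (a.coprod b) ∘L ContinuousLinearMap.inr ℝ E E = b ∧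
    (c ∘L ContinuousLinearMap.inl ℝ E E).coprod (c ∘L ContinuousLinearMap.inr ℝ E E) = c := by
  refine ⟨?_, ?_, ?_⟩
  · ext; simp
  · ext; simp
  · ext <;> simp

variable (E Q) in
/-- The canonical isomorphism `α_Q : TT*Q → T*TQ`, `(q, p, q̇, ṗ) ↦ (q, q̇, ṗ, p)`.
In Mathlib the tangent space at a point is the model space, through the preferred chart at that
point; at a point of `T*Q` or `TQ` over `q` this is the chart induced by the preferred chart of `Q`
at `q`.  So the components below are induced coordinates for one and the same chart of `Q`; the
covector `(ṗ, p)` at `(q, q̇)` is `(δq, δv) ↦ ṗ δq + p δv`. -/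
def alpha : TangentBundle (cModel E) (CQ E Q) ≃ CotangentBundle (tModel E) (TQ E Q) where
  toFun ξ :=
    let p : E →L[ℝ] ℝ := ξ.proj.2
    let w : E × (E →L[ℝ] ℝ) := ξ.2
    ⟨⟨ξ.proj.proj, w.1⟩, (w.2.coprod p : E × E →L[ℝ] ℝ)⟩
  invFun β :=
    let v : E := β.proj.2
    let b : E × E →L[ℝ] ℝ := β.2
    ⟨⟨β.proj.proj, (b ∘L ContinuousLinearMap.inr ℝ E E : E →L[ℝ] ℝ)⟩,
      ((v, b ∘L ContinuousLinearMap.inl ℝ E E) : E × (E →L[ℝ] ℝ))⟩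
  left_inv := by
    rintro ⟨⟨q, p⟩, ⟨v, w⟩⟩
    obtain ⟨h1, h2, -⟩ := coprod_inl_inr (E := E) w p 0
    exact congrArg₂ (fun a b : E →L[ℝ] ℝ =>
      (⟨⟨q, a⟩, ((v, b) : E × (E →L[ℝ] ℝ))⟩ : TangentBundle (cModel E) (CQ E Q))) h2 h1
  right_inv := by
    rintro ⟨⟨q, v⟩, b⟩
    exact congrArg (fun c : E × E →L[ℝ] ℝ =>
      (⟨⟨q, v⟩, c⟩ : CotangentBundle (tModel E) (TQ E Q))) (coprod_inl_inr (E := E) 0 0 b).2.2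

variable (E Q) in
/-- The diffeomorphism `Φ : T*Q × T*Q → T*(Q × Q)`, `(q₀, p₀; q₁, p₁) ↦ (q₀, q₁, -p₀, p₁)`. -/
def Phi : CQ E Q × CQ E Q ≃ CotangentBundle (𝓘(ℝ, E).prod 𝓘(ℝ, E)) (Q × Q) where
  toFun z :=
    let p₀ : E →L[ℝ] ℝ := z.1.2
    let p₁ : E →L[ℝ] ℝ := z.2.2
    ⟨(z.1.proj, z.2.proj), ((-p₀).coprod p₁ : E × E →L[ℝ] ℝ)⟩
  invFun β :=
    let b : E × E →L[ℝ] ℝ := β.2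
    (⟨β.proj.1, (-(b ∘L ContinuousLinearMap.inl ℝ E E) : E →L[ℝ] ℝ)⟩,
      ⟨β.proj.2, (b ∘L ContinuousLinearMap.inr ℝ E E : E →L[ℝ] ℝ)⟩)
  left_inv := by
    rintro ⟨⟨q₀, p₀⟩, ⟨q₁, p₁⟩⟩
    obtain ⟨h1, h2, -⟩ := coprod_inl_inr (E := E) (-(p₀ : E →L[ℝ] ℝ)) p₁ 0
    have h3 := (congrArg Neg.neg h1).trans (neg_neg (p₀ : E →L[ℝ] ℝ))
    exact congrArg₂ (fun a b : E →L[ℝ] ℝ => ((⟨q₀, a⟩, ⟨q₁, b⟩) : CQ E Q × CQ E Q)) h3 h2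
  right_inv := by
    rintro ⟨⟨q₀, q₁⟩, b⟩
    have h1 := neg_neg ((b : E × E →L[ℝ] ℝ) ∘L ContinuousLinearMap.inl ℝ E E)
    have h2 := (congrArg (fun a : E →L[ℝ] ℝ => a.coprod
      ((b : E × E →L[ℝ] ℝ) ∘L ContinuousLinearMap.inr ℝ E E)) h1).trans
        (coprod_inl_inr (E := E) 0 0 b).2.2
    exact congrArg (fun c : E × E →L[ℝ] ℝ =>
      (⟨(q₀, q₁), c⟩ : CotangentBundle (𝓘(ℝ, E).prod 𝓘(ℝ, E)) (Q × Q))) h2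

/-- The cotangent lift `R_d^{T*} = Φ⁻¹ ∘ R̂_d ∘ α_Q : TT*Q → T*Q × T*Q`. -/
def cotangentLift (R : TQ E Q → Q × Q) (ξ : TangentBundle (cModel E) (CQ E Q)) :
    CQ E Q × CQ E Q :=
  (Phi E Q).symm (hat (tModel E) (𝓘(ℝ, E).prod 𝓘(ℝ, E)) R (alpha E Q ξ))

/-- The part of `TT*Q` on which `R_d^{T*}` is defined when `R_d` is restricted to `V`. -/
def liftDomain (V : Set (TQ E Q)) : Set (TangentBundle (cModel E) (CQ E Q)) :=
  {ξ | (alpha E Q ξ).proj ∈ V}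

/-- If `R_d` is invertible on `V`, then so is `R_d^{T*}` over `V`: its inverse is single valued. -/
theorem cotangentLift_injOn {R : TQ E Q → Q × Q} {U V : Set (TQ E Q)}
    (h : IsInvertibleOn R U V) : Set.InjOn (cotangentLift R) (liftDomain V) := by
  intro ξ hξ η hη hR
  have h1 := (Phi E Q).symm.injective hR
  change (alpha E Q ξ).proj ∈ V at hξ
  change (alpha E Q η).proj ∈ V at hη
  apply (alpha E Q).injective
  generalize alpha E Q ξ = β at *
  generalize alpha E Q η = γ at *
  obtain ⟨v, b⟩ := β
  obtain ⟨w, c⟩ := γ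
  have h2 : R v = R w := congrArg Bundle.TotalSpace.proj h1
  obtain rfl : v = w := h.injOn hξ hη h2
  have h3 := eq_of_heq (Bundle.TotalSpace.mk.inj h1).2
  obtain ⟨D, hD⟩ : (mfderiv (tModel E) (𝓘(ℝ, E).prod 𝓘(ℝ, E)) R v).IsInvertible :=
    ⟨(h.localDiffeo v hξ).mfderivToContinuousLinearEquiv (by simp), rfl⟩
  simp only [← hD, ContinuousLinearMap.inverse_equiv] at h3
  have h4 : b = c := ContinuousLinearMap.ext fun x => by
    have := DFunLike.congr_fun h3 (D x)
    simpa using this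
  rw [h4]
section Scheme
variable [FiniteDimensional ℝ E]

/-- The pairs `(z₀, z₁)` that satisfy
`(R_d^{T*})⁻¹(z₀, z₁) = ω^♯(h dH(τ((R_d^{T*})⁻¹(z₀, z₁))))`, where `R_d` is restricted to `V`.
The point `ξ` below is the value `(R_d^{T*})⁻¹(z₀, z₁)`. -/
def scheme (R : TQ E Q → Q × Q) (V : Set (TQ E Q)) (H : CQ E Q → ℝ) (h : ℝ) :
    Set (CQ E Q × CQ E Q) :=
  {z | ∃ ξ : TangentBundle (cModel E) (CQ E Q), ξ ∈ liftDomain V ∧ cotangentLift R ξ = z ∧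
    ξ = ⟨ξ.proj, sharp ξ.proj (h • dH H ξ.proj)⟩}

end Scheme

/-- The symplectic form `Ω₁₂ = pr₂^*ω - pr₁^*ω` of `T*Q × T*Q`. -/
def omega12 (z : CQ E Q × CQ E Q) (ξ η : TangentSpace ((cModel E).prod (cModel E)) z) : ℝ :=
  omega z.2 ξ.2 η.2 - omega z.1 ξ.1 η.1

/-- `S` is a Lagrangian (embedded) submanifold of `T*Q × T*Q`: near each of its points it is
the image of an open set `D` of the model space under a smooth topological embedding `f` which is
an immersion and whose tangent spaces equal their orthogonal complements with respect to `Ω₁₂`. -/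
def IsLagrangianSubmanifold (S : Set (CQ E Q × CQ E Q)) : Prop :=
  ∀ z ∈ S, ∃ (D : Set (E × (E →L[ℝ] ℝ))) (f : E × (E →L[ℝ] ℝ) → CQ E Q × CQ E Q)
    (W : Set (CQ E Q × CQ E Q)),
    IsOpen D ∧ IsOpen W ∧ z ∈ W ∧ f '' D = S ∩ W ∧
    ContMDiffOn 𝓘(ℝ, E × (E →L[ℝ] ℝ)) ((cModel E).prod (cModel E)) ∞ f D ∧
    Topology.IsEmbedding (fun u : D => f u) ∧
    ∀ u ∈ D,
      Function.Injective (mfderiv 𝓘(ℝ, E × (E →L[ℝ] ℝ)) ((cModel E).prod (cModel E)) f u) ∧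
      ∀ η : TangentSpace ((cModel E).prod (cModel E)) (f u),
        η ∈ Set.range (mfderiv 𝓘(ℝ, E × (E →L[ℝ] ℝ)) ((cModel E).prod (cModel E)) f u) ↔
        ∀ ζ ∈ Set.range (mfderiv 𝓘(ℝ, E × (E →L[ℝ] ℝ)) ((cModel E).prod (cModel E)) f u),
          omega12 (f u) η ζ = 0

/-- On `A`, the map `φ : T*Q → T*Q` is a local diffeomorphism with `φ^*ω = ω`. -/
def IsLocalSymplectomorphismOn (φ : CQ E Q → CQ E Q) (A : Set (CQ E Q)) : Prop :=
  ∀ z ∈ A, IsLocalDiffeomorphAt (cModel E) (cModel E) ∞ φ z ∧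
    ∀ ξ η : TangentSpace (cModel E) z,
      omega (φ z) (mfderiv (cModel E) (cModel E) φ z ξ) (mfderiv (cModel E) (cModel E) φ z η) =
        omega z ξ η

/-- The velocity at time `0` of a curve `c` in `T*Q`, in the coordinates of the preferred chart at
`c 0`, that is, as an element of the model space of `T_{c(0)}T*Q`. -/
def velocityAtZero (c : ℝ → CQ E Q) : TangentSpace (cModel E) (c 0) :=
  mfderiv 𝓘(ℝ, ℝ) (cModel E) c 0 (1 : ℝ)

end Discretization

end

/-!
In a chart of `Q` the canonical map `α_Q` carries the vector `h X_H(z)` at `z = (q, p)` to the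
covector `(-h ∂H/∂q, p)` at `v = (q, h ∂H/∂p)`, that is, to `h` times `-∂H/∂q dq` plus `p dv`.
Its image under `R̂_d` and `Φ⁻¹` is the pair `(z₀, z₁)` with `p₁ dx₁ - p₀ dx₀ = -h ∂H/∂q dq + p dv`
on substituting `(x₀, x₁) = R_d(q, v)`. Pulled back along `z ↦ (z₀, z₁)`, the right-hand side is
`d(⟨p, h ∂H/∂p⟩ - h H)`. Hence `S_h`, the image of this map, is isotropic of half the dimension.
Since `R_d` is invertible on `V`, the point `z` is recovered smoothly from `(z₀, z₁)`, so the map is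
an embedding and `S_h` is Lagrangian. A smooth map whose graph lies in a Lagrangian submanifold
preserves `ω`.

At `h = 0` the parametrization is the diagonal, because `T R²_x - T R¹_x = Id` at the zero section
and `R_d(0_x) = (x, x)`. The inverse function theorem applied to `(h, z) ↦ (h, z₀)` therefore writes
`S_h` near the diagonal as the graph of a family `φ_h`. Differentiating the same two identities
along the zero section determines the mixed second derivatives of `R² - R¹`, and these give
`d/dh φ_h = X_H` at `h = 0`.
-/

noncomputable section

namespace Discretization

variable {E : Type*} [NormedAddCommGroup E] [NormedSpace ℝ E]
  {Q : Type*} [TopologicalSpace Q] [ChartedSpace E Q]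

section ModelDeriv

variable {F₁ F₂ K₁ K₂ M₁ M₂ : Type*}
  [NormedAddCommGroup F₁] [NormedSpace ℝ F₁] [NormedAddCommGroup F₂] [NormedSpace ℝ F₂]
  [TopologicalSpace K₁] [TopologicalSpace K₂]
  {I₁ : ModelWithCorners ℝ F₁ K₁} {I₂ : ModelWithCorners ℝ F₂ K₂}
  [TopologicalSpace M₁] [ChartedSpace K₁ M₁] [TopologicalSpace M₂] [ChartedSpace K₂ M₂]

variable (I₁ I₂) in
/-- The manifold derivative, with its type spelled out on the model spaces so that the calculus of
normed spaces applies to it. -/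
def modelDeriv (f : M₁ → M₂) (x : M₁) : F₁ →L[ℝ] F₂ :=
  mfderiv I₁ I₂ f x

theorem hasFDerivAt_comp_extChartAt_symm [I₁.Boundaryless] {f : M₁ → F₂} {x : M₁}
    {L : F₁ →L[ℝ] F₂} (hf : HasMFDerivAt I₁ 𝓘(ℝ, F₂) f x L) :
    HasFDerivAt (f ∘ (extChartAt I₁ x).symm) L (extChartAt I₁ x x) := by
  have h : HasFDerivWithinAt (writtenInExtChartAt I₁ 𝓘(ℝ, F₂) x f) L (Set.range I₁)
      (extChartAt I₁ x x) := hf.2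
  rwa [ModelWithCorners.range_eq_univ, hasFDerivWithinAt_univ] at h

end ModelDeriv

section BaseChart

variable (E) in
/-- The derivative at `q` of the preferred chart of `Q` at `b`, on the model space. -/
def baseDeriv (b q : Q) : E →L[ℝ] E :=
  modelDeriv 𝓘(ℝ, E) 𝓘(ℝ, E) (extChartAt 𝓘(ℝ, E) b) q

theorem isManifold_one [IsManifold 𝓘(ℝ, E) ∞ Q] : IsManifold 𝓘(ℝ, E) 1 Q :=
  IsManifold.of_le (n := ∞) (by simp)

theorem baseDeriv_self [IsManifold 𝓘(ℝ, E) ∞ Q] (b : Q) :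
    baseDeriv E b b = ContinuousLinearMap.id ℝ E := by
  have := isManifold_one (E := E) (Q := Q)
  exact mfderiv_extChartAt_self (I := 𝓘(ℝ, E)) (x := b)

theorem isInvertible_baseDeriv [IsManifold 𝓘(ℝ, E) ∞ Q] {b q : Q}
    (hq : q ∈ (chartAt E b).source) : (baseDeriv E b q).IsInvertible := by
  have := isManifold_one (E := E) (Q := Q)
  exact isInvertible_mfderiv_extChartAt (I := 𝓘(ℝ, E)) (x := b) (by simpa using hq)

theorem hasMFDerivAt_extChartAt [IsManifold 𝓘(ℝ, E) ∞ Q] {b q : Q}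
    (hq : q ∈ (chartAt E b).source) :
    HasMFDerivAt 𝓘(ℝ, E) 𝓘(ℝ, E) (extChartAt 𝓘(ℝ, E) b) q (baseDeriv E b q) := by
  have := isManifold_one (E := E) (Q := Q)
  exact (mdifferentiableAt_extChartAt hq).hasMFDerivAt

end BaseChart

section BundleChart

variable {F : Type*} [NormedAddCommGroup F] {Z : Q → Type*}
  [TopologicalSpace (Bundle.TotalSpace F Z)] [∀ x, TopologicalSpace (Z x)] [FiberBundle F Z]

variable (E F Z) in
/-- The chart of the total space of a fibre bundle over `Q` induced by the preferred chart of `Q`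
and the preferred trivialization at `b`. -/
def bundleChart (b : Q) : PartialEquiv (Bundle.TotalSpace F Z) (E × F) :=
  (trivializationAt F Z b).toPartialEquiv ≫ (extChartAt 𝓘(ℝ, E) b).prod (PartialEquiv.refl F)

theorem bundleChart_fst (b : Q) (z : Bundle.TotalSpace F Z)
    (hz : z ∈ (bundleChart E F Z b).source) :
    (bundleChart E F Z b z).1 = extChartAt 𝓘(ℝ, E) b z.proj := by
  have h : z ∈ (trivializationAt F Z b).source := hz.1
  exact congrArg (extChartAt 𝓘(ℝ, E) b) ((trivializationAt F Z b).coe_fst h)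

theorem proj_mem_chartAt_source {b : Q} {z : Bundle.TotalSpace F Z}
    (hz : z ∈ (bundleChart E F Z b).source) : z.proj ∈ (chartAt E b).source := by
  have h : z ∈ (trivializationAt F Z b).source := hz.1
  simpa [(trivializationAt F Z b).coe_fst h] using hz.2.1

theorem proj_bundleChart_symm {b : Q} {u : E × F} (hu : u ∈ (bundleChart E F Z b).target) :
    ((bundleChart E F Z b).symm u).proj = (extChartAt 𝓘(ℝ, E) b).symm u.1 := by
  have hs := (bundleChart E F Z b).map_target hu
  have h := bundleChart_fst b _ hs
  rw [(bundleChart E F Z b).right_inv hu] at h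
  rw [h, (extChartAt 𝓘(ℝ, E) b).left_inv]
  simpa using proj_mem_chartAt_source hs

variable [NormedSpace ℝ F]

theorem extChartAt_eq_bundleChart (z : Bundle.TotalSpace F Z) :
    extChartAt (𝓘(ℝ, E).prod 𝓘(ℝ, F)) z = bundleChart E F Z z.proj :=
  FiberBundle.extChartAt z

theorem mem_bundleChart_source_proj (z : Bundle.TotalSpace F Z) :
    z ∈ (bundleChart E F Z z.proj).source := by
  rw [← extChartAt_eq_bundleChart]
  exact mem_extChartAt_source z

variable [∀ x, AddCommGroup (Z x)]

theorem bundleChart_eq_extChartAt (b : Q) :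
    bundleChart E F Z b = extChartAt (𝓘(ℝ, E).prod 𝓘(ℝ, F)) (⟨b, 0⟩ : Bundle.TotalSpace F Z) :=
  (extChartAt_eq_bundleChart (⟨b, 0⟩ : Bundle.TotalSpace F Z)).symm

theorem isOpen_bundleChart_source (b : Q) : IsOpen (bundleChart E F Z b).source := by
  rw [bundleChart_eq_extChartAt]
  exact isOpen_extChartAt_source _

theorem isOpen_bundleChart_target (b : Q) : IsOpen (bundleChart E F Z b).target := by
  rw [bundleChart_eq_extChartAt]
  exact isOpen_extChartAt_target _

variable [∀ x, Module ℝ (Z x)] [IsManifold 𝓘(ℝ, E) ∞ Q] [VectorBundle ℝ F Z]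
  [ContMDiffVectorBundle ∞ F Z 𝓘(ℝ, E)]

theorem contMDiffAt_bundleChart {b : Q} {z : Bundle.TotalSpace F Z}
    (hz : z ∈ (bundleChart E F Z b).source) :
    ContMDiffAt (𝓘(ℝ, E).prod 𝓘(ℝ, F)) 𝓘(ℝ, E × F) ∞ (bundleChart E F Z b) z := by
  rw [bundleChart_eq_extChartAt] at hz ⊢
  exact contMDiffAt_extChartAt' (by rwa [extChartAt_source] at hz)

theorem contMDiffAt_bundleChart_symm {b : Q} {u : E × F} (hu : u ∈ (bundleChart E F Z b).target) :
    ContMDiffAt 𝓘(ℝ, E × F) (𝓘(ℝ, E).prod 𝓘(ℝ, F)) ∞ (bundleChart E F Z b).symm u := by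
  have ho := (isOpen_bundleChart_target b).mem_nhds hu
  rw [bundleChart_eq_extChartAt] at ho ⊢
  exact (contMDiffOn_extChartAt_symm (⟨b, 0⟩ : Bundle.TotalSpace F Z)).contMDiffAt ho

theorem contMDiffAt_of_bundleChart_eq {G K X : Type*} [NormedAddCommGroup G] [NormedSpace ℝ G]
    [TopologicalSpace K] {I : ModelWithCorners ℝ G K} [TopologicalSpace X] [ChartedSpace K X]
    {b : Q} {f : X → Bundle.TotalSpace F Z} {g : X → E × F} {x : X}
    (hfg : ∀ᶠ w in 𝓝 x, f w ∈ (bundleChart E F Z b).source ∧ bundleChart E F Z b (f w) = g w)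
    (hg : ContMDiffAt I 𝓘(ℝ, E × F) ∞ g x) :
    ContMDiffAt I (𝓘(ℝ, E).prod 𝓘(ℝ, F)) ∞ f x := by
  obtain ⟨hfx, hgx⟩ := hfg.self_of_nhds
  have hsymm := contMDiffAt_bundleChart_symm ((bundleChart E F Z b).map_source hfx)
  rw [hgx] at hsymm
  refine (hsymm.comp x hg).congr_of_eventuallyEq ?_
  filter_upwards [hfg] with w ⟨hfw, hgw⟩
  rw [Function.comp_apply, ← hgw, (bundleChart E F Z b).left_inv hfw]

variable (E F Z) in
/-- The derivative at `z` of the bundle chart at `b`, on the model space. -/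
def bundleChartDeriv (b : Q) (z : Bundle.TotalSpace F Z) : E × F →L[ℝ] E × F :=
  modelDeriv (𝓘(ℝ, E).prod 𝓘(ℝ, F)) 𝓘(ℝ, E × F) (bundleChart E F Z b) z

theorem hasMFDerivAt_bundleChart {b : Q} {z : Bundle.TotalSpace F Z}
    (hz : z ∈ (bundleChart E F Z b).source) :
    HasMFDerivAt (𝓘(ℝ, E).prod 𝓘(ℝ, F)) 𝓘(ℝ, E × F) (bundleChart E F Z b) z
      (bundleChartDeriv E F Z b z) :=
  ((contMDiffAt_bundleChart hz).mdifferentiableAt (by simp)).hasMFDerivAt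

theorem isInvertible_bundleChartDeriv {b : Q} {z : Bundle.TotalSpace F Z}
    (hz : z ∈ (bundleChart E F Z b).source) : (bundleChartDeriv E F Z b z).IsInvertible := by
  have : IsManifold (𝓘(ℝ, E).prod 𝓘(ℝ, F)) 1 (Bundle.TotalSpace F Z) :=
    IsManifold.of_le (n := ∞) (by simp)
  unfold bundleChartDeriv
  rw [bundleChart_eq_extChartAt] at hz ⊢
  exact isInvertible_mfderiv_extChartAt hz

theorem bundleChartDeriv_proj (z : Bundle.TotalSpace F Z) :
    bundleChartDeriv E F Z z.proj z = ContinuousLinearMap.id ℝ (E × F) := by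
  have : IsManifold (𝓘(ℝ, E).prod 𝓘(ℝ, F)) 1 (Bundle.TotalSpace F Z) :=
    IsManifold.of_le (n := ∞) (by simp)
  unfold bundleChartDeriv
  rw [← extChartAt_eq_bundleChart]
  exact mfderiv_extChartAt_self (I := 𝓘(ℝ, E).prod 𝓘(ℝ, F)) (x := z)

theorem hasFDerivAt_bundleChart_comp_symm {b : Q} {z : Bundle.TotalSpace F Z}
    (hz : z ∈ (bundleChart E F Z b).source) :
    HasFDerivAt (bundleChart E F Z b ∘ (bundleChart E F Z z.proj).symm) (bundleChartDeriv E F Z b z)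
      (bundleChart E F Z z.proj z) := by
  rw [← extChartAt_eq_bundleChart z]
  exact hasFDerivAt_comp_extChartAt_symm (hasMFDerivAt_bundleChart hz)

theorem eventually_bundleChart_symm {b : Q} {z : Bundle.TotalSpace F Z}
    (hz : z ∈ (bundleChart E F Z b).source) {p : Bundle.TotalSpace F Z → Prop}
    (hp : ∀ᶠ w in 𝓝 z, p w) :
    ∀ᶠ u in 𝓝 (bundleChart E F Z b z), u ∈ (bundleChart E F Z b).target ∧
      p ((bundleChart E F Z b).symm u) := by
  have ht := (bundleChart E F Z b).map_source hz
  have hsymm := (contMDiffAt_bundleChart_symm ht).continuousAt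
  rw [ContinuousAt, (bundleChart E F Z b).left_inv hz] at hsymm
  exact ((isOpen_bundleChart_target b).eventually_mem ht).and (hsymm.eventually hp)

theorem eventually_mem_bundleChart_transition {b : Q} {z : Bundle.TotalSpace F Z}
    (hz : z ∈ (bundleChart E F Z b).source) :
    ∀ᶠ u in 𝓝 (bundleChart E F Z z.proj z), u ∈ (bundleChart E F Z z.proj).target ∧
      (bundleChart E F Z z.proj).symm u ∈ (bundleChart E F Z b).source :=
  eventually_bundleChart_symm (mem_bundleChart_source_proj z)
    ((isOpen_bundleChart_source b).eventually_mem hz)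

theorem bundleChartDeriv_fst {b : Q} {z : Bundle.TotalSpace F Z}
    (hz : z ∈ (bundleChart E F Z b).source) (ζ : E × F) :
    (bundleChartDeriv E F Z b z ζ).1 = baseDeriv E b z.proj ζ.1 := by
  have hbase := hasFDerivAt_comp_extChartAt_symm
    (hasMFDerivAt_extChartAt (proj_mem_chartAt_source hz))
  rw [← bundleChart_fst z.proj z (mem_bundleChart_source_proj z)] at hbase
  have hfst : Prod.fst ∘ bundleChart E F Z b ∘ (bundleChart E F Z z.proj).symm
      =ᶠ[𝓝 (bundleChart E F Z z.proj z)]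
      (extChartAt 𝓘(ℝ, E) b ∘ (extChartAt 𝓘(ℝ, E) z.proj).symm) ∘ Prod.fst := by
    filter_upwards [eventually_mem_bundleChart_transition hz] with u hu
    simp only [Function.comp_apply, bundleChart_fst _ _ hu.2, proj_bundleChart_symm hu.1]
  have h := (hasFDerivAt_fst.comp _ (hasFDerivAt_bundleChart_comp_symm hz)).unique
    ((hbase.comp _ hasFDerivAt_fst).congr_of_eventuallyEq hfst)
  exact DFunLike.congr_fun h ζ

end BundleChart

section CotangentCharts

variable [IsManifold 𝓘(ℝ, E) ∞ Q]

variable (E) in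
/-- The chart of `T*Q` induced by the preferred chart of `Q` at `b`. -/
abbrev cotChart (b : Q) : PartialEquiv (CQ E Q) (E × (E →L[ℝ] ℝ)) :=
  bundleChart E (E →L[ℝ] ℝ) (fun x : Q => CotangentSpace 𝓘(ℝ, E) x) b

variable (E) in
/-- The chart of `TQ` induced by the preferred chart of `Q` at `b`. -/
abbrev tanChart (b : Q) : PartialEquiv (TQ E Q) (E × E) :=
  bundleChart E E (TangentSpace 𝓘(ℝ, E) : Q → Type _) b

variable (E) in
/-- The derivative at `z` of the chart of `T*Q` over `b`. -/
abbrev cotDeriv (b : Q) (z : CQ E Q) : E × (E →L[ℝ] ℝ) →L[ℝ] E × (E →L[ℝ] ℝ) :=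
  bundleChartDeriv E (E →L[ℝ] ℝ) (fun x : Q => CotangentSpace 𝓘(ℝ, E) x) b z

variable (E) in
/-- The derivative at `v` of the chart of `TQ` over `b`. -/
abbrev tanDeriv (b : Q) (v : TQ E Q) : E × E →L[ℝ] E × E :=
  bundleChartDeriv E E (TangentSpace 𝓘(ℝ, E) : Q → Type _) b v

/-- The covector underlying a point of `T*Q`, on the model space. -/
def covector (z : CQ E Q) : E →L[ℝ] ℝ := z.2

/-- The vector underlying a point of `TQ`, on the model space. -/
def vector (v : TQ E Q) : E := v.2

theorem mem_cotChart_source {b : Q} {z : CQ E Q} :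
    z ∈ (cotChart E b).source ↔ z.proj ∈ (chartAt E b).source := by
  simp only [bundleChart, mfld_simps]
  exact ⟨fun h => h.1.1, fun h => ⟨⟨h, trivial⟩, h⟩⟩

theorem mem_tanChart_source {b : Q} {v : TQ E Q} :
    v ∈ (tanChart E b).source ↔ v.proj ∈ (chartAt E b).source := by
  simp [bundleChart]

theorem mem_cotChart_target {b : Q} {u : E × (E →L[ℝ] ℝ)} :
    u ∈ (cotChart E b).target ↔ u.1 ∈ (extChartAt 𝓘(ℝ, E) b).target := by
  simp +contextual [bundleChart, OpenPartialHomeomorph.map_target]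

theorem mem_tanChart_target {b : Q} {u : E × E} :
    u ∈ (tanChart E b).target ↔ u.1 ∈ (extChartAt 𝓘(ℝ, E) b).target := by
  simp +contextual [bundleChart, OpenPartialHomeomorph.map_target]

theorem tanChart_fst (b : Q) (v : TQ E Q) : (tanChart E b v).1 = extChartAt 𝓘(ℝ, E) b v.proj := rfl

theorem tanChart_snd {b : Q} {v : TQ E Q} (hv : v.proj ∈ (chartAt E b).source) :
    (tanChart E b v).2 = baseDeriv E b v.proj (vector v) := by
  have := isManifold_one (E := E) (Q := Q)
  have htriv : (tanChart E b v).2 =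
      (trivializationAt E (TangentSpace 𝓘(ℝ, E)) b).continuousLinearMapAt ℝ v.proj v.2 := by
    rw [Bundle.Trivialization.continuousLinearMapAt_apply, Bundle.Trivialization.linearMapAt_apply,
      if_pos (by simpa using hv)]
    rfl
  rw [htriv]
  exact DFunLike.congr_fun
    (TangentBundle.continuousLinearMapAt_trivializationAt (I := 𝓘(ℝ, E)) (x₀ := b) hv) v.2

theorem cotChart_snd {b : Q} {z : CQ E Q} (hz : z.proj ∈ (chartAt E b).source) (ξ : E) :
    (cotChart E b z).2 (baseDeriv E b z.proj ξ) = covector z ξ := by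
  have := isManifold_one (E := E) (Q := Q)
  let t := trivializationAt E (TangentSpace 𝓘(ℝ, E)) b
  have htriv : (cotChart E b z).2 =
      (z.2 : TangentSpace 𝓘(ℝ, E) z.proj →L[ℝ] ℝ) ∘L t.symmL ℝ z.proj := by
    ext v
    simp [bundleChart, hom_trivializationAt_apply, ContinuousLinearMap.inCoordinates, t]
  have hξ : t.continuousLinearMapAt ℝ z.proj ξ = baseDeriv E b z.proj ξ :=
    DFunLike.congr_fun
      (TangentBundle.continuousLinearMapAt_trivializationAt (I := 𝓘(ℝ, E)) (x₀ := b) hz) ξ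
  rw [htriv, ← hξ]
  exact congrArg (covector z) (t.symmL_continuousLinearMapAt (by simpa [t] using hz) ξ)

theorem cotChart_proj (z : CQ E Q) :
    cotChart E z.proj z = (extChartAt 𝓘(ℝ, E) z.proj z.proj, covector z) := by
  refine Prod.ext rfl (ContinuousLinearMap.ext fun ξ => ?_)
  have h := cotChart_snd (mem_chart_source E z.proj) ξ
  rwa [baseDeriv_self] at h

theorem tanChart_proj (v : TQ E Q) :
    tanChart E v.proj v = (extChartAt 𝓘(ℝ, E) v.proj v.proj, vector v) := by
  refine Prod.ext rfl ?_
  rw [tanChart_snd (mem_chart_source E v.proj), baseDeriv_self, ContinuousLinearMap.id_apply]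

theorem pairing_cotChart_tanChart {b : Q} {z : CQ E Q} {v : TQ E Q} (h : z.proj = v.proj)
    (hz : z.proj ∈ (chartAt E b).source) :
    (cotChart E b z).2 (tanChart E b v).2 = covector z (vector v) := by
  rw [tanChart_snd (h ▸ hz), ← h, cotChart_snd hz]

theorem pairing_chart_transition {b q : Q} {u : E × (E →L[ℝ] ℝ)}
    (hu : u ∈ (cotChart E q).target)
    (hb : (cotChart E q).symm u ∈ (cotChart E b).source) (w : E) :
    (cotChart E b ((cotChart E q).symm u)).2 (tanChart E b ((tanChart E q).symm (u.1, w))).2 =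
      u.2 w := by
  have hw : (u.1, w) ∈ (tanChart E q).target := mem_tanChart_target.2 (mem_cotChart_target.1 hu)
  have hproj : ((cotChart E q).symm u).proj = ((tanChart E q).symm (u.1, w)).proj :=
    (proj_bundleChart_symm hu).trans (proj_bundleChart_symm hw).symm
  have hq := mem_cotChart_source.1 ((cotChart E q).map_target hu)
  rw [pairing_cotChart_tanChart hproj (mem_cotChart_source.1 hb),
    ← pairing_cotChart_tanChart hproj hq, (cotChart E q).right_inv hu, (tanChart E q).right_inv hw]

theorem pairing_deriv_of_pairing_eq {f : E × (E →L[ℝ] ℝ) → E × (E →L[ℝ] ℝ)}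
    {f' : E × (E →L[ℝ] ℝ) →L[ℝ] E × (E →L[ℝ] ℝ)} {g : E × E → E × E} {g' : E × E →L[ℝ] E × E}
    {x w : E} {p : E →L[ℝ] ℝ} (hf : HasFDerivAt f f' (x, p)) (hg : HasFDerivAt g g' (x, w))
    (hfg : ∀ᶠ u in 𝓝 (x, p), ∀ w, (f u).2 (g (u.1, w)).2 = u.2 w)
    (δ ε : E) (ϖ : E →L[ℝ] ℝ) :
    (f' (δ, ϖ)).2 (g (x, w)).2 + (f (x, p)).2 (g' (δ, ε)).2 = ϖ w + p ε := by
  let y : (E × (E →L[ℝ] ℝ)) × E := ((x, p), w)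
  let i : (E × (E →L[ℝ] ℝ)) × E →L[ℝ] E × E :=
    (ContinuousLinearMap.fst ℝ E (E →L[ℝ] ℝ)).prodMap (ContinuousLinearMap.id ℝ E)
  have hf₁ : HasFDerivAt (fun u => f u.1) (f' ∘L .fst ℝ _ _) y :=
    HasFDerivAt.comp (g := f) y hf hasFDerivAt_fst
  have hg₁ : HasFDerivAt (fun u => g (i u)) (g' ∘L i) y :=
    HasFDerivAt.comp (g := g) y hg i.hasFDerivAt
  have hpairing : HasFDerivAt (fun u : (E × (E →L[ℝ] ℝ)) × E => u.1.2 u.2) _ y :=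
    hasFDerivAt_fst.snd.clm_apply hasFDerivAt_snd
  have heq : (fun u : (E × (E →L[ℝ] ℝ)) × E => (f u.1).2 (g (i u)).2) =ᶠ[𝓝 y]
      fun u => u.1.2 u.2 :=
    (continuousAt_fst.eventually hfg).mono fun u hu => hu u.2
  have hderiv := DFunLike.congr_fun ((hf₁.snd.clm_apply hg₁.snd).unique
    (hpairing.congr_of_eventuallyEq heq)) ((δ, ϖ), ε)
  rw [add_comm, add_comm (ϖ w)]
  exact hderiv

theorem pairing_cotDeriv_tanDeriv {b : Q} {z : CQ E Q} {v : TQ E Q} (h : z.proj = v.proj)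
    (hz : z.proj ∈ (chartAt E b).source) (δ : E) (ϖ : E →L[ℝ] ℝ) (ε : E) :
    (cotDeriv E b z (δ, ϖ)).2 (baseDeriv E b z.proj (vector v)) +
      (cotChart E b z).2 (tanDeriv E b v (δ, ε)).2 = ϖ (vector v) + covector z ε := by
  have hzs := mem_cotChart_source.2 hz
  have hvs : v ∈ (tanChart E b).source := mem_tanChart_source.2 (h ▸ hz)
  have hcot := hasFDerivAt_bundleChart_comp_symm hzs
  have htan := hasFDerivAt_bundleChart_comp_symm hvs
  have htransition := eventually_mem_bundleChart_transition hzs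
  have hzz := (cotChart E z.proj).left_inv (mem_bundleChart_source_proj z)
  have hvv := (tanChart E v.proj).left_inv (mem_bundleChart_source_proj v)
  rw [cotChart_proj] at hcot htransition hzz
  rw [tanChart_proj] at htan hvv
  rw [← h] at htan hvv
  have key := pairing_deriv_of_pairing_eq hcot htan
    (htransition.mono fun u hu => pairing_chart_transition hu.1 hu.2) δ ε ϖ
  simpa only [Function.comp_apply, hzz, hvv, tanChart_snd (h ▸ hz), ← h] using key

end CotangentCharts

section Momenta

/-- The covectors `(p₀, p₁)` with `p₁ x₁ - p₀ x₀ = β (A⁻¹ (x₀, x₁))`: the coordinate expression of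
`β ↦ Φ⁻¹ (β ∘ A⁻¹)`, where `A` is the derivative of the discretization map. -/
def momenta (A : E × E →L[ℝ] E × E) (β : E × E →L[ℝ] ℝ) : (E →L[ℝ] ℝ) × (E →L[ℝ] ℝ) :=
  (-((β ∘L A.inverse) ∘L ContinuousLinearMap.inl ℝ E E),
    (β ∘L A.inverse) ∘L ContinuousLinearMap.inr ℝ E E)

theorem momenta_pairing {A : E × E →L[ℝ] E × E} (hA : A.IsInvertible) (β : E × E →L[ℝ] ℝ)
    (ζ : E × E) : (momenta A β).2 (A ζ).2 - (momenta A β).1 (A ζ).1 = β ζ := by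
  calc (momenta A β).2 (A ζ).2 - (momenta A β).1 (A ζ).1
      = β (A.inverse (0, (A ζ).2)) + β (A.inverse ((A ζ).1, 0)) := by simp [momenta]
    _ = β (A.inverse (A ζ)) := by rw [← map_add, ← map_add]; simp
    _ = β ζ := by rw [hA.inverse_apply_self]

theorem eq_momenta {A : E × E →L[ℝ] E × E} (hA : A.IsInvertible) {β : E × E →L[ℝ] ℝ}
    {p : (E →L[ℝ] ℝ) × (E →L[ℝ] ℝ)} (hp : ∀ ζ, p.2 (A ζ).2 - p.1 (A ζ).1 = β ζ) :
    p = momenta A β := by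
  refine Prod.ext (ContinuousLinearMap.ext fun e => ?_) (ContinuousLinearMap.ext fun e => ?_)
  · have := hp (A.inverse (e, 0))
    simp only [hA.self_apply_inverse, map_zero, zero_sub] at this
    simp [momenta, ← this]
  · have := hp (A.inverse (0, e))
    simp only [hA.self_apply_inverse, map_zero, sub_zero] at this
    simp [momenta, ← this]

theorem contDiffAt_momenta [CompleteSpace E] {W : Type*} [NormedAddCommGroup W] [NormedSpace ℝ W]
    {n : WithTop ℕ∞} {A : W → E × E →L[ℝ] E × E} {β : W → E × E →L[ℝ] ℝ} {w : W}
    (hA : ContDiffAt ℝ n A w) (hβ : ContDiffAt ℝ n β w) (hAw : (A w).IsInvertible) :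
    ContDiffAt ℝ n (fun w => momenta (A w) (β w)) w := by
  have hβA : ContDiffAt ℝ n (fun w => β w ∘L (A w).inverse) w :=
    hβ.clm_comp (hAw.contDiffAt_map_inverse.comp w hA)
  exact (hβA.clm_comp contDiffAt_const).neg.prodMk (hβA.clm_comp contDiffAt_const)

end Momenta

section Exactness

theorem minSmoothness_two_le : minSmoothness ℝ 2 ≤ (∞ : WithTop ℕ∞) := by
  rw [minSmoothness_of_isRCLikeNormedField]
  exact WithTop.coe_le_coe.2 (le_top : (2 : ℕ∞) ≤ ⊤)

theorem hasFDerivAt_fderiv {W G : Type*} [NormedAddCommGroup W] [NormedSpace ℝ W]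
    [NormedAddCommGroup G] [NormedSpace ℝ G] {f : W → G} {u : W} (hf : ContDiffAt ℝ ∞ f u) :
    HasFDerivAt (fderiv ℝ f) (fderiv ℝ (fderiv ℝ f) u) u :=
  ((hf.fderiv_right (m := ∞) (by simp)).differentiableAt (by simp)).hasFDerivAt

/-- By symmetry of second derivatives, only the terms with `dp₀` and `dp₁` survive when `h` is
differentiated once more and antisymmetrized. -/
theorem wedge_eq_of_exact {W : Type*} [NormedAddCommGroup W] [NormedSpace ℝ W]
    {x₀ x₁ : W → E} {p₀ p₁ : W → E →L[ℝ] ℝ} {L : W → ℝ} {u : W}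
    (hx₀ : ContDiffAt ℝ ∞ x₀ u) (hx₁ : ContDiffAt ℝ ∞ x₁ u)
    (hp₀ : DifferentiableAt ℝ p₀ u) (hp₁ : DifferentiableAt ℝ p₁ u) (hL : ContDiffAt ℝ ∞ L u)
    (h : ∀ᶠ w in 𝓝 u, ∀ ξ, p₁ w (fderiv ℝ x₁ w ξ) - p₀ w (fderiv ℝ x₀ w ξ) = fderiv ℝ L w ξ)
    (ξ η : W) :
    fderiv ℝ p₁ u η (fderiv ℝ x₁ u ξ) - fderiv ℝ p₁ u ξ (fderiv ℝ x₁ u η) =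
      fderiv ℝ p₀ u η (fderiv ℝ x₀ u ξ) - fderiv ℝ p₀ u ξ (fderiv ℝ x₀ u η) := by
  have second_deriv (a c : W) :
      fderiv ℝ p₁ u c (fderiv ℝ x₁ u a) + p₁ u (fderiv ℝ (fderiv ℝ x₁) u c a) -
        (fderiv ℝ p₀ u c (fderiv ℝ x₀ u a) + p₀ u (fderiv ℝ (fderiv ℝ x₀) u c a)) =
      fderiv ℝ (fderiv ℝ L) u c a := by
    have d₁ := hp₁.hasFDerivAt.clm_apply
      ((hasFDerivAt_fderiv hx₁).clm_apply (hasFDerivAt_const a u))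
    have d₀ := hp₀.hasFDerivAt.clm_apply
      ((hasFDerivAt_fderiv hx₀).clm_apply (hasFDerivAt_const a u))
    have dL := ((hasFDerivAt_fderiv hL).clm_apply (hasFDerivAt_const a u)).congr_of_eventuallyEq
      (h.mono fun w hw => hw a)
    have := DFunLike.congr_fun ((d₁.sub d₀).unique dL) c
    simp only [sub_apply, add_apply, ContinuousLinearMap.comp_apply, zero_apply,
      zero_add, map_zero, ContinuousLinearMap.flip_apply] at this
    linarith
  have symm₀ := (hx₀.isSymmSndFDerivAt minSmoothness_two_le) ξ η
  have symm₁ := (hx₁.isSymmSndFDerivAt minSmoothness_two_le) ξ η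
  have symmL := (hL.isSymmSndFDerivAt minSmoothness_two_le) ξ η
  have hξη := second_deriv ξ η
  have hηξ := second_deriv η ξ
  rw [symm₀, symm₁, symmL] at hηξ
  linarith

end Exactness

section ModelScheme

variable [FiniteDimensional ℝ E]

variable (E) in
/-- The map `ω^♯` on the model space, `D ↦ (∂D/∂p, -∂D/∂q)`; it is read off `sharp` because its
first component involves the identification of `E` with its bidual. -/
def sharpModel : (E × (E →L[ℝ] ℝ) →L[ℝ] ℝ) →L[ℝ] E × (E →L[ℝ] ℝ) :=
  let s : (E × (E →L[ℝ] ℝ) →L[ℝ] ℝ) →ₗ[ℝ] E × (E →L[ℝ] ℝ) :=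
    (sharp (Q := E) (⟨0, 0⟩ : CQ E E)).toLinearMap
  ⟨s, LinearMap.continuous_of_finiteDimensional (𝕜 := ℝ)
    (E := E × (E →L[ℝ] ℝ) →L[ℝ] ℝ) (F' := E × (E →L[ℝ] ℝ)) s⟩

theorem sharpModel_spec (D : E × (E →L[ℝ] ℝ) →L[ℝ] ℝ) (η : E × (E →L[ℝ] ℝ)) :
    D η = η.2 (sharpModel E D).1 - (sharpModel E D).2 η.1 := by
  have flat_sharp : flat (Q := E) (⟨0, 0⟩ : CQ E E) (sharp (Q := E) (⟨0, 0⟩ : CQ E E) D) = D :=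
    LinearEquiv.apply_symm_apply (LinearEquiv.ofBijective _ (flat_bijective _)) D
  exact (DFunLike.congr_fun flat_sharp η).symm.trans
    (omega_apply (Q := E) (⟨0, 0⟩ : CQ E E) (sharpModel E D) η)

/-- The Hamiltonian vector field of a function on the model space. -/
def hamField (K : E × (E →L[ℝ] ℝ) → ℝ) (u : E × (E →L[ℝ] ℝ)) : E × (E →L[ℝ] ℝ) :=
  sharpModel E (fderiv ℝ K u)

theorem fderiv_eq_hamField (K : E × (E →L[ℝ] ℝ) → ℝ) (u η : E × (E →L[ℝ] ℝ)) :
    fderiv ℝ K u η = η.2 (hamField K u).1 - (hamField K u).2 η.1 :=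
  sharpModel_spec _ _

theorem contDiffAt_hamField {K : E × (E →L[ℝ] ℝ) → ℝ} {u : E × (E →L[ℝ] ℝ)}
    (hK : ContDiffAt ℝ ∞ K u) : ContDiffAt ℝ ∞ (hamField K) u :=
  (sharpModel E).contDiff.contDiffAt.comp u (hK.fderiv_right (by simp))

/-- The point of the tangent bundle underlying `h X_K(u)`. -/
def modelStep (K : E × (E →L[ℝ] ℝ) → ℝ) (h : ℝ) (u : E × (E →L[ℝ] ℝ)) : E × E :=
  (u.1, h • (hamField K u).1)

/-- The covector `α (h X_K(u))`, at the point `modelStep K h u`. -/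
def modelForce (K : E × (E →L[ℝ] ℝ) → ℝ) (h : ℝ) (u : E × (E →L[ℝ] ℝ)) : E × E →L[ℝ] ℝ :=
  (h • (hamField K u).2) ∘L ContinuousLinearMap.fst ℝ E E + u.2 ∘L ContinuousLinearMap.snd ℝ E E

/-- The parametrization `u ↦ R_d^{T*}(h X_K(u))` of the scheme in coordinates, where `r` is the
coordinate expression of the discretization map and `K` that of the Hamiltonian. -/
def modelScheme (r : E × E → E × E) (K : E × (E →L[ℝ] ℝ) → ℝ) (h : ℝ) (u : E × (E →L[ℝ] ℝ)) :
    (E × (E →L[ℝ] ℝ)) × (E × (E →L[ℝ] ℝ)) :=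
  let p := momenta (fderiv ℝ r (modelStep K h u)) (modelForce K h u)
  (((r (modelStep K h u)).1, p.1), ((r (modelStep K h u)).2, p.2))

/-- The conditions under which `modelScheme r K h` is smooth at `u`. -/
structure IsRegularAt (r : E × E → E × E) (K : E × (E →L[ℝ] ℝ) → ℝ) (h : ℝ)
    (u : E × (E →L[ℝ] ℝ)) : Prop where
  hamiltonian : ContDiffAt ℝ ∞ K u
  map : ContDiffAt ℝ ∞ r (modelStep K h u)
  isInvertible : (fderiv ℝ r (modelStep K h u)).IsInvertible

variable {r : E × E → E × E} {K : E × (E →L[ℝ] ℝ) → ℝ} {h : ℝ} {u : E × (E →L[ℝ] ℝ)}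

theorem contDiffAt_modelStep (hK : ContDiffAt ℝ ∞ K u) :
    ContDiffAt ℝ ∞ (fun y : ℝ × (E × (E →L[ℝ] ℝ)) => modelStep K y.1 y.2) (h, u) :=
  contDiffAt_snd.fst.prodMk
    (contDiffAt_fst.smul (ContDiffAt.comp (g := hamField K) (h, u) (contDiffAt_hamField hK)
      contDiffAt_snd).fst)

theorem contDiffAt_modelForce (hK : ContDiffAt ℝ ∞ K u) :
    ContDiffAt ℝ ∞ (fun y : ℝ × (E × (E →L[ℝ] ℝ)) => modelForce K y.1 y.2) (h, u) :=
  ((contDiffAt_fst.smul (ContDiffAt.comp (g := hamField K) (h, u) (contDiffAt_hamField hK)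
    contDiffAt_snd).snd).clm_comp contDiffAt_const).add
      (contDiffAt_snd.snd.clm_comp contDiffAt_const)

theorem IsRegularAt.contDiffAt_modelScheme (hu : IsRegularAt r K h u) :
    ContDiffAt ℝ ∞ (fun y : ℝ × (E × (E →L[ℝ] ℝ)) => modelScheme r K y.1 y.2) (h, u) := by
  have hstep := contDiffAt_modelStep (h := h) hu.hamiltonian
  have hr := ContDiffAt.comp (g := r) (h, u) hu.map hstep
  have hA := ContDiffAt.comp (g := fderiv ℝ r) (h, u) (hu.map.fderiv_right (m := ∞) (by simp)) hstep
  have hp := contDiffAt_momenta hA (contDiffAt_modelForce hu.hamiltonian) hu.isInvertible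
  exact (hr.fst.prodMk hp.fst).prodMk (hr.snd.prodMk hp.snd)

/-- The primitive of the pullback of `p₁ dx₁ - p₀ dx₀` by the scheme. -/
def modelAction (K : E × (E →L[ℝ] ℝ) → ℝ) (h : ℝ) (u : E × (E →L[ℝ] ℝ)) : ℝ :=
  u.2 (h • (hamField K u).1) - h * K u

theorem contDiffAt_modelAction (hK : ContDiffAt ℝ ∞ K u) :
    ContDiffAt ℝ ∞ (modelAction K h) u :=
  (contDiffAt_snd.clm_apply (contDiffAt_const.smul (contDiffAt_hamField hK).fst)).sub
    (contDiffAt_const.mul hK)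

theorem hasFDerivAt_modelStep (hK : ContDiffAt ℝ ∞ K u) :
    HasFDerivAt (modelStep K h) ((ContinuousLinearMap.fst ℝ E (E →L[ℝ] ℝ)).prod
      (h • (ContinuousLinearMap.fst ℝ E (E →L[ℝ] ℝ) ∘L fderiv ℝ (hamField K) u))) u :=
  hasFDerivAt_fst.prodMk
    ((((contDiffAt_hamField hK).differentiableAt (by simp)).hasFDerivAt.fst).const_smul h)

theorem fderiv_modelAction (hK : ContDiffAt ℝ ∞ K u) (ζ : E × (E →L[ℝ] ℝ)) :
    fderiv ℝ (modelAction K h) u ζ = modelForce K h u (fderiv ℝ (modelStep K h) u ζ) := by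
  have dX := ((contDiffAt_hamField hK).differentiableAt (by simp)).hasFDerivAt
  have dK := (hK.differentiableAt (by simp)).hasFDerivAt
  have dL := ((hasFDerivAt_snd (𝕜 := ℝ) (p := u)).clm_apply (dX.fst.const_smul h)).sub
    (dK.const_mul h)
  have hdL : fderiv ℝ (modelAction K h) u = _ := dL.fderiv
  rw [hdL, (hasFDerivAt_modelStep hK).fderiv]
  have hamilton := fderiv_eq_hamField K u ζ
  simp only [sub_apply, add_apply, smul_apply, ContinuousLinearMap.comp_apply,
    ContinuousLinearMap.flip_apply, ContinuousLinearMap.prod_apply, ContinuousLinearMap.coe_fst',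
    ContinuousLinearMap.coe_snd', Pi.smul_apply, map_smul, smul_eq_mul, modelForce, hamilton]
  ring

theorem IsRegularAt.modelScheme_exact (hu : IsRegularAt r K h u) (ζ : E × (E →L[ℝ] ℝ)) :
    (modelScheme r K h u).2.2 (fderiv ℝ (fun w => (modelScheme r K h w).2.1) u ζ) -
      (modelScheme r K h u).1.2 (fderiv ℝ (fun w => (modelScheme r K h w).1.1) u ζ) =
        fderiv ℝ (modelAction K h) u ζ := by
  have dr := (hu.map.differentiableAt (by simp)).hasFDerivAt.comp u
    (hasFDerivAt_modelStep (h := h) hu.hamiltonian).differentiableAt.hasFDerivAt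
  have dx₁ : fderiv ℝ (fun w => (modelScheme r K h w).2.1) u = _ := dr.snd.fderiv
  have dx₀ : fderiv ℝ (fun w => (modelScheme r K h w).1.1) u = _ := dr.fst.fderiv
  rw [dx₁, dx₀, fderiv_modelAction hu.hamiltonian]
  exact momenta_pairing hu.isInvertible _ _

theorem modelScheme_isotropic (hu : ∀ᶠ w in 𝓝 u, IsRegularAt r K h w)
    {D : E × (E →L[ℝ] ℝ) →L[ℝ] (E × (E →L[ℝ] ℝ)) × (E × (E →L[ℝ] ℝ))}
    (hD : HasFDerivAt (modelScheme r K h) D u) (ξ η : E × (E →L[ℝ] ℝ)) :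
    (D η).2.2 (D ξ).2.1 - (D ξ).2.2 (D η).2.1 = (D η).1.2 (D ξ).1.1 - (D ξ).1.2 (D η).1.1 := by
  have hreg := hu.self_of_nhds
  have hf : ContDiffAt ℝ ∞ (modelScheme r K h) u :=
    ContDiffAt.comp (g := fun y : ℝ × (E × (E →L[ℝ] ℝ)) => modelScheme r K y.1 y.2) u
      hreg.contDiffAt_modelScheme (contDiffAt_const.prodMk contDiffAt_id)
  have wedge := wedge_eq_of_exact hf.fst.fst hf.snd.fst hD.fst.snd.differentiableAt
    hD.snd.snd.differentiableAt (contDiffAt_modelAction hreg.hamiltonian)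
    (hu.mono fun w hw => hw.modelScheme_exact) ξ η
  rw [hD.fst.fst.fderiv, hD.snd.fst.fderiv, hD.fst.snd.fderiv, hD.snd.snd.fderiv] at wedge
  exact wedge

end ModelScheme

section ModelConsistency

/-- The axioms of a discretization map in coordinates, near the zero vector at `q₀`. -/
structure IsModelDiscretizationAt (r : E × E → E × E) (q₀ : E) : Prop where
  contDiffAt : ContDiffAt ℝ ∞ r (q₀, 0)
  diagonal : ∀ᶠ y in 𝓝 q₀, r (y, 0) = (y, y)
  vertical : ∀ᶠ y in 𝓝 q₀, ∀ e, (fderiv ℝ r (y, 0) (0, e)).2 - (fderiv ℝ r (y, 0) (0, e)).1 = e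

variable {r : E × E → E × E} {q₀ : E}

theorem hasFDerivAt_zeroSection (y : E) :
    HasFDerivAt (fun y : E => (y, (0 : E))) (ContinuousLinearMap.inl ℝ E E) y :=
  (ContinuousLinearMap.inl ℝ E E).hasFDerivAt

theorem IsModelDiscretizationAt.horizontal (hr : IsModelDiscretizationAt r q₀) :
    ∀ᶠ y in 𝓝 q₀, ∀ δ, fderiv ℝ r (y, 0) (δ, 0) = (δ, δ) := by
  have hdiff : ∀ᶠ y in 𝓝 q₀, ContDiffAt ℝ 1 r (y, 0) :=
    (Continuous.prodMk_left (0 : E)).continuousAt.eventually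
      ((hr.contDiffAt.of_le (by simp)).eventually (by simp))
  filter_upwards [hdiff, hr.diagonal.eventually_nhds] with y hy hdiag δ
  have dr := HasFDerivAt.comp (g := r) y (hy.differentiableAt (by simp)).hasFDerivAt
    (hasFDerivAt_zeroSection y)
  have ddiagonal := (hasFDerivAt_id (𝕜 := ℝ) y).prodMk (hasFDerivAt_id y)
  exact DFunLike.congr_fun (dr.unique (ddiagonal.congr_of_eventuallyEq hdiag)) δ

theorem IsModelDiscretizationAt.fderiv_snd_sub_fst (hr : IsModelDiscretizationAt r q₀) :
    ∀ᶠ y in 𝓝 q₀, ∀ t, (fderiv ℝ r (y, 0) t).2 - (fderiv ℝ r (y, 0) t).1 = t.2 := by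
  filter_upwards [hr.horizontal, hr.vertical] with y hhor hver t
  have split : fderiv ℝ r (y, 0) t = (t.1, t.1) + fderiv ℝ r (y, 0) (0, t.2) := by
    rw [← hhor, ← map_add]
    simp
  rw [split, Prod.snd_add, Prod.fst_add, add_sub_add_left_eq_sub, hver]

theorem IsModelDiscretizationAt.momenta_eq (hr : IsModelDiscretizationAt r q₀)
    (hA : (fderiv ℝ r (q₀, 0)).IsInvertible) (p : E →L[ℝ] ℝ) :
    momenta (fderiv ℝ r (q₀, 0)) (p ∘L ContinuousLinearMap.snd ℝ E E) = (p, p) :=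
  (eq_momenta hA fun ζ => by
    simp [← hr.fderiv_snd_sub_fst.self_of_nhds ζ]).symm

theorem IsModelDiscretizationAt.isInvertible_fderiv [FiniteDimensional ℝ E]
    (hr : IsModelDiscretizationAt r q₀) :
    (fderiv ℝ r (q₀, 0)).IsInvertible := by
  have hinj : Function.Injective (fderiv ℝ r (q₀, 0)).toLinearMap := by
    refine (injective_iff_map_eq_zero _).2 ?_
    rintro ⟨δ, ε⟩ (hδε : fderiv ℝ r (q₀, 0) (δ, ε) = 0)
    obtain rfl : ε = 0 := by
      simpa [hδε] using (hr.fderiv_snd_sub_fst.self_of_nhds (δ, ε)).symm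
    have hδ : (δ, δ) = (0 : E × E) := (hr.horizontal.self_of_nhds δ).symm.trans hδε
    exact Prod.ext (Prod.ext_iff.1 hδ).1 rfl
  exact ⟨(LinearEquiv.ofInjectiveEndo _ hinj).toContinuousLinearEquiv, rfl⟩

theorem IsModelDiscretizationAt.modelScheme_zero [FiniteDimensional ℝ E]
    {K : E × (E →L[ℝ] ℝ) → ℝ} {u : E × (E →L[ℝ] ℝ)} (hr : IsModelDiscretizationAt r u.1) :
    modelScheme r K 0 u = (u, u) := by
  have hstep : modelStep K 0 u = (u.1, 0) := by simp [modelStep]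
  have hforce : modelForce K 0 u = u.2 ∘L ContinuousLinearMap.snd ℝ E E := by simp [modelForce]
  simp only [modelScheme, hstep, hforce, hr.diagonal.self_of_nhds,
    hr.momenta_eq hr.isInvertible_fderiv]

/-- Differentiate `(∂r(y, 0) t)₁ - (∂r(y, 0) t)₀ = t.2` in `y`. -/
theorem IsModelDiscretizationAt.mixed_fderiv_eq (hr : IsModelDiscretizationAt r q₀)
    (δ : E) (t : E × E) :
    (fderiv ℝ (fderiv ℝ r) (q₀, 0) (δ, 0) t).2 = (fderiv ℝ (fderiv ℝ r) (q₀, 0) (δ, 0) t).1 := by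
  have dD := (HasFDerivAt.comp (g := fderiv ℝ r) q₀ (hasFDerivAt_fderiv hr.contDiffAt)
    (hasFDerivAt_zeroSection q₀)).clm_apply (hasFDerivAt_const t q₀)
  have hconst := (dD.snd.sub dD.fst).unique ((hasFDerivAt_const t.2 q₀).congr_of_eventuallyEq
    (hr.fderiv_snd_sub_fst.mono fun y hy => hy t))
  have := DFunLike.congr_fun hconst δ
  simpa [sub_eq_zero] using this

theorem hasDerivAt_fst_of_prod {𝕜 F G : Type*} [NontriviallyNormedField 𝕜]
    [NormedAddCommGroup F] [NormedSpace 𝕜 F] [NormedAddCommGroup G] [NormedSpace 𝕜 G]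
    {f : 𝕜 → F × G} {f' : F × G} {x : 𝕜} (h : HasDerivAt f f' x) :
    HasDerivAt (fun y => (f y).1) f'.1 x :=
  (ContinuousLinearMap.fst 𝕜 F G).hasFDerivAt.comp_hasDerivAt x h

theorem hasDerivAt_snd_of_prod {𝕜 F G : Type*} [NontriviallyNormedField 𝕜]
    [NormedAddCommGroup F] [NormedSpace 𝕜 F] [NormedAddCommGroup G] [NormedSpace 𝕜 G]
    {f : 𝕜 → F × G} {f' : F × G} {x : 𝕜} (h : HasDerivAt f f' x) :
    HasDerivAt (fun y => (f y).2) f'.2 x :=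
  (ContinuousLinearMap.snd 𝕜 F G).hasFDerivAt.comp_hasDerivAt x h

variable {t : ℝ → E × E} {t' : E × E}

theorem IsModelDiscretizationAt.endpoint_velocity (hr : IsModelDiscretizationAt r q₀)
    (ht₀ : t 0 = (q₀, 0)) (ht : HasDerivAt t t' 0) {x : ℝ → E} {x' : E} (hx : HasDerivAt x x' 0)
    (hfst : ∀ᶠ h in 𝓝 0, (r (t h)).1 = q₀) (hsnd : ∀ᶠ h in 𝓝 0, (r (t h)).2 = x h) :
    x' = t'.2 := by
  have dr : HasFDerivAt r (fderiv ℝ r (q₀, 0)) (t 0) := by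
    rw [ht₀]
    exact (hr.contDiffAt.differentiableAt (by simp)).hasFDerivAt
  have drt := dr.comp_hasDerivAt 0 ht
  have dfst : (fderiv ℝ r (q₀, 0) t').1 = 0 :=
    (hasDerivAt_fst_of_prod drt).unique ((hasDerivAt_const 0 q₀).congr_of_eventuallyEq hfst)
  have dsnd : (fderiv ℝ r (q₀, 0) t').2 = x' :=
    (hasDerivAt_snd_of_prod drt).unique (hx.congr_of_eventuallyEq hsnd)
  simpa [dfst, dsnd] using hr.fderiv_snd_sub_fst.self_of_nhds t'

theorem IsModelDiscretizationAt.momentum_velocity (hr : IsModelDiscretizationAt r q₀)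
    (ht₀ : t 0 = (q₀, 0)) (ht : HasDerivAt t t' 0) {p g : ℝ → E →L[ℝ] ℝ} {p' g' : E →L[ℝ] ℝ}
    (hp : HasDerivAt p p' 0) (hg : HasDerivAt g g' 0)
    (hpair : ∀ᶠ h in 𝓝 0, ∀ δ, p h (fderiv ℝ r (t h) (δ, 0)).2 -
      p 0 (fderiv ℝ r (t h) (δ, 0)).1 = g h δ) :
    p' = g' := by
  refine ContinuousLinearMap.ext fun δ => ?_
  have dD : HasFDerivAt (fderiv ℝ r) (fderiv ℝ (fderiv ℝ r) (q₀, 0)) (t 0) := by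
    rw [ht₀]
    exact hasFDerivAt_fderiv hr.contDiffAt
  have dDt := (dD.comp_hasDerivAt 0 ht).clm_apply (hasDerivAt_const (0 : ℝ) ((δ, 0) : E × E))
  have dpair := ((hp.clm_apply (hasDerivAt_snd_of_prod dDt)).sub
    ((hasDerivAt_const (0 : ℝ) (p 0)).clm_apply (hasDerivAt_fst_of_prod dDt))).unique
      ((hg.clm_apply (hasDerivAt_const (0 : ℝ) δ)).congr_of_eventuallyEq
        (hpair.mono fun h hh => hh δ))
  have hsymm := (hr.contDiffAt.isSymmSndFDerivAt minSmoothness_two_le) t' (δ, 0)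
  simpa [ht₀, hr.horizontal.self_of_nhds, hsymm, hr.mixed_fderiv_eq] using dpair

theorem IsModelDiscretizationAt.scheme_velocity [FiniteDimensional ℝ E]
    {K : E × (E →L[ℝ] ℝ) → ℝ} {u₀ u' c' : E × (E →L[ℝ] ℝ)} {u c : ℝ → E × (E →L[ℝ] ℝ)}
    (hr : IsModelDiscretizationAt r u₀.1) (hK : ContDiffAt ℝ ∞ K u₀)
    (hu₀ : u 0 = u₀) (hc₀ : c 0 = u₀) (hu : HasDerivAt u u' 0) (hc : HasDerivAt c c' 0)
    (hreg : ∀ᶠ h in 𝓝 0, (fderiv ℝ r (modelStep K h (u h))).IsInvertible)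
    (hscheme : ∀ᶠ h in 𝓝 0, modelScheme r K h (u h) = (u₀, c h)) :
    c' = hamField K u₀ := by
  have dX : HasDerivAt (fun h : ℝ => h • hamField K (u h)) (hamField K u₀) 0 := by
    have hX : DifferentiableAt ℝ (hamField K) (u 0) :=
      hu₀ ▸ (contDiffAt_hamField hK).differentiableAt (by simp)
    have := (hasDerivAt_id (0 : ℝ)).smul (hX.hasFDerivAt.comp_hasDerivAt 0 hu)
    simp only [id_eq, zero_smul, zero_add, one_smul, Function.comp_apply, hu₀] at this
    exact this
  have dt : HasDerivAt (fun h => modelStep K h (u h)) (u'.1, (hamField K u₀).1) 0 :=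
    (hasDerivAt_fst_of_prod hu).prodMk (hasDerivAt_fst_of_prod dX)
  have ht₀ : modelStep K 0 (u 0) = (u₀.1, 0) := by simp [modelStep, hu₀]
  refine Prod.ext ?_ ?_
  · exact hr.endpoint_velocity ht₀ dt (hasDerivAt_fst_of_prod hc)
      (hscheme.mono fun h hh => congrArg (fun y => y.1.1) hh)
      (hscheme.mono fun h hh => congrArg (fun y => y.2.1) hh)
  · refine hr.momentum_velocity ht₀ dt (hasDerivAt_snd_of_prod hc) (hasDerivAt_snd_of_prod dX) ?_
    filter_upwards [hreg, hscheme] with h hA hh δ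
    have pairing := momenta_pairing hA (modelForce K h (u h)) (δ, 0)
    have p₀ : (momenta _ _).1 = u₀.2 := congrArg (fun y => y.1.2) hh
    have p₁ : (momenta _ _).2 = (c h).2 := congrArg (fun y => y.2.2) hh
    rw [p₀, p₁] at pairing
    simpa [modelForce, hc₀] using pairing

end ModelConsistency

section InverseFunction

variable {F₁ F₂ K₁ K₂ M N : Type*} [NormedAddCommGroup F₁] [NormedSpace ℝ F₁]
  [NormedAddCommGroup F₂] [NormedSpace ℝ F₂] [TopologicalSpace K₁] [TopologicalSpace K₂]
  {I : ModelWithCorners ℝ F₁ K₁} {J : ModelWithCorners ℝ F₂ K₂}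
  [TopologicalSpace M] [ChartedSpace K₁ M] [TopologicalSpace N] [ChartedSpace K₂ N]

theorem isLocalDiffeomorphAt_congr {f g : M → N} {x : M} (hf : IsLocalDiffeomorphAt I J ∞ f x)
    (hfg : f =ᶠ[𝓝 x] g) : IsLocalDiffeomorphAt I J ∞ g x := by
  obtain ⟨Φ, hx, hΦ⟩ := hf
  obtain ⟨s, hs, hso, hxs⟩ := eventually_nhds_iff.1 hfg
  let e := Φ.toOpenPartialHomeomorph.restrOpen s hso
  exact ⟨⟨e.toPartialEquiv, e.open_source, e.open_target,
    Φ.contMDiffOn_toFun.mono fun y hy => hy.1, Φ.contMDiffOn_invFun.mono fun y hy => hy.1⟩,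
    ⟨hx, hxs⟩, fun y hy => (hs y hy.2).symm.trans (hΦ hy.1)⟩

theorem isLocalDiffeomorphAt_of_hasFDerivAt [CompleteSpace F₁] {f : F₁ → F₂} {a : F₁}
    {f' : F₁ ≃L[ℝ] F₂} (hf : ∀ᶠ y in 𝓝 a, ContDiffAt ℝ ∞ f y)
    (hf' : HasFDerivAt f (f' : F₁ →L[ℝ] F₂) a) :
    IsLocalDiffeomorphAt 𝓘(ℝ, F₁) 𝓘(ℝ, F₂) ∞ f a := by
  have hfa := hf.self_of_nhds
  have invertible_near : ∀ᶠ y in 𝓝 a,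
      fderiv ℝ f y ∈ Set.range ((↑) : (F₁ ≃L[ℝ] F₂) → F₁ →L[ℝ] F₂) := by
    refine (hfa.fderiv_right (m := 0) (by norm_num)).continuousAt.eventually_mem ?_
    rw [hf'.fderiv]
    exact f'.nhds
  obtain ⟨s, hs, hso, hxs⟩ := eventually_nhds_iff.1 (hf.and invertible_near)
  let e := (hfa.toOpenPartialHomeomorph f hf' (by simp)).restrOpen s hso
  have smooth : ∀ y ∈ e.source, ContDiffAt ℝ ∞ f y := fun y hy => (hs y hy.2).1
  have smooth_symm : ∀ y ∈ e.target, ContDiffAt ℝ ∞ e.symm y := fun y hy => by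
    obtain ⟨hfy, g, hg⟩ := hs _ (e.map_target hy).2
    refine e.contDiffAt_symm (f₀' := g) hy ?_ hfy
    rw [hg]
    exact (hfy.differentiableAt (by simp)).hasFDerivAt
  exact ⟨⟨e.toPartialEquiv, e.open_source, e.open_target,
    fun y hy => (smooth y hy).contMDiffAt.contMDiffWithinAt,
    fun y hy => (smooth_symm y hy).contMDiffAt.contMDiffWithinAt⟩,
    ⟨hfa.mem_toOpenPartialHomeomorph_source hf' (by simp), hxs⟩, fun y _ => rfl⟩

theorem contMDiffOn_extChartAt_source [IsManifold I ∞ M] (x : M) :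
    ContMDiffOn I 𝓘(ℝ, F₁) ∞ (extChartAt I x) (extChartAt I x).source := by
  rw [extChartAt_source]
  exact contMDiffOn_extChartAt

variable [I.Boundaryless]

theorem isLocalDiffeomorphAt_extChartAt [IsManifold I ∞ M] {x y : M}
    (hy : y ∈ (extChartAt I x).source) :
    IsLocalDiffeomorphAt I 𝓘(ℝ, F₁) ∞ (extChartAt I x) y :=
  ⟨⟨extChartAt I x, isOpen_extChartAt_source x, isOpen_extChartAt_target x,
    contMDiffOn_extChartAt_source x, contMDiffOn_extChartAt_symm x⟩, hy, fun _ _ => rfl⟩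

theorem isLocalDiffeomorphAt_extChartAt_symm [IsManifold I ∞ M] {x : M} {y : F₁}
    (hy : y ∈ (extChartAt I x).target) :
    IsLocalDiffeomorphAt 𝓘(ℝ, F₁) I ∞ (extChartAt I x).symm y :=
  ⟨⟨(extChartAt I x).symm, isOpen_extChartAt_target x, isOpen_extChartAt_source x,
    contMDiffOn_extChartAt_symm x, contMDiffOn_extChartAt_source x⟩, hy, fun _ _ => rfl⟩

variable [IsManifold I ∞ M] [IsManifold J ∞ N]

theorem eventually_contDiffAt_writtenInExtChartAt {f : M → N} {x : M}
    (hf : ∀ᶠ y in 𝓝 x, ContMDiffAt I J ∞ f y) :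
    ∀ᶠ y in 𝓝 (extChartAt I x x), ContDiffAt ℝ ∞ (writtenInExtChartAt I J x f) y := by
  have hfx := hf.and (hf.self_of_nhds.continuousAt.eventually_mem
    (extChartAt_source_mem_nhds (I := J) (f x)))
  rw [← extChartAt_to_inv (I := I) x] at hfx
  filter_upwards [(continuousAt_extChartAt_symm x).eventually hfx,
    (isOpen_extChartAt_target x).mem_nhds (mem_extChartAt_target (I := I) x)]
    with y ⟨hfy, hfy_source⟩ hy
  rw [← contMDiffAt_iff_contDiffAt]
  rw [extChartAt_to_inv] at hfy_source
  exact ((contMDiffOn_extChartAt_source (I := J) (f x)).contMDiffAt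
    ((isOpen_extChartAt_source (f x)).mem_nhds hfy_source)).comp y
      (hfy.comp y (isLocalDiffeomorphAt_extChartAt_symm (I := I) hy).contMDiffAt)

theorem isLocalDiffeomorphAt_of_hasMFDerivAt [CompleteSpace F₁] [J.Boundaryless] {f : M → N}
    {x : M} {f' : F₁ ≃L[ℝ] F₂} (hf : ∀ᶠ y in 𝓝 x, ContMDiffAt I J ∞ f y)
    (hf' : HasMFDerivAt I J f x (f' : F₁ →L[ℝ] F₂)) : IsLocalDiffeomorphAt I J ∞ f x := by
  have hderiv : HasFDerivWithinAt (writtenInExtChartAt I J x f) (f' : F₁ →L[ℝ] F₂) (Set.range I)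
      (extChartAt I x x) := hf'.2
  rw [ModelWithCorners.range_eq_univ, hasFDerivWithinAt_univ] at hderiv
  have hcharts := (isLocalDiffeomorphAt_extChartAt (mem_extChartAt_source (I := I) x)).comp
    (K := 𝓘(ℝ, F₂)) (P := F₂) (isLocalDiffeomorphAt_of_hasFDerivAt
      (eventually_contDiffAt_writtenInExtChartAt hf) hderiv)
  have htarget : (writtenInExtChartAt I J x f ∘ extChartAt I x) x ∈
      (extChartAt J (f x)).target := by
    simp only [writtenInExtChartAt, Function.comp_apply, extChartAt_to_inv]
    exact mem_extChartAt_target _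
  refine isLocalDiffeomorphAt_congr
    (hcharts.comp (K := J) (P := N) (isLocalDiffeomorphAt_extChartAt_symm htarget)) ?_
  filter_upwards [hf.self_of_nhds.continuousAt.eventually_mem
    (extChartAt_source_mem_nhds (I := J) (f x)), extChartAt_source_mem_nhds (I := I) x]
    with y hfy hy
  simp only [writtenInExtChartAt, Function.comp_apply, (extChartAt I x).left_inv hy]
  exact (extChartAt J (f x)).left_inv hfy

end InverseFunction

section Hamiltonian

variable [IsManifold 𝓘(ℝ, E) ∞ Q] {H : CQ E Q → ℝ} {b : Q} {z : CQ E Q}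

variable (H b) in
/-- The expression of a function on `T*Q` in the chart over `b`. -/
def localHam : E × (E →L[ℝ] ℝ) → ℝ := H ∘ (cotChart E b).symm

theorem contDiffAt_localHam (hH : ContMDiff (cModel E) 𝓘(ℝ, ℝ) ∞ H) {u : E × (E →L[ℝ] ℝ)}
    (hu : u ∈ (cotChart E b).target) : ContDiffAt ℝ ∞ (localHam H b) u := by
  rw [← contMDiffAt_iff_contDiffAt]
  exact hH.contMDiffAt.comp u (contMDiffAt_bundleChart_symm hu)

theorem dH_eq_fderiv_localHam (hH : ContMDiff (cModel E) 𝓘(ℝ, ℝ) ∞ H)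
    (hz : z.proj ∈ (chartAt E b).source) (η : E × (E →L[ℝ] ℝ)) :
    dH H z η = fderiv ℝ (localHam H b) (cotChart E b z) (cotDeriv E b z η) := by
  have hs := mem_cotChart_source.2 hz
  have hlocal := (contDiffAt_localHam hH ((cotChart E b).map_source hs)).differentiableAt (by simp)
  have hcomp := hlocal.hasFDerivAt.hasMFDerivAt.comp z (hasMFDerivAt_bundleChart hs)
  have heq : localHam H b ∘ cotChart E b =ᶠ[𝓝 z] H := by
    filter_upwards [(isOpen_bundleChart_source b).mem_nhds hs] with w hw
    simp only [localHam, Function.comp_apply, (cotChart E b).left_inv hw]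
  exact DFunLike.congr_fun (hcomp.congr_of_eventuallyEq heq.symm).mfderiv η

theorem cotDeriv_vertical (hz : z.proj ∈ (chartAt E b).source) (g : E →L[ℝ] ℝ) :
    cotDeriv E b z (0, g ∘L baseDeriv E b z.proj) = (0, g) := by
  refine Prod.ext ((bundleChartDeriv_fst (mem_cotChart_source.2 hz) _).trans (map_zero _))
    (ContinuousLinearMap.ext fun a => ?_)
  obtain ⟨A, hA⟩ := isInvertible_baseDeriv hz
  have hpair := pairing_cotDeriv_tanDeriv (v := ⟨z.proj, A.symm a⟩) rfl hz 0
    (g ∘L baseDeriv E b z.proj) 0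
  have hzero : ((0 : E), (0 : E)) = 0 := rfl
  rw [hzero] at hpair
  simpa [vector, ← hA] using hpair

variable [FiniteDimensional ℝ E]

variable (H z) in
/-- The Hamiltonian vector field of `H` at `z`, on the model space. -/
def hamVec : E × (E →L[ℝ] ℝ) := hamiltonianVF H z

theorem dH_eq_hamVec (η : E × (E →L[ℝ] ℝ)) :
    dH H z η = η.2 (hamVec H z).1 - (hamVec H z).2 η.1 := by
  have flat_sharp : flat z (sharp z (dH H z)) = dH H z :=
    LinearEquiv.apply_symm_apply (LinearEquiv.ofBijective _ (flat_bijective z)) _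
  exact (DFunLike.congr_fun flat_sharp η).symm.trans (omega_apply z _ η)

theorem sharp_smul_dH (h : ℝ) : sharp z (h • dH H z) = h • hamVec H z :=
  map_smul (sharp z) h (dH H z)

variable (H) in
/-- The projection to `TQ` of the vector `h • X_H(z)`. -/
def legendre (h : ℝ) (z : CQ E Q) : TQ E Q := ⟨z.proj, h • (hamVec H z).1⟩

theorem hamField_fst (hH : ContMDiff (cModel E) 𝓘(ℝ, ℝ) ∞ H)
    (hz : z.proj ∈ (chartAt E b).source) :
    (hamField (localHam H b) (cotChart E b z)).1 = baseDeriv E b z.proj (hamVec H z).1 := by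
  refine (SeparatingDual.eq_iff_forall_dual_eq (R := ℝ)).2 fun g => ?_
  have hdH := dH_eq_fderiv_localHam hH hz (0, g ∘L baseDeriv E b z.proj)
  rw [dH_eq_hamVec, cotDeriv_vertical hz, fderiv_eq_hamField] at hdH
  simpa using hdH.symm

theorem tanChart_legendre (hH : ContMDiff (cModel E) 𝓘(ℝ, ℝ) ∞ H)
    (hz : z.proj ∈ (chartAt E b).source) (h : ℝ) :
    tanChart E b (legendre H h z) = modelStep (localHam H b) h (cotChart E b z) := by
  refine Prod.ext rfl ((tanChart_snd hz).trans ?_)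
  simp only [modelStep, hamField_fst hH hz]
  exact map_smul (baseDeriv E b z.proj) h (hamVec H z).1

/-- The canonical map `α_Q` takes `h • X_H(z)` to the covector `(-h ∂H/∂q, p)` in every chart. -/
theorem modelForce_tanDeriv (hH : ContMDiff (cModel E) 𝓘(ℝ, ℝ) ∞ H)
    (hz : z.proj ∈ (chartAt E b).source) (h : ℝ) (ζ : E × E) :
    modelForce (localHam H b) h (cotChart E b z) (tanDeriv E b (legendre H h z) ζ) =
      h * (hamVec H z).2 ζ.1 + covector z ζ.2 := by
  have hdH := dH_eq_fderiv_localHam hH hz (ζ.1, 0)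
  have hpair := pairing_cotDeriv_tanDeriv (v := legendre H h z) rfl hz ζ.1 0 ζ.2
  have hvec : vector (legendre H h z) = h • (hamVec H z).1 := rfl
  have hfst : (tanDeriv E b (legendre H h z) ζ).1 = baseDeriv E b z.proj ζ.1 :=
    bundleChartDeriv_fst (mem_tanChart_source.2 hz) ζ
  rw [dH_eq_hamVec, fderiv_eq_hamField, bundleChartDeriv_fst (mem_cotChart_source.2 hz),
    hamField_fst hH hz] at hdH
  rw [hvec] at hpair
  simp only [map_smul, smul_eq_mul, zero_apply, mul_zero, zero_add, zero_sub] at hdH hpair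
  simp only [modelForce, add_apply, ContinuousLinearMap.comp_apply, ContinuousLinearMap.coe_fst',
    ContinuousLinearMap.coe_snd', hfst, smul_apply, smul_eq_mul]
  linear_combination hpair + h * hdH

end Hamiltonian

section LocalExpression

variable {R : TQ E Q → Q × Q} {b : Q} {c : Q × Q} {v : TQ E Q}

/-- The point `v` and its image under `R` lie in the domains of the charts over `b` and `c`. -/
structure InCharts (R : TQ E Q → Q × Q) (b : Q) (c : Q × Q) (v : TQ E Q) : Prop where
  proj : v.proj ∈ (chartAt E b).source
  fst : (R v).1 ∈ (chartAt E c.1).source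
  snd : (R v).2 ∈ (chartAt E c.2).source

variable (R v) in
theorem inCharts_self : InCharts R v.proj (R v) v :=
  ⟨mem_chart_source E _, mem_chart_source E _, mem_chart_source E _⟩

variable [IsManifold 𝓘(ℝ, E) ∞ Q]

/-- The expression of `R : TQ → Q × Q` in the charts over `b` and `c`. -/
def localR (R : TQ E Q → Q × Q) (b : Q) (c : Q × Q) (t : E × E) : E × E :=
  (extChartAt 𝓘(ℝ, E) c.1 (R ((tanChart E b).symm t)).1,
    extChartAt 𝓘(ℝ, E) c.2 (R ((tanChart E b).symm t)).2)

theorem InCharts.eventually (hv : InCharts R b c v) {Y : Type*} [TopologicalSpace Y]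
    {f : Y → TQ E Q} {y : Y} (hf : ContinuousAt f y) (hy : f y = v) (hR : ContinuousAt R v) :
    ∀ᶠ w in 𝓝 y, InCharts R b c (f w) := by
  subst hy
  have hRf : ContinuousAt (R ∘ f) y := hR.comp hf
  filter_upwards [(FiberBundle.continuous_proj E _).continuousAt.comp hf |>.eventually_mem
      ((chartAt E b).open_source.mem_nhds hv.proj),
    hRf.fst.eventually_mem ((chartAt E c.1).open_source.mem_nhds hv.fst),
    hRf.snd.eventually_mem ((chartAt E c.2).open_source.mem_nhds hv.snd)] with w h₀ h₁ h₂
  exact ⟨h₀, h₁, h₂⟩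

theorem contDiffAt_localR (hR : ContMDiffAt (tModel E) (𝓘(ℝ, E).prod 𝓘(ℝ, E)) ∞ R v)
    (hv : InCharts R b c v) : ContDiffAt ℝ ∞ (localR R b c) (tanChart E b v) := by
  have hs := mem_tanChart_source.2 hv.proj
  obtain ⟨_, hfst, hsnd⟩ := hv
  rw [← (tanChart E b).left_inv hs] at hR hfst hsnd
  have hRsymm := hR.comp _ (contMDiffAt_bundleChart_symm ((tanChart E b).map_source hs))
  exact ((contMDiffAt_extChartAt' (I := 𝓘(ℝ, E)) hfst).comp (tanChart E b v)
      (contMDiffAt_fst.comp _ hRsymm)).contDiffAt.prodMk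
    ((contMDiffAt_extChartAt' (I := 𝓘(ℝ, E)) hsnd).comp (tanChart E b v)
      (contMDiffAt_snd.comp _ hRsymm)).contDiffAt

/-- The derivative of `R : TQ → Q × Q`, on the model spaces. -/
abbrev discretizationDeriv (R : TQ E Q → Q × Q) (v : TQ E Q) : E × E →L[ℝ] E × E :=
  modelDeriv (tModel E) (𝓘(ℝ, E).prod 𝓘(ℝ, E)) R v

theorem fderiv_localR (hR : ContMDiffAt (tModel E) (𝓘(ℝ, E).prod 𝓘(ℝ, E)) ∞ R v)
    (hv : InCharts R b c v) (ζ : E × E) :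
    fderiv ℝ (localR R b c) (tanChart E b v) (tanDeriv E b v ζ) =
      (baseDeriv E c.1 (R v).1 (discretizationDeriv R v ζ).1,
        baseDeriv E c.2 (R v).2 (discretizationDeriv R v ζ).2) := by
  have hs := mem_tanChart_source.2 hv.proj
  have dlocal := ((contDiffAt_localR hR hv).differentiableAt
    (by simp)).hasFDerivAt.hasMFDerivAt.comp v (hasMFDerivAt_bundleChart hs)
  have dR : HasMFDerivAt (tModel E) (𝓘(ℝ, E).prod 𝓘(ℝ, E)) R v (discretizationDeriv R v) :=
    (hR.mdifferentiableAt (by simp)).hasMFDerivAt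
  have dfst := (hasMFDerivAt_extChartAt hv.fst).comp v
    ((hasMFDerivAt_fst (I := 𝓘(ℝ, E)) (I' := 𝓘(ℝ, E)) (R v)).comp v dR)
  have dsnd := (hasMFDerivAt_extChartAt hv.snd).comp v
    ((hasMFDerivAt_snd (I := 𝓘(ℝ, E)) (I' := 𝓘(ℝ, E)) (R v)).comp v dR)
  have heq : ∀ᶠ w in 𝓝 v, localR R b c (tanChart E b w) =
      (extChartAt 𝓘(ℝ, E) c.1 (R w).1, extChartAt 𝓘(ℝ, E) c.2 (R w).2) := by
    filter_upwards [(isOpen_bundleChart_source b).mem_nhds hs] with w hw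
    simp only [localR, (tanChart E b).left_inv hw]
  exact Prod.ext
    (DFunLike.congr_fun (hasMFDerivAt_unique
      (((ContinuousLinearMap.fst ℝ E E).hasMFDerivAt.comp v dlocal).congr_of_eventuallyEq
        (heq.mono fun w hw => (congrArg Prod.fst hw).symm)) dfst) ζ)
    (DFunLike.congr_fun (hasMFDerivAt_unique
      (((ContinuousLinearMap.snd ℝ E E).hasMFDerivAt.comp v dlocal).congr_of_eventuallyEq
        (heq.mono fun w hw => (congrArg Prod.snd hw).symm)) dsnd) ζ)

theorem isInvertible_discretizationDeriv
    (hR : IsLocalDiffeomorphAt (tModel E) (𝓘(ℝ, E).prod 𝓘(ℝ, E)) ∞ R v) :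
    (discretizationDeriv R v).IsInvertible :=
  ⟨hR.mfderivToContinuousLinearEquiv (by simp), rfl⟩

theorem isInvertible_fderiv_localR
    (hR : IsLocalDiffeomorphAt (tModel E) (𝓘(ℝ, E).prod 𝓘(ℝ, E)) ∞ R v)
    (hv : InCharts R b c v) : (fderiv ℝ (localR R b c) (tanChart E b v)).IsInvertible := by
  obtain ⟨D, hD⟩ := isInvertible_discretizationDeriv hR
  obtain ⟨T, hT⟩ : (tanDeriv E b v).IsInvertible :=
    isInvertible_bundleChartDeriv (mem_tanChart_source.2 hv.proj)
  obtain ⟨A₁, hA₁⟩ := isInvertible_baseDeriv hv.fst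
  obtain ⟨A₂, hA₂⟩ := isInvertible_baseDeriv hv.snd
  refine ⟨(T.symm.trans D).trans (A₁.prodCongr A₂), ContinuousLinearMap.ext fun ζ => ?_⟩
  have hfderiv := fderiv_localR hR.contMDiffAt hv (T.symm ζ)
  rw [← hT, ← hD, ← hA₁, ← hA₂] at hfderiv
  simp only [ContinuousLinearEquiv.coe_coe, ContinuousLinearEquiv.apply_symm_apply] at hfderiv
  exact hfderiv.symm

end LocalExpression

section SchemeMap

variable [IsManifold 𝓘(ℝ, E) ∞ Q]
  {R : TQ E Q → Q × Q} {U V : Set (TQ E Q)} {H : CQ E Q → ℝ} {h : ℝ} {z : CQ E Q}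
  {b : Q} {c : Q × Q}

theorem contMDiffAt_prodMap_cotChart {y : ℝ × CQ E Q} (hy : y.2.proj ∈ (chartAt E b).source) :
    ContMDiffAt (𝓘(ℝ, ℝ).prod (cModel E)) 𝓘(ℝ, ℝ × (E × (E →L[ℝ] ℝ))) ∞
      (fun y : ℝ × CQ E Q => (y.1, cotChart E b y.2)) y :=
  contMDiffAt_fst.prodMk_space
    ((contMDiffAt_bundleChart (mem_cotChart_source.2 hy)).comp y contMDiffAt_snd)

variable [FiniteDimensional ℝ E]

variable (R H) in
/-- The pair `R_d^{T*}(h • X_H(z))`. These pairs make up the scheme `S_h`. -/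
def schemeMap (h : ℝ) (z : CQ E Q) : CQ E Q × CQ E Q :=
  cotangentLift R ⟨z, h • hamiltonianVF H z⟩

variable (R H h z) in
theorem schemeMap_fst_proj : (schemeMap R H h z).1.proj = (R (legendre H h z)).1 := rfl

variable (R H h z) in
theorem schemeMap_snd_proj : (schemeMap R H h z).2.proj = (R (legendre H h z)).2 := rfl

variable (R H h z) in
theorem covector_schemeMap :
    (covector (schemeMap R H h z).1, covector (schemeMap R H h z).2) =
      momenta (discretizationDeriv R (legendre H h z))
        ((h • (hamVec H z).2).coprod (covector z)) :=
  rfl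

theorem mem_scheme_iff {y : CQ E Q × CQ E Q} :
    y ∈ scheme R V H h ↔ ∃ z, legendre H h z ∈ V ∧ schemeMap R H h z = y := by
  constructor
  · rintro ⟨ξ, hdom, hlift, hξ⟩
    rw [sharp_smul_dH] at hξ
    rw [hξ] at hdom hlift
    exact ⟨ξ.proj, hdom, hlift⟩
  · rintro ⟨z, hdom, hlift⟩
    exact ⟨⟨z, h • hamiltonianVF H z⟩, hdom, hlift,
      congrArg (Bundle.TotalSpace.mk z) (sharp_smul_dH h).symm⟩

theorem cotChart_schemeMap (hH : ContMDiff (cModel E) 𝓘(ℝ, ℝ) ∞ H)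
    (hR : IsLocalDiffeomorphAt (tModel E) (𝓘(ℝ, E).prod 𝓘(ℝ, E)) ∞ R (legendre H h z))
    (hz : InCharts R b c (legendre H h z)) :
    (cotChart E c.1 (schemeMap R H h z).1, cotChart E c.2 (schemeMap R H h z).2) =
      modelScheme (localR R b c) (localHam H b) h (cotChart E b z) := by
  have hA := isInvertible_fderiv_localR hR hz
  have pairing : ∀ ζ, (cotChart E c.2 (schemeMap R H h z).2).2
        (fderiv ℝ (localR R b c) (tanChart E b (legendre H h z)) ζ).2 -
      (cotChart E c.1 (schemeMap R H h z).1).2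
        (fderiv ℝ (localR R b c) (tanChart E b (legendre H h z)) ζ).1 =
      modelForce (localHam H b) h (cotChart E b z) ζ := fun ζ => by
    obtain ⟨T, hT⟩ : (tanDeriv E b (legendre H h z)).IsInvertible :=
      isInvertible_bundleChartDeriv (mem_tanChart_source.2 hz.proj)
    obtain ⟨ζ, rfl⟩ := T.surjective ζ
    have hTζ : T ζ = tanDeriv E b (legendre H h z) ζ := DFunLike.congr_fun hT ζ
    have hpair := momenta_pairing (isInvertible_discretizationDeriv hR)
      ((h • (hamVec H z).2).coprod (covector z)) ζ
    rw [← covector_schemeMap] at hpair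
    rw [hTζ, fderiv_localR hR.contMDiffAt hz, modelForce_tanDeriv hH hz.proj,
      ← schemeMap_fst_proj, ← schemeMap_snd_proj, cotChart_snd hz.snd, cotChart_snd hz.fst]
    exact hpair
  have hmomenta := eq_momenta (p := ((cotChart E c.1 (schemeMap R H h z).1).2,
    (cotChart E c.2 (schemeMap R H h z).2).2)) hA pairing
  have hbase : localR R b c (tanChart E b (legendre H h z)) =
      ((cotChart E c.1 (schemeMap R H h z).1).1, (cotChart E c.2 (schemeMap R H h z).2).1) := by
    simp only [localR, (tanChart E b).left_inv (mem_tanChart_source.2 hz.proj)]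
    rfl
  simp only [modelScheme, ← tanChart_legendre hH hz.proj, ← hmomenta, hbase]

theorem contMDiff_legendre (hH : ContMDiff (cModel E) 𝓘(ℝ, ℝ) ∞ H) :
    ContMDiff (𝓘(ℝ, ℝ).prod (cModel E)) (tModel E) ∞
      (fun y : ℝ × CQ E Q => legendre H y.1 y.2) := by
  intro y
  have hy := mem_bundleChart_source_proj (E := E) y.2
  have hstep := contDiffAt_modelStep (h := y.1)
    (contDiffAt_localHam hH ((cotChart E y.2.proj).map_source hy))
  refine contMDiffAt_of_bundleChart_eq (b := y.2.proj) ?_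
    (hstep.contMDiffAt.comp y (contMDiffAt_prodMap_cotChart (mem_cotChart_source.1 hy)))
  filter_upwards [continuousAt_snd.eventually_mem ((isOpen_bundleChart_source _).mem_nhds hy)]
    with w hw
  have hw' := mem_cotChart_source.1 hw
  exact ⟨mem_tanChart_source.2 hw', tanChart_legendre hH hw' w.1⟩

variable (V H) in
/-- The pairs `(h, z)` for which `schemeMap R H h z` belongs to the scheme with `R` restricted
to `V`. -/
def schemeDomain : Set (ℝ × CQ E Q) := {y | legendre H y.1 y.2 ∈ V}

theorem isOpen_schemeDomain (hV : IsOpen V) (hH : ContMDiff (cModel E) 𝓘(ℝ, ℝ) ∞ H) :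
    IsOpen (schemeDomain V H) :=
  hV.preimage (contMDiff_legendre hH).continuous

theorem isRegularAt_cotChart (hH : ContMDiff (cModel E) 𝓘(ℝ, ℝ) ∞ H)
    (hR : IsLocalDiffeomorphAt (tModel E) (𝓘(ℝ, E).prod 𝓘(ℝ, E)) ∞ R (legendre H h z))
    (hz : InCharts R b c (legendre H h z)) :
    IsRegularAt (localR R b c) (localHam H b) h (cotChart E b z) where
  hamiltonian := contDiffAt_localHam hH
    ((cotChart E b).map_source (mem_cotChart_source.2 hz.proj))
  map := tanChart_legendre hH hz.proj h ▸ contDiffAt_localR hR.contMDiffAt hz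
  isInvertible := tanChart_legendre hH hz.proj h ▸ isInvertible_fderiv_localR hR hz

theorem eventually_mem_schemeDomain_and_inCharts (hV : IsInvertibleOn R U V)
    (hH : ContMDiff (cModel E) 𝓘(ℝ, ℝ) ∞ H) (hz : legendre H h z ∈ V)
    (hzc : InCharts R b c (legendre H h z)) :
    ∀ᶠ w in 𝓝 (h, z), w ∈ schemeDomain V H ∧ InCharts R b c (legendre H w.1 w.2) :=
  ((isOpen_schemeDomain hV.isOpen hH).eventually_mem (x := (h, z)) hz).and
    (hzc.eventually (contMDiff_legendre hH).continuous.continuousAt rfl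
      (hV.localDiffeo _ hz).contMDiffAt.continuousAt)

theorem contMDiffAt_schemeMap (hV : IsInvertibleOn R U V)
    (hH : ContMDiff (cModel E) 𝓘(ℝ, ℝ) ∞ H) {y : ℝ × CQ E Q} (hy : y ∈ schemeDomain V H) :
    ContMDiffAt (𝓘(ℝ, ℝ).prod (cModel E)) ((cModel E).prod (cModel E)) ∞
      (fun y : ℝ × CQ E Q => schemeMap R H y.1 y.2) y := by
  let b := y.2.proj
  let c := R (legendre H y.1 y.2)
  have hyc : InCharts R b c (legendre H y.1 y.2) := inCharts_self R (legendre H y.1 y.2)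
  have hR := hV.localDiffeo _ hy
  have hlocal := (isRegularAt_cotChart hH hR hyc).contDiffAt_modelScheme.contMDiffAt.comp y
    (contMDiffAt_prodMap_cotChart hyc.proj)
  have hcharts : ∀ᶠ w in 𝓝 y, InCharts R b c (legendre H w.1 w.2) ∧
      (cotChart E c.1 (schemeMap R H w.1 w.2).1, cotChart E c.2 (schemeMap R H w.1 w.2).2) =
        modelScheme (localR R b c) (localHam H b) w.1 (cotChart E b w.2) := by
    filter_upwards [eventually_mem_schemeDomain_and_inCharts hV hH hy hyc] with w ⟨hw, hwc⟩
    exact ⟨hwc, cotChart_schemeMap hH (hV.localDiffeo _ hw) hwc⟩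
  exact (contMDiffAt_of_bundleChart_eq (b := c.1) (hcharts.mono fun w hw =>
      ⟨mem_cotChart_source.2 hw.1.fst, congrArg Prod.fst hw.2⟩)
      (contDiffAt_fst.contMDiffAt.comp y hlocal)).prodMk
    (contMDiffAt_of_bundleChart_eq (b := c.2) (hcharts.mono fun w hw =>
      ⟨mem_cotChart_source.2 hw.1.snd, congrArg Prod.snd hw.2⟩)
      (contDiffAt_snd.contMDiffAt.comp y hlocal))

end SchemeMap

section Recover

variable [IsManifold 𝓘(ℝ, E) ∞ Q]
  {R : TQ E Q → Q × Q} {U V : Set (TQ E Q)} {y : CQ E Q × CQ E Q} {v : TQ E Q}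
  {b : Q} {c : Q × Q}

/-- The base point in `T*Q` of `(R_d^{T*})⁻¹(y)`, if `v ∈ TQ` is its projection to `TQ`. -/
def recoverAt (R : TQ E Q → Q × Q) (v : TQ E Q) (y : CQ E Q × CQ E Q) : CQ E Q :=
  ⟨v.proj, (covector y.2 ∘L .snd ℝ E E - covector y.1 ∘L .fst ℝ E E) ∘L
    discretizationDeriv R v ∘L .inr ℝ E E⟩

open Classical in
/-- The base point in `T*Q` of `(R_d^{T*})⁻¹(y)`, where `R_d` is restricted to `V`; the value off
`recoverDomain R V` is irrelevant. -/
def recover (R : TQ E Q → Q × Q) (V : Set (TQ E Q)) (y : CQ E Q × CQ E Q) : CQ E Q :=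
  if h : ∃ v ∈ V, R v = (y.1.proj, y.2.proj) then recoverAt R h.choose y else y.1

/-- The set of points at which the inverse of the cotangent lift of `R_d|_V` is defined. -/
def recoverDomain (R : TQ E Q → Q × Q) (V : Set (TQ E Q)) : Set (CQ E Q × CQ E Q) :=
  {y | (y.1.proj, y.2.proj) ∈ R '' V}

theorem recover_eq (hV : IsInvertibleOn R U V) (hv : v ∈ V) (hy : R v = (y.1.proj, y.2.proj)) :
    recover R V y = recoverAt R v y := by
  have h : ∃ v ∈ V, R v = (y.1.proj, y.2.proj) := ⟨v, hv, hy⟩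
  rw [recover, dif_pos h, hV.injOn h.choose_spec.1 hv (h.choose_spec.2.trans hy.symm)]

/-- The expression of `recoverAt` in charts, for a map `r` of the model space. -/
def modelRecover (r : E × E → E × E) (w : E × E) (p : (E →L[ℝ] ℝ) × (E →L[ℝ] ℝ)) :
    E × (E →L[ℝ] ℝ) :=
  (w.1, (p.2 ∘L .snd ℝ E E - p.1 ∘L .fst ℝ E E) ∘L fderiv ℝ r w ∘L .inr ℝ E E)

theorem contDiffAt_modelRecover {r : E × E → E × E} {w : E × E}
    {p : (E →L[ℝ] ℝ) × (E →L[ℝ] ℝ)} (hr : ContDiffAt ℝ ∞ r w) :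
    ContDiffAt ℝ ∞ (fun s : (E × E) × (E →L[ℝ] ℝ) × (E →L[ℝ] ℝ) => modelRecover r s.1 s.2)
      (w, p) := by
  have hfderiv : ContDiffAt ℝ ∞ (fun s : (E × E) × (E →L[ℝ] ℝ) × (E →L[ℝ] ℝ) => fderiv ℝ r s.1)
      (w, p) :=
    ContDiffAt.comp (g := fderiv ℝ r) (w, p) (hr.fderiv_right (m := ∞) (by simp)) contDiffAt_fst
  exact contDiffAt_fst.fst.prodMk
    (((contDiffAt_snd.snd.clm_comp contDiffAt_const).sub
      (contDiffAt_snd.fst.clm_comp contDiffAt_const)).clm_comp (hfderiv.clm_comp contDiffAt_const))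

theorem tanDeriv_vertical (hv : v.proj ∈ (chartAt E b).source) (ε : E) :
    tanDeriv E b v (0, ε) = (0, baseDeriv E b v.proj ε) := by
  refine Prod.ext ((bundleChartDeriv_fst (mem_tanChart_source.2 hv) _).trans (map_zero _)) ?_
  refine (SeparatingDual.eq_iff_forall_dual_eq (R := ℝ)).2 fun g => ?_
  have hg : (extChartAt 𝓘(ℝ, E) b v.proj, g) ∈ (cotChart E b).target :=
    mem_cotChart_target.2 ((extChartAt 𝓘(ℝ, E) b).map_source (by simpa using hv))
  let z : CQ E Q := (cotChart E b).symm (extChartAt 𝓘(ℝ, E) b v.proj, g)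
  have hz : z.proj = v.proj :=
    (proj_bundleChart_symm hg).trans ((extChartAt 𝓘(ℝ, E) b).left_inv (by simpa using hv))
  have hzg : (cotChart E b z).2 = g := congrArg Prod.snd ((cotChart E b).right_inv hg)
  have hpairing := pairing_cotDeriv_tanDeriv hz (hz ▸ hv) 0 0 ε
  rw [← cotChart_snd (hz ▸ hv), Prod.mk_zero_zero, map_zero, hzg, hz] at hpairing
  simpa using hpairing

theorem contMDiff_projs : ContMDiff ((cModel E).prod (cModel E)) (𝓘(ℝ, E).prod 𝓘(ℝ, E)) ∞
    (fun y : CQ E Q × CQ E Q => (y.1.proj, y.2.proj)) :=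
  ((Bundle.contMDiff_proj _).comp contMDiff_fst).prodMk
    ((Bundle.contMDiff_proj _).comp contMDiff_snd)

theorem isOpen_image_of_isInvertibleOn (hV : IsInvertibleOn R U V) : IsOpen (R '' V) := by
  rw [isOpen_iff_mem_nhds]
  rintro _ ⟨v, hv, rfl⟩
  have hR := hV.localDiffeo v hv
  have hinverse := hR.localInverse_left_inv hR.localInverse_mem_target
  filter_upwards [hR.localInverse_contMDiffAt.continuousAt.eventually_mem
    (hinverse.symm ▸ hV.isOpen.mem_nhds hv), hR.localInverse_eventuallyEq_right] with x hxV hx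
  exact ⟨_, hxV, hx⟩

theorem isOpen_recoverDomain (hV : IsInvertibleOn R U V) : IsOpen (recoverDomain R V) :=
  (isOpen_image_of_isInvertibleOn hV).preimage contMDiff_projs.continuous

theorem cotChart_recoverAt (hR : ContMDiffAt (tModel E) (𝓘(ℝ, E).prod 𝓘(ℝ, E)) ∞ R v)
    (hy : R v = (y.1.proj, y.2.proj)) (hv : InCharts R b c v) :
    cotChart E b (recoverAt R v y) = modelRecover (localR R b c) (tanChart E b v)
      ((cotChart E c.1 y.1).2, (cotChart E c.2 y.2).2) := by
  refine Prod.ext rfl (ContinuousLinearMap.ext fun ε => ?_)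
  obtain ⟨A, hA⟩ := isInvertible_baseDeriv hv.proj
  obtain ⟨ε, rfl⟩ := A.surjective ε
  have hAε : A ε = baseDeriv E b v.proj ε := DFunLike.congr_fun hA ε
  have hfst : (R v).1 = y.1.proj := congrArg Prod.fst hy
  have hsnd : (R v).2 = y.2.proj := congrArg Prod.snd hy
  have hderiv := fderiv_localR hR hv (0, ε)
  rw [tanDeriv_vertical hv.proj, ← hAε] at hderiv
  calc (cotChart E b (recoverAt R v y)).2 (A ε)
      = covector (recoverAt R v y) ε := by
        rw [hAε]
        exact cotChart_snd (z := recoverAt R v y) hv.proj ε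
    _ = covector y.2 (discretizationDeriv R v (0, ε)).2 -
          covector y.1 (discretizationDeriv R v (0, ε)).1 := rfl
    _ = _ := by
        simp only [modelRecover, ContinuousLinearMap.comp_apply, ContinuousLinearMap.inr_apply,
          sub_apply, ContinuousLinearMap.coe_fst', ContinuousLinearMap.coe_snd', hderiv, hfst,
          hsnd, cotChart_snd (hsnd ▸ hv.snd), cotChart_snd (hfst ▸ hv.fst)]

theorem contMDiffAt_recoverAt {σ : CQ E Q × CQ E Q → TQ E Q}
    (hσ : ContMDiffAt ((cModel E).prod (cModel E)) (tModel E) ∞ σ y)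
    (hR : ∀ᶠ w in 𝓝 y, ContMDiffAt (tModel E) (𝓘(ℝ, E).prod 𝓘(ℝ, E)) ∞ R (σ w))
    (hRσ : ∀ᶠ w in 𝓝 y, R (σ w) = (w.1.proj, w.2.proj)) :
    ContMDiffAt ((cModel E).prod (cModel E)) (cModel E) ∞ (fun w => recoverAt R (σ w) w) y := by
  let b := (σ y).proj
  let c := R (σ y)
  have hc : c = (y.1.proj, y.2.proj) := hRσ.self_of_nhds
  have hcharts : InCharts R b c (σ y) := inCharts_self R (σ y)
  have hRy := hR.self_of_nhds
  have hp₀ : ContMDiffAt ((cModel E).prod (cModel E)) 𝓘(ℝ, E →L[ℝ] ℝ) ∞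
      (fun w : CQ E Q × CQ E Q => (cotChart E c.1 w.1).2) y :=
    contDiffAt_snd.contMDiffAt.comp y ((contMDiffAt_bundleChart (mem_cotChart_source.2
      (by rw [hc]; exact mem_chart_source E _))).comp y contMDiffAt_fst)
  have hp₁ : ContMDiffAt ((cModel E).prod (cModel E)) 𝓘(ℝ, E →L[ℝ] ℝ) ∞
      (fun w : CQ E Q × CQ E Q => (cotChart E c.2 w.2).2) y :=
    contDiffAt_snd.contMDiffAt.comp y ((contMDiffAt_bundleChart (mem_cotChart_source.2
      (by rw [hc]; exact mem_chart_source E _))).comp y contMDiffAt_snd)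
  have htan := (contMDiffAt_bundleChart (mem_tanChart_source.2 hcharts.proj)).comp y hσ
  refine contMDiffAt_of_bundleChart_eq (b := b) ?_
    ((contDiffAt_modelRecover (contDiffAt_localR hRy hcharts)).contMDiffAt.comp y
      (htan.prodMk_space (hp₀.prodMk_space hp₁)))
  filter_upwards [hR, hRσ, hcharts.eventually hσ.continuousAt rfl hRy.continuousAt]
    with w hRw hRσw hw
  exact ⟨mem_cotChart_source.2 hw.proj, cotChart_recoverAt hRw hRσw hw⟩

theorem contMDiffAt_recover (hV : IsInvertibleOn R U V) (hy : y ∈ recoverDomain R V) :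
    ContMDiffAt ((cModel E).prod (cModel E)) (cModel E) ∞ (recover R V) y := by
  obtain ⟨v, hv, hRv⟩ := hy
  have hR := hV.localDiffeo v hv
  let σ : CQ E Q × CQ E Q → TQ E Q := fun w => hR.localInverse (w.1.proj, w.2.proj)
  have hσy : σ y = v :=
    (congrArg hR.localInverse hRv.symm).trans
      (hR.localInverse_left_inv hR.localInverse_mem_target)
  have hσ : ContMDiffAt ((cModel E).prod (cModel E)) (tModel E) ∞ σ y :=
    ContMDiffAt.comp (g := hR.localInverse) y (hRv ▸ hR.localInverse_contMDiffAt)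
      contMDiff_projs.contMDiffAt
  have hσV : ∀ᶠ w in 𝓝 y, σ w ∈ V :=
    hσ.continuousAt.eventually_mem (hV.isOpen.mem_nhds (hσy.symm ▸ hv))
  have hRσ : ∀ᶠ w in 𝓝 y, R (σ w) = (w.1.proj, w.2.proj) :=
    contMDiff_projs.continuous.continuousAt.eventually
      (hRv ▸ hR.localInverse_eventuallyEq_right)
  refine (contMDiffAt_recoverAt hσ (hσV.mono fun w hw => (hV.localDiffeo _ hw).contMDiffAt)
    hRσ).congr_of_eventuallyEq ?_
  filter_upwards [hσV, hRσ] with w hwV hw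
  exact recover_eq hV hwV hw

variable [FiniteDimensional ℝ E] {H : CQ E Q → ℝ} {h : ℝ} {z : CQ E Q}

theorem schemeMap_mem_recoverDomain (hz : legendre H h z ∈ V) :
    schemeMap R H h z ∈ recoverDomain R V :=
  ⟨_, hz, rfl⟩

theorem recover_schemeMap (hV : IsInvertibleOn R U V) (hz : legendre H h z ∈ V) :
    recover R V (schemeMap R H h z) = z := by
  rw [recover_eq hV hz rfl]
  have hcovector : (covector (schemeMap R H h z).2 ∘L .snd ℝ E E -
      covector (schemeMap R H h z).1 ∘L .fst ℝ E E) ∘L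
      discretizationDeriv R (legendre H h z) ∘L .inr ℝ E E = covector z := by
    refine ContinuousLinearMap.ext fun ε => ?_
    have hpairing := momenta_pairing (isInvertible_discretizationDeriv (hV.localDiffeo _ hz))
      ((h • (hamVec H z).2).coprod (covector z)) (0, ε)
    rw [← covector_schemeMap] at hpairing
    simpa using hpairing
  exact congrArg (fun p : E →L[ℝ] ℝ => (⟨z.proj, p⟩ : CQ E Q)) hcovector

end Recover

section Isotropic

variable {K W X : Type*} [Field K] [AddCommGroup W] [Module K W] [FiniteDimensional K W]
  [AddCommGroup X] [Module K X] {B : LinearMap.BilinForm K W}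

theorem eq_orthogonal_of_le_of_two_mul_finrank_eq (hB : B.Nondegenerate) {S : Submodule K W}
    (hS : S ≤ B.orthogonal S) (hdim : 2 * Module.finrank K S = Module.finrank K W) :
    S = B.orthogonal S :=
  Submodule.eq_of_le_of_finrank_eq hS
    (by rw [LinearMap.BilinForm.finrank_orthogonal hB]; omega)

theorem mem_range_iff_of_isotropic (hB : B.Nondegenerate) (hrefl : LinearMap.IsRefl B)
    {T : X →ₗ[K] W} (hT : Function.Injective T)
    (hdim : 2 * Module.finrank K X = Module.finrank K W)
    (hiso : ∀ ξ η, B (T ξ) (T η) = 0) (η : W) :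
    η ∈ Set.range T ↔ ∀ ζ ∈ Set.range T, B η ζ = 0 := by
  have hlagrangian : LinearMap.range T = B.orthogonal (LinearMap.range T) := by
    refine eq_orthogonal_of_le_of_two_mul_finrank_eq hB ?_
      (by rwa [LinearMap.finrank_range_of_inj hT])
    rintro _ ⟨ξ, rfl⟩ _ ⟨ζ, rfl⟩
    exact hiso ζ ξ
  refine ⟨?_, fun hη => ?_⟩
  · rintro ⟨ξ, rfl⟩ _ ⟨ζ, rfl⟩
    exact hiso ξ ζ
  · change η ∈ LinearMap.range T
    rw [hlagrangian]
    exact fun ζ hζ => hrefl _ _ (hη ζ hζ)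

end Isotropic

theorem isEmbedding_of_leftInvOn {X Y : Type*} [TopologicalSpace X] [TopologicalSpace Y]
    {f : X → Y} {g : Y → X} {D : Set X} {P : Set Y} (hf : ContinuousOn f D)
    (hg : ContinuousOn g P) (hfP : Set.MapsTo f D P) (hgf : Set.LeftInvOn g f D) :
    Topology.IsEmbedding (fun u : D => f u) := by
  have hcomp : P.domRestrict g ∘ hfP.restrict f D P = Subtype.val := funext fun u => hgf u.2
  exact Topology.IsEmbedding.subtypeVal.comp
    (.of_comp (hf.mapsToRestrict hfP) hg.domRestrict (hcomp ▸ .subtypeVal))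

section LeftInverse

variable {F₁ F₂ K₁ K₂ M N : Type*} [NormedAddCommGroup F₁] [NormedSpace ℝ F₁]
  [NormedAddCommGroup F₂] [NormedSpace ℝ F₂] [TopologicalSpace K₁] [TopologicalSpace K₂]
  {I : ModelWithCorners ℝ F₁ K₁} {J : ModelWithCorners ℝ F₂ K₂}
  [TopologicalSpace M] [ChartedSpace K₁ M] [TopologicalSpace N] [ChartedSpace K₂ N]

theorem injective_mfderiv_of_leftInverse {f : M → N} {g : N → M} {x : M}
    (hf : MDifferentiableAt I J f x) (hg : MDifferentiableAt J I g (f x))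
    (hgf : ∀ᶠ w in 𝓝 x, g (f w) = w) : Function.Injective (mfderiv I J f x) := by
  have hid := hasMFDerivAt_unique
    ((hg.hasMFDerivAt.comp x hf.hasMFDerivAt).congr_of_eventuallyEq (f₁ := id)
      (hgf.mono fun w hw => hw.symm)) (hasMFDerivAt_id x)
  exact Function.LeftInverse.injective (g := mfderiv J I g (f x)) (DFunLike.congr_fun hid)

end LeftInverse

section Omega12

variable (E) in
/-- The form `pr₂*ω - pr₁*ω`, on the model space of `T*Q × T*Q`. -/
def modelOmega12 : LinearMap.BilinForm ℝ ((E × (E →L[ℝ] ℝ)) × (E × (E →L[ℝ] ℝ))) :=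
  LinearMap.mk₂ ℝ (fun ξ η => (η.2.2 ξ.2.1 - ξ.2.2 η.2.1) - (η.1.2 ξ.1.1 - ξ.1.2 η.1.1))
    (by intros; simp; ring) (by intros; simp; ring) (by intros; simp; ring) (by intros; simp; ring)

theorem isRefl_modelOmega12 : LinearMap.IsRefl (modelOmega12 E) := fun ξ η hξ => by
  have hneg : modelOmega12 E η ξ = -modelOmega12 E ξ η := by
    simp only [modelOmega12, LinearMap.mk₂_apply]
    ring
  rw [hneg, hξ, neg_zero]

theorem nondegenerate_modelOmega12 : (modelOmega12 E).Nondegenerate := by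
  refine (LinearMap.IsRefl.nondegenerate_iff_separatingLeft isRefl_modelOmega12).2 fun ξ hξ => ?_
  refine Prod.ext (Prod.ext ?_ (ContinuousLinearMap.ext fun e => ?_))
    (Prod.ext ?_ (ContinuousLinearMap.ext fun e => ?_))
  · exact SeparatingDual.eq_zero_of_forall_dual_eq_zero (R := ℝ) fun g => by
      simpa [modelOmega12] using hξ ((0, g), 0)
  · simpa [modelOmega12] using hξ ((e, 0), 0)
  · exact SeparatingDual.eq_zero_of_forall_dual_eq_zero (R := ℝ) fun g => by
      simpa [modelOmega12] using hξ (0, (0, g))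
  · simpa [modelOmega12] using hξ (0, (e, 0))

variable [IsManifold 𝓘(ℝ, E) ∞ Q]

theorem omega12_eq_modelOmega12 (y : CQ E Q × CQ E Q)
    (ξ η : (E × (E →L[ℝ] ℝ)) × (E × (E →L[ℝ] ℝ))) : omega12 y ξ η = modelOmega12 E ξ η :=
  congrArg₂ (· - ·) (omega_apply y.2 ξ.2 η.2) (omega_apply y.1 ξ.1 η.1)

end Omega12

section Lagrangian

variable [IsManifold 𝓘(ℝ, E) ∞ Q]

/-- A smooth parametrization of a subset of `(T*Q × T*Q, pr₂*ω - pr₁*ω)` by an open subset `O` of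
`T*Q` that is isotropic and has a smooth left inverse `ρ` on an open set `P` containing its
image. -/
structure IsLagrangianParametrization (F : CQ E Q → CQ E Q × CQ E Q) (O : Set (CQ E Q))
    (ρ : CQ E Q × CQ E Q → CQ E Q) (P : Set (CQ E Q × CQ E Q)) : Prop where
  isOpen_source : IsOpen O
  isOpen_target : IsOpen P
  mapsTo : Set.MapsTo F O P
  leftInvOn : Set.LeftInvOn ρ F O
  contMDiffAt : ∀ z ∈ O, ContMDiffAt (cModel E) ((cModel E).prod (cModel E)) ∞ F z
  contMDiffAt_leftInverse : ∀ y ∈ P, ContMDiffAt ((cModel E).prod (cModel E)) (cModel E) ∞ ρ y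
  isotropic : ∀ z ∈ O, ∀ ξ η,
    modelOmega12 E (modelDeriv (cModel E) ((cModel E).prod (cModel E)) F z ξ)
      (modelDeriv (cModel E) ((cModel E).prod (cModel E)) F z η) = 0

namespace IsLagrangianParametrization

variable {F : CQ E Q → CQ E Q × CQ E Q} {O : Set (CQ E Q)} {ρ : CQ E Q × CQ E Q → CQ E Q}
  {P : Set (CQ E Q × CQ E Q)} {z : CQ E Q}

theorem hasMFDerivAt (hF : IsLagrangianParametrization F O ρ P) (hz : z ∈ O) :
    HasMFDerivAt (cModel E) ((cModel E).prod (cModel E)) F z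
      (modelDeriv (cModel E) ((cModel E).prod (cModel E)) F z) :=
  ((hF.contMDiffAt z hz).mdifferentiableAt (by simp)).hasMFDerivAt

theorem modelOmega12_eq_zero {G K X : Type*} [NormedAddCommGroup G] [NormedSpace ℝ G]
    [TopologicalSpace K] {I : ModelWithCorners ℝ G K} [TopologicalSpace X] [ChartedSpace K X]
    (hF : IsLagrangianParametrization F O ρ P) {γ : X → CQ E Q × CQ E Q} {x : X}
    {γ' : G →L[ℝ] (E × (E →L[ℝ] ℝ)) × (E × (E →L[ℝ] ℝ))}
    (hγ : HasMFDerivAt I ((cModel E).prod (cModel E)) γ x γ')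
    (hγF : ∀ᶠ w in 𝓝 x, γ w ∈ F '' O) (ξ η : G) :
    modelOmega12 E (γ' ξ) (γ' η) = 0 := by
  obtain ⟨z, hz, hzx⟩ := hγF.self_of_nhds
  have hρx : (ρ ∘ γ) x ∈ O := by
    rw [Function.comp_apply, ← hzx, hF.leftInvOn hz]
    exact hz
  have hρ := (hF.contMDiffAt_leftInverse _ (hzx ▸ hF.mapsTo hz)).mdifferentiableAt (by simp)
  have hfactor : γ =ᶠ[𝓝 x] F ∘ ρ ∘ γ := by
    filter_upwards [hγF] with w ⟨y, hy, hyw⟩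
    simp only [Function.comp_apply]
    rw [← hyw, hF.leftInvOn hy]
  have hderiv := hasMFDerivAt_unique hγ (((hF.hasMFDerivAt hρx).comp x
    (hρ.hasMFDerivAt.comp x hγ)).congr_of_eventuallyEq hfactor)
  rw [hderiv]
  exact hF.isotropic _ hρx _ _

theorem image_comp_symm (hF : IsLagrangianParametrization F O ρ P) {X : Type*}
    (κ : PartialEquiv (CQ E Q) X) :
    F ∘ κ.symm '' (κ.target ∩ κ.symm ⁻¹' (κ.source ∩ O)) =
      F '' O ∩ (P ∩ ρ ⁻¹' (κ.source ∩ O)) := by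
  ext y
  constructor
  · rintro ⟨u, ⟨-, hu⟩, rfl⟩
    refine ⟨⟨_, hu.2, rfl⟩, hF.mapsTo hu.2, ?_⟩
    rwa [Set.mem_preimage, Function.comp_apply, hF.leftInvOn hu.2]
  · rintro ⟨⟨z, hz, rfl⟩, -, hρz⟩
    rw [Set.mem_preimage, hF.leftInvOn hz] at hρz
    have hκz := κ.left_inv hρz.1
    refine ⟨κ z, ⟨κ.map_source hρz.1, ?_⟩, congrArg F hκz⟩
    rwa [Set.mem_preimage, hκz]

variable [FiniteDimensional ℝ E]

theorem mem_range_mfderiv_iff (hF : IsLagrangianParametrization F O ρ P)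
    {f : E × (E →L[ℝ] ℝ) → CQ E Q × CQ E Q} {u : E × (E →L[ℝ] ℝ)}
    (hfF : ∀ᶠ w in 𝓝 u, f w ∈ F '' O)
    (hf : MDifferentiableAt 𝓘(ℝ, E × (E →L[ℝ] ℝ)) ((cModel E).prod (cModel E)) f u)
    (hinj : Function.Injective
      (mfderiv 𝓘(ℝ, E × (E →L[ℝ] ℝ)) ((cModel E).prod (cModel E)) f u))
    (η : TangentSpace ((cModel E).prod (cModel E)) (f u)) :
    η ∈ Set.range (mfderiv 𝓘(ℝ, E × (E →L[ℝ] ℝ)) ((cModel E).prod (cModel E)) f u) ↔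
      ∀ ζ ∈ Set.range (mfderiv 𝓘(ℝ, E × (E →L[ℝ] ℝ)) ((cModel E).prod (cModel E)) f u),
        omega12 (f u) η ζ = 0 := by
  refine (mem_range_iff_of_isotropic nondegenerate_modelOmega12 isRefl_modelOmega12
    (T := (modelDeriv 𝓘(ℝ, E × (E →L[ℝ] ℝ)) ((cModel E).prod (cModel E)) f u).toLinearMap)
    hinj ?_ (hF.modelOmega12_eq_zero hf.hasMFDerivAt hfF) η).trans ?_
  · rw [two_mul, ← Module.finrank_prod]
  · exact forall₂_congr fun ζ _ => by rw [← omega12_eq_modelOmega12 (f u) η ζ]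

theorem isLagrangianSubmanifold (hF : IsLagrangianParametrization F O ρ P) :
    IsLagrangianSubmanifold (F '' O) := by
  rintro _ ⟨z, hz, rfl⟩
  have hchart := mem_bundleChart_source_proj (E := E) z
  let κ := cotChart E z.proj
  let N := κ.source ∩ O
  let D := κ.target ∩ κ.symm ⁻¹' N
  let W := P ∩ ρ ⁻¹' N
  have hN : IsOpen N := (isOpen_bundleChart_source _).inter hF.isOpen_source
  have hκ : ContinuousOn κ.symm κ.target := fun u hu =>
    (contMDiffAt_bundleChart_symm hu).continuousAt.continuousWithinAt
  have hρ : ContinuousOn ρ P := fun y hy =>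
    (hF.contMDiffAt_leftInverse y hy).continuousAt.continuousWithinAt
  have hf : ∀ u ∈ D, ContMDiffAt 𝓘(ℝ, E × (E →L[ℝ] ℝ)) ((cModel E).prod (cModel E)) ∞
      (F ∘ κ.symm) u := fun u hu =>
    (hF.contMDiffAt _ hu.2.2).comp u (contMDiffAt_bundleChart_symm hu.1)
  have hmaps : Set.MapsTo (F ∘ κ.symm) D W := fun u hu =>
    ⟨hF.mapsTo hu.2.2, by
      rw [Set.mem_preimage, Function.comp_apply, hF.leftInvOn hu.2.2]; exact hu.2⟩
  have hleft : Set.LeftInvOn (κ ∘ ρ) (F ∘ κ.symm) D := fun u hu => by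
    simp only [Function.comp_apply, hF.leftInvOn hu.2.2, κ.right_inv hu.1]
  have hκρ : ∀ y ∈ W, ContMDiffAt ((cModel E).prod (cModel E)) 𝓘(ℝ, E × (E →L[ℝ] ℝ)) ∞
      (κ ∘ ρ) y := fun y hy =>
    (contMDiffAt_bundleChart hy.2.1).comp y (hF.contMDiffAt_leftInverse y hy.1)
  have hD : IsOpen D := hκ.isOpen_inter_preimage (isOpen_bundleChart_target _) hN
  refine ⟨D, F ∘ κ.symm, W, hD, hρ.isOpen_inter_preimage hF.isOpen_target hN,
    ⟨hF.mapsTo hz, ?_⟩, hF.image_comp_symm κ, fun u hu => (hf u hu).contMDiffWithinAt,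
    isEmbedding_of_leftInvOn (fun u hu => (hf u hu).continuousAt.continuousWithinAt)
      (fun y hy => (hκρ y hy).continuousAt.continuousWithinAt) hmaps hleft, fun u hu => ?_⟩
  · rw [Set.mem_preimage, hF.leftInvOn hz]
    exact ⟨hchart, hz⟩
  · have hfu := (hf u hu).mdifferentiableAt (by simp)
    have hinj := injective_mfderiv_of_leftInverse hfu
      ((hκρ _ (hmaps hu)).mdifferentiableAt (by simp)) ((hD.eventually_mem hu).mono hleft)
    exact ⟨hinj, hF.mem_range_mfderiv_iff
      ((hD.eventually_mem hu).mono fun w hw => ⟨_, hw.2.2, rfl⟩) hfu hinj⟩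

end IsLagrangianParametrization

variable [FiniteDimensional ℝ E] {φ : CQ E Q → CQ E Q} {D : Set (CQ E Q)} {z : CQ E Q}

theorem isLocalDiffeomorphAt_of_omega_mfderiv
    (hφ : ∀ᶠ w in 𝓝 z, ContMDiffAt (cModel E) (cModel E) ∞ φ w)
    (hω : ∀ ξ η, omega (φ z) (mfderiv (cModel E) (cModel E) φ z ξ)
      (mfderiv (cModel E) (cModel E) φ z η) = omega z ξ η) :
    IsLocalDiffeomorphAt (cModel E) (cModel E) ∞ φ z := by
  let φ' : E × (E →L[ℝ] ℝ) →L[ℝ] E × (E →L[ℝ] ℝ) := modelDeriv (cModel E) (cModel E) φ z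
  have hinj : Function.Injective φ'.toLinearMap := (injective_iff_map_eq_zero _).2 fun ξ hξ => by
    refine omega_nondegenerate z ξ fun η => (hω ξ η).symm.trans ?_
    refine (omega_apply (φ z) (φ' ξ) (φ' η)).trans ?_
    simp [show φ' ξ = 0 from hξ]
  exact isLocalDiffeomorphAt_of_hasMFDerivAt hφ
    (f' := (LinearEquiv.ofInjectiveEndo _ hinj).toContinuousLinearEquiv)
    (hφ.self_of_nhds.mdifferentiableAt (by simp)).hasMFDerivAt

theorem IsLagrangianParametrization.isLocalSymplectomorphismOn {F : CQ E Q → CQ E Q × CQ E Q}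
    {O : Set (CQ E Q)} {ρ : CQ E Q × CQ E Q → CQ E Q} {P : Set (CQ E Q × CQ E Q)}
    (hF : IsLagrangianParametrization F O ρ P) (hD : IsOpen D)
    (hφ : ContMDiffOn (cModel E) (cModel E) ∞ φ D) (hg : ∀ z ∈ D, (z, φ z) ∈ F '' O) :
    IsLocalSymplectomorphismOn φ D := by
  intro z hz
  have hφz : ∀ᶠ w in 𝓝 z, ContMDiffAt (cModel E) (cModel E) ∞ φ w :=
    (hD.eventually_mem hz).mono fun w hw => hφ.contMDiffAt (hD.mem_nhds hw)
  have hφ' := (hφz.self_of_nhds.mdifferentiableAt (by simp)).hasMFDerivAt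
  have hω : ∀ ξ η, omega (φ z) (mfderiv (cModel E) (cModel E) φ z ξ)
      (mfderiv (cModel E) (cModel E) φ z η) = omega z ξ η := fun ξ η =>
    sub_eq_zero.1 ((omega12_eq_modelOmega12 (z, φ z) _ _).trans
      (hF.modelOmega12_eq_zero ((hasMFDerivAt_id z).prodMk hφ')
        ((hD.eventually_mem hz).mono hg) ξ η))
  exact ⟨isLocalDiffeomorphAt_of_omega_mfderiv hφz hω, hω⟩

end Lagrangian

section SchemeIsLagrangian

variable [IsManifold 𝓘(ℝ, E) ∞ Q] [FiniteDimensional ℝ E]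
  {R : TQ E Q → Q × Q} {U V : Set (TQ E Q)} {H : CQ E Q → ℝ} {h : ℝ} {z : CQ E Q}

theorem contMDiffAt_schemeMap_right (hV : IsInvertibleOn R U V)
    (hH : ContMDiff (cModel E) 𝓘(ℝ, ℝ) ∞ H) (hz : legendre H h z ∈ V) :
    ContMDiffAt (cModel E) ((cModel E).prod (cModel E)) ∞ (schemeMap R H h) z :=
  (contMDiffAt_schemeMap (y := (h, z)) hV hH hz).comp z (contMDiffAt_const.prodMk contMDiffAt_id)

theorem eventually_legendre_mem_and_inCharts (hV : IsInvertibleOn R U V)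
    (hH : ContMDiff (cModel E) 𝓘(ℝ, ℝ) ∞ H) (hz : legendre H h z ∈ V) :
    ∀ᶠ u in 𝓝 (cotChart E z.proj z), u ∈ (cotChart E z.proj).target ∧
      legendre H h ((cotChart E z.proj).symm u) ∈ V ∧
      InCharts R z.proj (R (legendre H h z)) (legendre H h ((cotChart E z.proj).symm u)) :=
  eventually_bundleChart_symm (mem_bundleChart_source_proj (E := E) z)
    ((Continuous.prodMk_right h).continuousAt.eventually
      (eventually_mem_schemeDomain_and_inCharts hV hH hz (inCharts_self R (legendre H h z))))

theorem hasFDerivAt_modelScheme (hV : IsInvertibleOn R U V)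
    (hH : ContMDiff (cModel E) 𝓘(ℝ, ℝ) ∞ H) (hz : legendre H h z ∈ V) :
    HasFDerivAt (modelScheme (localR R z.proj (R (legendre H h z))) (localHam H z.proj) h)
      (modelDeriv (cModel E) ((cModel E).prod (cModel E)) (schemeMap R H h) z)
      (cotChart E z.proj z) := by
  have hderiv : HasFDerivWithinAt (writtenInExtChartAt (cModel E) ((cModel E).prod (cModel E)) z
      (schemeMap R H h)) (modelDeriv (cModel E) ((cModel E).prod (cModel E)) (schemeMap R H h) z)
      (Set.range (cModel E)) (extChartAt (cModel E) z z) :=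
    ((contMDiffAt_schemeMap_right hV hH hz).mdifferentiableAt (by simp)).hasMFDerivAt.2
  rw [ModelWithCorners.range_eq_univ, hasFDerivWithinAt_univ, extChartAt_eq_bundleChart] at hderiv
  refine hderiv.congr_of_eventuallyEq ?_
  filter_upwards [eventually_legendre_mem_and_inCharts hV hH hz] with u ⟨hu, hmem, hcharts⟩
  have hlocal : (cotChart E _ (schemeMap R H h ((cotChart E z.proj).symm u)).1,
      cotChart E _ (schemeMap R H h ((cotChart E z.proj).symm u)).2) =
      modelScheme (localR R z.proj _) (localHam H z.proj) h
        (cotChart E z.proj ((cotChart E z.proj).symm u)) :=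
    cotChart_schemeMap hH (hV.localDiffeo _ hmem) hcharts
  rw [(cotChart E z.proj).right_inv hu] at hlocal
  rw [← hlocal]
  simp only [writtenInExtChartAt, Function.comp_apply, extChartAt_prod, extChartAt_eq_bundleChart]
  rfl

theorem isLagrangianParametrization_schemeMap (hV : IsInvertibleOn R U V)
    (hH : ContMDiff (cModel E) 𝓘(ℝ, ℝ) ∞ H) (h : ℝ) :
    IsLagrangianParametrization (schemeMap R H h) {z | legendre H h z ∈ V} (recover R V)
      (recoverDomain R V) where
  isOpen_source := (isOpen_schemeDomain hV.isOpen hH).preimage (Continuous.prodMk_right h)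
  isOpen_target := isOpen_recoverDomain hV
  mapsTo _ hz := schemeMap_mem_recoverDomain hz
  leftInvOn _ hz := recover_schemeMap hV hz
  contMDiffAt _ hz := contMDiffAt_schemeMap_right hV hH hz
  contMDiffAt_leftInverse _ hy := contMDiffAt_recover hV hy
  isotropic z hz ξ η := by
    refine sub_eq_zero.2 (modelScheme_isotropic ?_ (hasFDerivAt_modelScheme hV hH hz) ξ η)
    filter_upwards [eventually_legendre_mem_and_inCharts hV hH hz] with u ⟨hu, hmem, hcharts⟩
    have hregular : IsRegularAt (localR R z.proj _) (localHam H z.proj) h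
        (cotChart E z.proj ((cotChart E z.proj).symm u)) :=
      isRegularAt_cotChart hH (hV.localDiffeo _ hmem) hcharts
    rwa [(cotChart E z.proj).right_inv hu] at hregular

theorem scheme_eq_image (h : ℝ) : scheme R V H h = schemeMap R H h '' {z | legendre H h z ∈ V} :=
  Set.ext fun _ => mem_scheme_iff

theorem scheme_isLagrangian (hV : IsInvertibleOn R U V)
    (hH : ContMDiff (cModel E) 𝓘(ℝ, ℝ) ∞ H) (h : ℝ) :
    IsLagrangianSubmanifold (scheme R V H h) :=
  scheme_eq_image (R := R) (V := V) (H := H) h ▸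
    (isLagrangianParametrization_schemeMap hV hH h).isLagrangianSubmanifold

theorem isLocalSymplectomorphismOn_of_graph_subset (hV : IsInvertibleOn R U V)
    (hH : ContMDiff (cModel E) 𝓘(ℝ, ℝ) ∞ H) {D : Set (CQ E Q)} {φ : CQ E Q → CQ E Q}
    (hD : IsOpen D) (hφ : ContMDiffOn (cModel E) (cModel E) ∞ φ D)
    (hg : ∀ z ∈ D, (z, φ z) ∈ scheme R V H h) : IsLocalSymplectomorphismOn φ D :=
  (isLagrangianParametrization_schemeMap hV hH h).isLocalSymplectomorphismOn hD hφ
    fun z hz => mem_scheme_iff.1 (hg z hz)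

end SchemeIsLagrangian

section Rigidity

theorem eventually_mem_range_extChartAt (b : Q) :
    ∀ᶠ y in 𝓝 (extChartAt 𝓘(ℝ, E) b b),
      ∃ q ∈ (chartAt E b).source, extChartAt 𝓘(ℝ, E) b q = y := by
  filter_upwards [extChartAt_target_mem_nhds (I := 𝓘(ℝ, E)) b] with y hy
  exact ⟨(extChartAt 𝓘(ℝ, E) b).symm y, by simpa using (extChartAt 𝓘(ℝ, E) b).map_target hy,
    (extChartAt 𝓘(ℝ, E) b).right_inv hy⟩

variable [IsManifold 𝓘(ℝ, E) ∞ Q] {R : TQ E Q → Q × Q} {U : Set (TQ E Q)} {b q : Q}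

theorem contMDiffAt_fiber (q : Q) (e : E) :
    ContMDiffAt 𝓘(ℝ, E) (tModel E) ∞ (fun e : E => (⟨q, e⟩ : TQ E Q)) e :=
  contMDiffAt_of_bundleChart_eq (g := fun e => (extChartAt 𝓘(ℝ, E) q q, e))
    (.of_forall fun e => ⟨mem_bundleChart_source_proj (⟨q, e⟩ : TQ E Q), tanChart_proj ⟨q, e⟩⟩)
    ((contDiffAt_const.prodMk contDiffAt_id).contMDiffAt)

theorem hasMFDerivAt_fiber (q : Q) (e : E) :
    HasMFDerivAt 𝓘(ℝ, E) (tModel E) (fun e : E => (⟨q, e⟩ : TQ E Q)) e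
      (ContinuousLinearMap.inr ℝ E E) := by
  let D : E →L[ℝ] E × E := modelDeriv 𝓘(ℝ, E) (tModel E) (fun e : E => (⟨q, e⟩ : TQ E Q)) e
  have dfiber : HasMFDerivAt 𝓘(ℝ, E) (tModel E) (fun e : E => (⟨q, e⟩ : TQ E Q)) e D :=
    ((contMDiffAt_fiber q e).mdifferentiableAt (by simp)).hasMFDerivAt
  have dchart := (hasMFDerivAt_bundleChart (mem_bundleChart_source_proj (E := E)
    (⟨q, e⟩ : TQ E Q))).comp e dfiber
  have dpair : HasFDerivAt (fun e : E => (extChartAt 𝓘(ℝ, E) q q, e))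
      (ContinuousLinearMap.inr ℝ E E) e := (hasFDerivAt_const _ _).prodMk (hasFDerivAt_id e)
  rw [bundleChartDeriv_proj] at dchart
  have hD : D = ContinuousLinearMap.inr ℝ E E := hasMFDerivAt_unique
    (dchart.congr_of_eventuallyEq (.of_forall fun e => (tanChart_proj ⟨q, e⟩).symm))
    dpair.hasMFDerivAt
  exact hD ▸ dfiber

theorem contMDiffAt_zero (hR : IsDiscretizationMap R U) (q : Q) :
    ContMDiffAt (tModel E) (𝓘(ℝ, E).prod 𝓘(ℝ, E)) ∞ R (⟨q, 0⟩ : TQ E Q) :=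
  hR.smooth.contMDiffAt (hR.isOpen.mem_nhds (hR.zero_mem q))

theorem discretizationDeriv_vertical (hR : IsDiscretizationMap R U) (q : Q) (e : E) :
    (discretizationDeriv R (⟨q, 0⟩ : TQ E Q) (0, e)).2 -
      (discretizationDeriv R (⟨q, 0⟩ : TQ E Q) (0, e)).1 = e := by
  have dR : HasMFDerivAt (tModel E) (𝓘(ℝ, E).prod 𝓘(ℝ, E)) R (⟨q, 0⟩ : TQ E Q)
      (discretizationDeriv R ⟨q, 0⟩) :=
    ((contMDiffAt_zero hR q).mdifferentiableAt (by simp)).hasMFDerivAt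
  have dfiber := dR.comp (0 : E) (hasMFDerivAt_fiber q 0)
  have dfst := (hasMFDerivAt_fst (I := 𝓘(ℝ, E)) (I' := 𝓘(ℝ, E)) (R ⟨q, 0⟩)).comp (0 : E) dfiber
  have dsnd := (hasMFDerivAt_snd (I := 𝓘(ℝ, E)) (I' := 𝓘(ℝ, E)) (R ⟨q, 0⟩)).comp (0 : E) dfiber
  have hfst : fiberDeriv (fun v => (R v).1) q e =
      (discretizationDeriv R (⟨q, 0⟩ : TQ E Q) (0, e)).1 := DFunLike.congr_fun dfst.mfderiv e
  have hsnd : fiberDeriv (fun v => (R v).2) q e =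
      (discretizationDeriv R (⟨q, 0⟩ : TQ E Q) (0, e)).2 := DFunLike.congr_fun dsnd.mfderiv e
  rw [← hfst, ← hsnd]
  exact DFunLike.congr_fun (hR.rigidity q) e

theorem tanChart_zero (hq : q ∈ (chartAt E b).source) :
    tanChart E b (⟨q, 0⟩ : TQ E Q) = (extChartAt 𝓘(ℝ, E) b q, 0) :=
  Prod.ext (tanChart_fst _ _) ((tanChart_snd (v := ⟨q, 0⟩) hq).trans (map_zero _))

theorem inCharts_zero (hR : IsDiscretizationMap R U) (hq : q ∈ (chartAt E b).source) :
    InCharts R b (b, b) ⟨q, 0⟩ :=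
  ⟨hq, by rwa [hR.map_zero], by rwa [hR.map_zero]⟩

theorem localR_zero (hR : IsDiscretizationMap R U) (hq : q ∈ (chartAt E b).source) :
    localR R b (b, b) (extChartAt 𝓘(ℝ, E) b q, 0) =
      (extChartAt 𝓘(ℝ, E) b q, extChartAt 𝓘(ℝ, E) b q) := by
  rw [← tanChart_zero hq]
  simp only [localR, (tanChart E b).left_inv ((mem_tanChart_source (v := ⟨q, 0⟩)).2 hq),
    hR.map_zero]

theorem contDiffAt_localR_zero (hR : IsDiscretizationMap R U) (hq : q ∈ (chartAt E b).source) :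
    ContDiffAt ℝ ∞ (localR R b (b, b)) (extChartAt 𝓘(ℝ, E) b q, 0) :=
  tanChart_zero hq ▸ contDiffAt_localR (contMDiffAt_zero hR q) (inCharts_zero hR hq)

theorem fderiv_localR_vertical (hR : IsDiscretizationMap R U) (hq : q ∈ (chartAt E b).source)
    (e : E) :
    (fderiv ℝ (localR R b (b, b)) (extChartAt 𝓘(ℝ, E) b q, 0) (0, e)).2 -
      (fderiv ℝ (localR R b (b, b)) (extChartAt 𝓘(ℝ, E) b q, 0) (0, e)).1 = e := by
  obtain ⟨A, hA⟩ := isInvertible_baseDeriv hq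
  obtain ⟨a, rfl⟩ : ∃ a, baseDeriv E b q a = e := ⟨A.symm e, by simp [← hA]⟩
  have hlocal := fderiv_localR (contMDiffAt_zero hR q) (inCharts_zero hR hq) (0, a)
  rw [show tanDeriv E b ⟨q, 0⟩ (0, a) = (0, baseDeriv E b q a) from
    tanDeriv_vertical (v := ⟨q, 0⟩) hq a, tanChart_zero hq, hR.map_zero] at hlocal
  rw [hlocal, ← map_sub, discretizationDeriv_vertical hR]

theorem isModelDiscretizationAt_localR (hR : IsDiscretizationMap R U) (b : Q) :
    IsModelDiscretizationAt (localR R b (b, b)) (extChartAt 𝓘(ℝ, E) b b) where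
  contDiffAt := contDiffAt_localR_zero hR (mem_chart_source E b)
  diagonal := (eventually_mem_range_extChartAt b).mono fun _ ⟨_, hq, hy⟩ => hy ▸ localR_zero hR hq
  vertical := (eventually_mem_range_extChartAt b).mono fun _ ⟨_, hq, hy⟩ e =>
    hy ▸ fderiv_localR_vertical hR hq e

theorem discretizationDeriv_zero (hR : IsDiscretizationMap R U) (q : Q) :
    discretizationDeriv R (⟨q, 0⟩ : TQ E Q) =
      fderiv ℝ (localR R q (q, q)) (extChartAt 𝓘(ℝ, E) q q, 0) := by
  refine ContinuousLinearMap.ext fun ζ => ?_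
  have hq := mem_chart_source E q
  have hlocal := fderiv_localR (contMDiffAt_zero hR q) (inCharts_zero hR hq) ζ
  rw [show tanDeriv E q ⟨q, 0⟩ = ContinuousLinearMap.id ℝ _ from bundleChartDeriv_proj ⟨q, 0⟩,
    tanChart_zero hq, hR.map_zero, baseDeriv_self] at hlocal
  exact hlocal.symm

theorem isLocalDiffeomorphAt_zero [FiniteDimensional ℝ E] (hR : IsDiscretizationMap R U) (q : Q) :
    IsLocalDiffeomorphAt (tModel E) (𝓘(ℝ, E).prod 𝓘(ℝ, E)) ∞ R (⟨q, 0⟩ : TQ E Q) := by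
  obtain ⟨D, hD⟩ := (isModelDiscretizationAt_localR hR q).isInvertible_fderiv
  refine isLocalDiffeomorphAt_of_hasMFDerivAt (f' := D) ?_ ?_
  · exact (hR.isOpen.eventually_mem (hR.zero_mem q)).mono fun v hv =>
      hR.smooth.contMDiffAt (hR.isOpen.mem_nhds hv)
  · rw [hD, ← discretizationDeriv_zero hR]
    exact ((contMDiffAt_zero hR q).mdifferentiableAt (by simp)).hasMFDerivAt

theorem exists_isInvertibleOn [FiniteDimensional ℝ E] (hR : IsDiscretizationMap R U) (q : Q) :
    ∃ V : Set (TQ E Q), IsInvertibleOn R U V ∧ (⟨q, 0⟩ : TQ E Q) ∈ V := by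
  obtain ⟨Φ, hΦ, hΦR⟩ := isLocalDiffeomorphAt_zero hR q
  exact ⟨Φ.source ∩ U,
    { isOpen := Φ.open_source.inter hR.isOpen
      subset := Set.inter_subset_right
      injOn := (hΦR.injOn_iff.2 Φ.injOn).mono Set.inter_subset_left
      localDiffeo := fun v hv => ⟨Φ, hv.1, hΦR⟩ }, hΦ, hR.zero_mem q⟩

end Rigidity

section Consistency

variable [IsManifold 𝓘(ℝ, E) ∞ Q]

theorem hasDerivAt_velocityAtZero {c : ℝ → CQ E Q} (hc : ContMDiffAt 𝓘(ℝ, ℝ) (cModel E) ∞ c 0) :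
    HasDerivAt (fun h => cotChart E (c 0).proj (c h)) (velocityAtZero c : E × (E →L[ℝ] ℝ)) 0 := by
  let D : ℝ →L[ℝ] E × (E →L[ℝ] ℝ) := modelDeriv 𝓘(ℝ, ℝ) (cModel E) c 0
  have hD : HasMFDerivAt 𝓘(ℝ, ℝ) (cModel E) c 0 D :=
    (hc.mdifferentiableAt (by simp)).hasMFDerivAt
  have dchart := (hasMFDerivAt_bundleChart (mem_bundleChart_source_proj (E := E) (c 0))).comp 0 hD
  rw [bundleChartDeriv_proj] at dchart
  have dcurve : HasFDerivAt (fun h => cotChart E (c 0).proj (c h)) D 0 := dchart.hasFDerivAt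
  exact dcurve.hasDerivAt

variable [FiniteDimensional ℝ E] {R : TQ E Q → Q × Q} {U V : Set (TQ E Q)} {H : CQ E Q → ℝ}

theorem hamField_self (hH : ContMDiff (cModel E) 𝓘(ℝ, ℝ) ∞ H) (z : CQ E Q) :
    hamField (localHam H z.proj) (cotChart E z.proj z) = hamVec H z := by
  have hz : z.proj ∈ (chartAt E z.proj).source := mem_chart_source E z.proj
  refine Prod.ext ?_ (ContinuousLinearMap.ext fun δ => ?_)
  · rw [hamField_fst hH hz, baseDeriv_self, ContinuousLinearMap.id_apply]
  · have hdH := dH_eq_fderiv_localHam hH hz (δ, 0)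
    rw [show cotDeriv E z.proj z = ContinuousLinearMap.id ℝ _ from bundleChartDeriv_proj z,
      ContinuousLinearMap.id_apply, dH_eq_hamVec, fderiv_eq_hamField] at hdH
    simpa using hdH.symm

theorem legendre_zero (z : CQ E Q) : legendre H 0 z = ⟨z.proj, 0⟩ :=
  congrArg (Bundle.TotalSpace.mk z.proj) (zero_smul ℝ (hamVec H z).1)

theorem schemeMap_zero (hR : IsDiscretizationMap R U) (hH : ContMDiff (cModel E) 𝓘(ℝ, ℝ) ∞ H)
    (z : CQ E Q) : schemeMap R H 0 z = (z, z) := by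
  have hcharts : InCharts R z.proj (z.proj, z.proj) (legendre H 0 z) :=
    legendre_zero (H := H) z ▸ inCharts_zero hR (mem_chart_source E z.proj)
  have hdiffeo := isLocalDiffeomorphAt_zero hR z.proj
  rw [← legendre_zero (H := H)] at hdiffeo
  have hmodel := (cotChart_schemeMap hH hdiffeo hcharts).trans
    (isModelDiscretizationAt_localR hR z.proj).modelScheme_zero
  have hz : z ∈ (cotChart E z.proj).source := mem_cotChart_source.2 (mem_chart_source E z.proj)
  exact Prod.ext
    ((cotChart E z.proj).injOn (mem_cotChart_source.2 hcharts.fst) hz (congrArg Prod.fst hmodel))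
    ((cotChart E z.proj).injOn (mem_cotChart_source.2 hcharts.snd) hz (congrArg Prod.snd hmodel))

theorem velocityAtZero_of_schemeMap_eq (hR : IsDiscretizationMap R U)
    (hH : ContMDiff (cModel E) 𝓘(ℝ, ℝ) ∞ H) {w c : ℝ → CQ E Q} {z : CQ E Q}
    (hw₀ : w 0 = z) (hc₀ : c 0 = z) (hw : ContMDiffAt 𝓘(ℝ, ℝ) (cModel E) ∞ w 0)
    (hc : ContMDiffAt 𝓘(ℝ, ℝ) (cModel E) ∞ c 0)
    (hscheme : ∀ᶠ h in 𝓝 0, schemeMap R H h (w h) = (z, c h)) :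
    (⟨c 0, velocityAtZero c⟩ : TangentBundle (cModel E) (CQ E Q)) = ⟨z, hamiltonianVF H z⟩ := by
  subst hc₀
  obtain ⟨V, hV, hmem⟩ := exists_isInvertibleOn hR (c 0).proj
  have hlegendre : ContinuousAt (fun h => legendre H h (w h)) 0 :=
    (contMDiff_legendre hH).continuous.continuousAt.comp
      (continuousAt_id.prodMk hw.continuousAt)
  have hlegendre₀ : legendre H 0 (w 0) = ⟨(c 0).proj, 0⟩ := by rw [legendre_zero, hw₀]
  have hV_nhds : ∀ᶠ h in 𝓝 0, legendre H h (w h) ∈ V :=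
    hlegendre.eventually (hV.isOpen.eventually_mem (by simpa only [hlegendre₀] using hmem))
  have hcharts : ∀ᶠ h in 𝓝 0,
      InCharts R (c 0).proj ((c 0).proj, (c 0).proj) (legendre H h (w h)) :=
    (inCharts_zero hR (mem_chart_source E (c 0).proj)).eventually hlegendre hlegendre₀
      (hV.localDiffeo _ hmem).contMDiffAt.continuousAt
  have dw := hasDerivAt_velocityAtZero hw
  rw [hw₀] at dw
  have hvelocity := (isModelDiscretizationAt_localR hR (c 0).proj).scheme_velocity
    (contDiffAt_localHam hH (mem_cotChart_target.2 (mem_extChartAt_target (c 0).proj)))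
    (congrArg (cotChart E (c 0).proj) hw₀) rfl dw (hasDerivAt_velocityAtZero hc) ?_ ?_
  · exact congrArg (Bundle.TotalSpace.mk (c 0)) (hvelocity.trans (hamField_self hH (c 0)))
  · filter_upwards [hV_nhds, hcharts] with h hh hin
    rw [← tanChart_legendre hH hin.proj]
    exact isInvertible_fderiv_localR (hV.localDiffeo _ hh) hin
  · filter_upwards [hV_nhds, hcharts, hscheme] with h hh hin heq
    have hmodel := cotChart_schemeMap hH (hV.localDiffeo _ hh) hin
    rw [heq] at hmodel
    exact hmodel.symm

end Consistency

section DiagonalFamily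

variable {F K M : Type*} [NormedAddCommGroup F] [NormedSpace ℝ F]
  [TopologicalSpace K] {I : ModelWithCorners ℝ F K} [TopologicalSpace M] [ChartedSpace K M]

theorem exists_Ioo_prod_subset {s : Set (ℝ × M)} {x : M} (hs : s ∈ 𝓝 ((0 : ℝ), x)) :
    ∃ ε > 0, ∃ A : Set M, IsOpen A ∧ x ∈ A ∧ Set.Ioo (-ε) ε ×ˢ A ⊆ s := by
  obtain ⟨u, A, hu, hu₀, hA, hxA, huA⟩ := mem_nhds_prod_iff'.1 hs
  obtain ⟨ε, hε, hεu⟩ := Metric.isOpen_iff.1 hu 0 hu₀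
  rw [Real.ball_eq_Ioo, zero_sub, zero_add] at hεu
  exact ⟨ε, hε, A, hA, hxA, (Set.prod_mono_left hεu).trans huA⟩

/-- A smooth family of pairs of points `G (h, w)`, parametrized by an open set `O`, which is the
diagonal at time `h = 0` and from whose members the parameter `w` is recovered by `ρ`, continuously
and independently of `h`. -/
structure IsDiagonalFamily (I : ModelWithCorners ℝ F K) (G : ℝ × M → M × M) (O : Set (ℝ × M))
    (ρ : M × M → M) : Prop where
  isOpen : IsOpen O
  contMDiffAt : ∀ y ∈ O, ContMDiffAt (𝓘(ℝ, ℝ).prod I) (I.prod I) ∞ G y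
  zero : ∀ w, (0, w) ∈ O → G (0, w) = (w, w)
  recover : ∀ y ∈ O, ρ (G y) = y.2
  continuousAt_recover : ∀ y ∈ O, ContinuousAt ρ (G y)

/-- For `|h| < ε`, the part in `A × B` of the set of pairs `G (h, w)` is the graph over `A` of the
injective map `z ↦ (G (h, ψ (h, z))).2`, where `ψ` depends smoothly on `h` and `z`. -/
structure IsLocalFlow (I : ModelWithCorners ℝ F K) (G : ℝ × M → M × M) (O : Set (ℝ × M))
    (ε : ℝ) (A B : Set M) (ψ : ℝ × M → M) : Prop where
  contMDiffAt : ∀ y ∈ Set.Ioo (-ε) ε ×ˢ A, ContMDiffAt (𝓘(ℝ, ℝ).prod I) I ∞ ψ y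
  mem : ∀ y ∈ Set.Ioo (-ε) ε ×ˢ A, (y.1, ψ y) ∈ O
  fst_eq : ∀ y ∈ Set.Ioo (-ε) ε ×ˢ A, (G (y.1, ψ y)).1 = y.2
  snd_mem : ∀ y ∈ Set.Ioo (-ε) ε ×ˢ A, (G (y.1, ψ y)).2 ∈ B
  eq_of_mem : ∀ h ∈ Set.Ioo (-ε) ε, ∀ w, (h, w) ∈ O → (G (h, w)).1 ∈ A → (G (h, w)).2 ∈ B →
    ψ (h, (G (h, w)).1) = w
  injOn : ∀ h ∈ Set.Ioo (-ε) ε, Set.InjOn (fun z => (G (h, ψ (h, z))).2) A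

variable {G : ℝ × M → M × M} {O : Set (ℝ × M)} {ρ : M × M → M} {x : M} {ε : ℝ}
  {A B : Set M} {ψ : ℝ × M → M} {z : M}

theorem IsDiagonalFamily.preimage_recover_mem_nhds (hG : IsDiagonalFamily I G O ρ)
    (hx : (0, x) ∈ O) {W : Set M} (hW : W ∈ 𝓝 x) : ρ ⁻¹' W ∈ 𝓝 (x, x) := by
  rw [← hG.zero x hx]
  exact (hG.continuousAt_recover _ hx).preimage_mem_nhds (by simpa only [hG.recover _ hx] using hW)

theorem IsLocalFlow.zero (hψ : IsLocalFlow I G O ε A B ψ) (hG : IsDiagonalFamily I G O ρ)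
    (hε : 0 < ε) (hz : z ∈ A) : ψ (0, z) = z := by
  have hy : ((0 : ℝ), z) ∈ Set.Ioo (-ε) ε ×ˢ A := ⟨⟨neg_lt_zero.2 hε, hε⟩, hz⟩
  have hfst := hψ.fst_eq _ hy
  rwa [hG.zero _ (hψ.mem _ hy)] at hfst

theorem IsLocalFlow.contMDiffAt_flow (hψ : IsLocalFlow I G O ε A B ψ)
    (hG : IsDiagonalFamily I G O ρ) {y : ℝ × M} (hy : y ∈ Set.Ioo (-ε) ε ×ˢ A) :
    ContMDiffAt (𝓘(ℝ, ℝ).prod I) I ∞ (fun y : ℝ × M => (G (y.1, ψ y)).2) y :=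
  contMDiffAt_snd.comp y (ContMDiffAt.comp (g := G) y (hG.contMDiffAt _ (hψ.mem y hy))
    (contMDiffAt_fst.prodMk (hψ.contMDiffAt y hy)))

theorem IsLocalFlow.exists_eq_iff (hψ : IsLocalFlow I G O ε A B ψ) {h : ℝ}
    (hh : h ∈ Set.Ioo (-ε) ε) {z z' : M} (hz : z ∈ A) (hz' : z' ∈ B) :
    (∃ w, (h, w) ∈ O ∧ G (h, w) = (z, z')) ↔ z' = (G (h, ψ (h, z))).2 := by
  constructor
  · rintro ⟨w, hw, heq⟩
    have hψw := hψ.eq_of_mem h hh w hw (by rwa [heq]) (by rwa [heq])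
    rw [heq] at hψw
    rw [hψw, heq]
  · rintro rfl
    exact ⟨ψ (h, z), hψ.mem (h, z) ⟨hh, hz⟩, Prod.ext (hψ.fst_eq (h, z) ⟨hh, hz⟩) rfl⟩

variable [FiniteDimensional ℝ F] [I.Boundaryless] [IsManifold I ∞ M]

theorem isLocalDiffeomorphAt_suspension {f : ℝ × M → M} {x : M}
    (hf : ∀ᶠ y in 𝓝 ((0 : ℝ), x), ContMDiffAt (𝓘(ℝ, ℝ).prod I) I ∞ f y)
    (hf₀ : ∀ᶠ w in 𝓝 x, f (0, w) = w) :
    IsLocalDiffeomorphAt (𝓘(ℝ, ℝ).prod I) (𝓘(ℝ, ℝ).prod I) ∞ (fun y : ℝ × M => (y.1, f y))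
      (0, x) := by
  have := FiniteDimensional.complete ℝ F
  obtain ⟨D, hD⟩ : ∃ D : ℝ × F →L[ℝ] F, HasMFDerivAt (𝓘(ℝ, ℝ).prod I) I f ((0 : ℝ), x) D :=
    ⟨_, (hf.self_of_nhds.mdifferentiableAt (by simp)).hasMFDerivAt⟩
  have dinr : HasMFDerivAt I (𝓘(ℝ, ℝ).prod I) (fun w : M => ((0 : ℝ), w)) x
      (ContinuousLinearMap.inr ℝ ℝ F) :=
    (hasMFDerivAt_const (I := I) (I' := 𝓘(ℝ, ℝ)) (0 : ℝ) x).prodMk (hasMFDerivAt_id x)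
  have hD_inr : D ∘L ContinuousLinearMap.inr ℝ ℝ F = ContinuousLinearMap.id ℝ F :=
    hasMFDerivAt_unique (hD.comp x dinr) ((hasMFDerivAt_id (I := I) x).congr_of_eventuallyEq hf₀)
  let S : ℝ × F →L[ℝ] ℝ × F := (ContinuousLinearMap.fst ℝ ℝ F).prod D
  have hS : Function.Injective S.toLinearMap := by
    refine (injective_iff_map_eq_zero S.toLinearMap).2 ?_
    rintro ⟨τ, ξ⟩ hτξ
    obtain rfl : τ = 0 := congrArg Prod.fst hτξ
    have hξ : D (0, ξ) = ξ := DFunLike.congr_fun hD_inr ξ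
    exact congrArg (Prod.mk 0) (hξ.symm.trans (congrArg Prod.snd hτξ))
  refine isLocalDiffeomorphAt_of_hasMFDerivAt
    (f' := (LinearEquiv.ofInjectiveEndo S.toLinearMap hS).toContinuousLinearEquiv)
    (hf.mono fun y hy => contMDiffAt_fst.prodMk hy) ?_
  have hcoe : ((LinearEquiv.ofInjectiveEndo S.toLinearMap hS).toContinuousLinearEquiv :
      ℝ × F →L[ℝ] ℝ × F) = S := rfl
  rw [hcoe]
  exact (hasMFDerivAt_fst (I := 𝓘(ℝ, ℝ)) (I' := I) ((0 : ℝ), x)).prodMk hD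

theorem exists_contMDiff_family_inverse {f : ℝ × M → M} {x : M}
    (hf : ∀ᶠ y in 𝓝 ((0 : ℝ), x), ContMDiffAt (𝓘(ℝ, ℝ).prod I) I ∞ f y)
    (hf₀ : ∀ᶠ w in 𝓝 x, f (0, w) = w) :
    ∃ σ : ℝ × M → M, σ (0, x) = x ∧
      (∀ᶠ y in 𝓝 ((0 : ℝ), x), ContMDiffAt (𝓘(ℝ, ℝ).prod I) I ∞ σ y) ∧
      (∀ᶠ y in 𝓝 ((0 : ℝ), x), f (y.1, σ y) = y.2) ∧
      ∀ᶠ y in 𝓝 ((0 : ℝ), x), σ (y.1, f y) = y.2 := by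
  have hsusp := isLocalDiffeomorphAt_suspension hf hf₀
  have hsuspx : ((0 : ℝ), f (0, x)) = (0, x) := congrArg (Prod.mk 0) hf₀.self_of_nhds
  have hsource : ∀ᶠ y in 𝓝 ((0 : ℝ), x), y ∈ hsusp.localInverse.source :=
    hsusp.localInverse_open_source.eventually_mem (by
      simpa only [hsuspx] using hsusp.localInverse_mem_source)
  have hleft := hsusp.localInverse_eventuallyEq_left
  refine ⟨fun y => (hsusp.localInverse y).2, ?_, ?_, ?_, ?_⟩
  · have hx := hleft.self_of_nhds
    simp only [Function.comp_apply, hsuspx] at hx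
    exact congrArg Prod.snd hx
  · filter_upwards [hsource] with y hy
    exact contMDiffAt_snd.comp y (hsusp.localInverse_contMDiffOn.contMDiffAt
      (hsusp.localInverse_open_source.mem_nhds hy))
  · filter_upwards [hsource] with y hy
    have hright := hsusp.localInverse_right_inv hy
    have htime : (hsusp.localInverse y).1 = y.1 := (Prod.ext_iff.1 hright).1
    rw [← htime]
    exact (Prod.ext_iff.1 hright).2
  · filter_upwards [hleft] with y hy
    exact congrArg Prod.snd hy

theorem IsDiagonalFamily.exists_local_inverses (hG : IsDiagonalFamily I G O ρ)
    (hx : (0, x) ∈ O) :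
    ∃ σ₀ σ₁ : ℝ × M → M, σ₀ (0, x) = x ∧
      (∀ᶠ y in 𝓝 ((0 : ℝ), x), ContMDiffAt (𝓘(ℝ, ℝ).prod I) I ∞ σ₀ y ∧
        (G (y.1, σ₀ y)).1 = y.2) ∧
      ∀ᶠ y in 𝓝 ((0 : ℝ), x), y ∈ O ∧ σ₀ (y.1, (G y).1) = y.2 ∧ σ₁ (y.1, (G y).2) = y.2 := by
  have hO : ∀ᶠ y in 𝓝 ((0 : ℝ), x), y ∈ O := hG.isOpen.eventually_mem hx
  have hzero : ∀ᶠ w in 𝓝 x, G (0, w) = (w, w) :=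
    ((Continuous.prodMk_right (0 : ℝ)).continuousAt.eventually hO).mono hG.zero
  obtain ⟨σ₀, hσ₀, hsmooth, hright, hleft₀⟩ := exists_contMDiff_family_inverse (I := I)
    (f := fun y => (G y).1) (hO.mono fun y hy => contMDiffAt_fst.comp y (hG.contMDiffAt y hy))
    (hzero.mono fun w hw => congrArg Prod.fst hw)
  obtain ⟨σ₁, -, -, -, hleft₁⟩ := exists_contMDiff_family_inverse (I := I)
    (f := fun y => (G y).2) (hO.mono fun y hy => contMDiffAt_snd.comp y (hG.contMDiffAt y hy))
    (hzero.mono fun w hw => congrArg Prod.snd hw)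
  exact ⟨σ₀, σ₁, hσ₀, hsmooth.and hright, hO.and (hleft₀.and hleft₁)⟩

theorem IsDiagonalFamily.exists_isLocalFlow (hG : IsDiagonalFamily I G O ρ) (hx : (0, x) ∈ O) :
    ∃ ε > 0, ∃ A B : Set M, IsOpen A ∧ IsOpen B ∧ x ∈ A ∧ x ∈ B ∧
      ∃ ψ : ℝ × M → M, IsLocalFlow I G O ε A B ψ := by
  obtain ⟨ψ, τ, hψx, hψ, hinv⟩ := hG.exists_local_inverses hx
  obtain ⟨δ, hδ, W, hW, hxW, hδW⟩ := exists_Ioo_prod_subset hinv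
  obtain ⟨A₁, B, hA₁, hxA₁, hB, hxB, hAB⟩ := mem_nhds_prod_iff'.1
    (hG.preimage_recover_mem_nhds hx (hW.mem_nhds hxW))
  have hcurve : ContinuousAt (fun y : ℝ × M => (y.1, ψ y)) (0, x) :=
    continuousAt_fst.prodMk hψ.self_of_nhds.1.continuousAt
  have hinner : ∀ᶠ y in 𝓝 ((0 : ℝ), x), (y.1, ψ y) ∈ Set.Ioo (-δ) δ ×ˢ W := by
    refine hcurve.eventually ((isOpen_Ioo.prod hW).eventually_mem ?_)
    simp only [hψx]
    exact ⟨⟨neg_lt_zero.2 hδ, hδ⟩, hxW⟩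
  have hvalue : ∀ᶠ y in 𝓝 ((0 : ℝ), x), G (y.1, ψ y) ∈ A₁ ×ˢ B := by
    have hGx : ContinuousAt G ((0 : ℝ), ψ (0, x)) := by
      simpa only [hψx] using (hG.contMDiffAt _ hx).continuousAt
    refine (hGx.comp_of_eq hcurve rfl).eventually ((hA₁.prod hB).eventually_mem ?_)
    simpa only [Function.comp_apply, hψx, hG.zero x hx] using Set.mk_mem_prod hxA₁ hxB
  obtain ⟨ε, hε, A, hA, hxA, hεA⟩ := exists_Ioo_prod_subset (hψ.and (hinner.and hvalue))
  refine ⟨ε, hε, A, B, hA, hB, hxA, hxB, ψ, ⟨fun y hy => (hεA hy).1.1,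
    fun y hy => (hδW (hεA hy).2.1).1, fun y hy => (hεA hy).1.2, fun y hy => (hεA hy).2.2.2,
    fun h hh w hw hwA hwB => ?_, fun h hh z hz z' hz' hzz' => ?_⟩⟩
  · obtain ⟨⟨-, hfst⟩, hbox, hwA₁, -⟩ := hεA (Set.mk_mem_prod hh hwA)
    rw [hfst] at hwA₁
    have hwW : w ∈ W := by
      rw [← show ρ (G (h, w)) = w from hG.recover _ hw]
      exact hAB ⟨hwA₁, hwB⟩
    exact (hδW (Set.mk_mem_prod hbox.1 hwW)).2.1
  · have hmem := hεA (Set.mk_mem_prod hh hz)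
    have hmem' := hεA (Set.mk_mem_prod hh hz')
    have hψ_eq : ψ (h, z) = ψ (h, z') := (hδW hmem.2.1).2.2.symm.trans
      ((congrArg (fun ξ => τ (h, ξ)) hzz').trans (hδW hmem'.2.1).2.2)
    exact (hmem.1.2.symm.trans (by rw [hψ_eq])).trans hmem'.1.2

end DiagonalFamily

section DiscreteFlow

variable [IsManifold 𝓘(ℝ, E) ∞ Q] [FiniteDimensional ℝ E] {R : TQ E Q → Q × Q}
  {U V : Set (TQ E Q)} {H : CQ E Q → ℝ}

theorem isDiagonalFamily_schemeMap (hR : IsDiscretizationMap R U) (hV : IsInvertibleOn R U V)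
    (hH : ContMDiff (cModel E) 𝓘(ℝ, ℝ) ∞ H) :
    IsDiagonalFamily (cModel E) (fun y => schemeMap R H y.1 y.2) (schemeDomain V H)
      (recover R V) where
  isOpen := isOpen_schemeDomain hV.isOpen hH
  contMDiffAt _ hy := contMDiffAt_schemeMap hV hH hy
  zero w _ := schemeMap_zero hR hH w
  recover _ hy := recover_schemeMap hV hy
  continuousAt_recover _ hy :=
    (contMDiffAt_recover hV (schemeMap_mem_recoverDomain hy)).continuousAt

theorem exists_discreteFlow (hR : IsDiscretizationMap R U) (hV : IsInvertibleOn R U V)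
    (hH : ContMDiff (cModel E) 𝓘(ℝ, ℝ) ∞ H) {x : CQ E Q} (hx : (⟨x.proj, 0⟩ : TQ E Q) ∈ V) :
    ∃ (ε : ℝ) (A B : Set (CQ E Q)) (φ : ℝ → CQ E Q → CQ E Q),
      0 < ε ∧ IsOpen A ∧ IsOpen B ∧ x ∈ A ∧ x ∈ B ∧
      ContMDiffOn (𝓘(ℝ, ℝ).prod (cModel E)) (cModel E) ∞
        (fun y : ℝ × CQ E Q => φ y.1 y.2) (Set.Ioo (-ε) ε ×ˢ A) ∧
      (∀ h ∈ Set.Ioo (-ε) ε,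
        (∀ z₀ ∈ A, φ h z₀ ∈ B ∧ ∀ z₁ ∈ B, (z₀, z₁) ∈ scheme R V H h ↔ z₁ = φ h z₀) ∧
        Set.InjOn (φ h) A ∧ IsLocalSymplectomorphismOn (φ h) A) ∧
      ∀ z ∈ A, φ 0 z = z ∧
        (⟨φ 0 z, velocityAtZero (fun h => φ h z)⟩ : TangentBundle (cModel E) (CQ E Q)) =
          ⟨z, hamiltonianVF H z⟩ := by
  have hG := isDiagonalFamily_schemeMap hR hV hH
  obtain ⟨ε, hε, A, B, hA, hB, hxA, hxB, ψ, hψ⟩ := hG.exists_isLocalFlow (x := x)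
    (show legendre H 0 x ∈ V by rwa [legendre_zero])
  let φ : ℝ → CQ E Q → CQ E Q := fun h z => (schemeMap R H h (ψ (h, z))).2
  have hφ : ContMDiffOn (𝓘(ℝ, ℝ).prod (cModel E)) (cModel E) ∞
      (fun y : ℝ × CQ E Q => φ y.1 y.2) (Set.Ioo (-ε) ε ×ˢ A) := fun _ hy =>
    (hψ.contMDiffAt_flow hG hy).contMDiffWithinAt
  have hgraph {h : ℝ} (hh : h ∈ Set.Ioo (-ε) ε) {z₀ : CQ E Q} (hz₀ : z₀ ∈ A) {z₁ : CQ E Q}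
      (hz₁ : z₁ ∈ B) : (z₀, z₁) ∈ scheme R V H h ↔ z₁ = φ h z₀ :=
    mem_scheme_iff.trans (hψ.exists_eq_iff hh hz₀ hz₁)
  have hφB {h : ℝ} (hh : h ∈ Set.Ioo (-ε) ε) {z : CQ E Q} (hz : z ∈ A) : φ h z ∈ B :=
    hψ.snd_mem (h, z) ⟨hh, hz⟩
  refine ⟨ε, A, B, φ, hε, hA, hB, hxA, hxB, hφ, fun h hh => ⟨fun z₀ hz₀ =>
    ⟨hφB hh hz₀, fun z₁ hz₁ => hgraph hh hz₀ hz₁⟩, hψ.injOn h hh, ?_⟩, fun z hz => ?_⟩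
  · exact isLocalSymplectomorphismOn_of_graph_subset hV hH hA
      (hφ.comp (contMDiff_const.prodMk contMDiff_id).contMDiffOn fun z hz => ⟨hh, hz⟩)
      fun z hz => (hgraph hh hz (hφB hh hz)).2 rfl
  · have hψ₀ : ψ (0, z) = z := hψ.zero hG hε hz
    have hφ₀ : φ 0 z = z := by simp only [φ, hψ₀, schemeMap_zero hR hH]
    have h₀ : (0 : ℝ) ∈ Set.Ioo (-ε) ε := ⟨neg_lt_zero.2 hε, hε⟩
    have hcurve : ContMDiffAt 𝓘(ℝ, ℝ) (𝓘(ℝ, ℝ).prod (cModel E)) ∞ (fun h : ℝ => (h, z)) 0 :=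
      contMDiffAt_id.prodMk contMDiffAt_const
    refine ⟨hφ₀, velocityAtZero_of_schemeMap_eq hR hH (w := fun h => ψ (h, z)) hψ₀ hφ₀
      (ContMDiffAt.comp (g := ψ) (0 : ℝ) (hψ.contMDiffAt (0, z) ⟨h₀, hz⟩) hcurve)
      (ContMDiffAt.comp (g := fun y : ℝ × CQ E Q => φ y.1 y.2) (0 : ℝ)
        (hψ.contMDiffAt_flow hG ⟨h₀, hz⟩) hcurve) ?_⟩
    filter_upwards [isOpen_Ioo.mem_nhds h₀] with h hh
    exact Prod.ext (hψ.fst_eq (h, z) ⟨hh, hz⟩) rfl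

end DiscreteFlow

end Discretization

end

theorem mainTheorem4 {E : Type*} [NormedAddCommGroup E] [NormedSpace ℝ E] [FiniteDimensional ℝ E]
    {Q : Type*} [TopologicalSpace Q] [ChartedSpace E Q] [IsManifold 𝓘(ℝ, E) ∞ Q]
    (R : Discretization.TQ E Q → Q × Q) (U : Set (Discretization.TQ E Q))
    (hR : Discretization.IsDiscretizationMap R U)
    (H : Discretization.CQ E Q → ℝ)
    (hH : ContMDiff (Discretization.cModel E) 𝓘(ℝ, ℝ) ∞ H) :
    -- `R_d` is invertible near each point of the zero section
    (∀ q : Q, ∃ V : Set (Discretization.TQ E Q),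
      Discretization.IsInvertibleOn R U V ∧ (⟨q, 0⟩ : Discretization.TQ E Q) ∈ V) ∧
    -- wherever `R_d` is inverted:
    ∀ V : Set (Discretization.TQ E Q), Discretization.IsInvertibleOn R U V →
      -- the scheme is a Lagrangian submanifold
      (∀ h : ℝ, Discretization.IsLagrangianSubmanifold (Discretization.scheme R V H h)) ∧
      -- every smooth map whose graph lies in the scheme is a local symplectomorphism
      (∀ (h : ℝ) (D : Set (Discretization.CQ E Q))
        (φ : Discretization.CQ E Q → Discretization.CQ E Q), IsOpen D →
        ContMDiffOn (Discretization.cModel E) (Discretization.cModel E) ∞ φ D →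
        (∀ z ∈ D, (z, φ z) ∈ Discretization.scheme R V H h) →
        Discretization.IsLocalSymplectomorphismOn φ D) ∧
      -- near each point and for small steps, the scheme is the graph of a discrete flow
      (∀ x : Discretization.CQ E Q, (⟨x.proj, 0⟩ : Discretization.TQ E Q) ∈ V →
        ∃ (ε : ℝ) (A B : Set (Discretization.CQ E Q))
          (φ : ℝ → Discretization.CQ E Q → Discretization.CQ E Q),
          0 < ε ∧ IsOpen A ∧ IsOpen B ∧ x ∈ A ∧ x ∈ B ∧
          ContMDiffOn (𝓘(ℝ, ℝ).prod (Discretization.cModel E)) (Discretization.cModel E) ∞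
            (fun y : ℝ × Discretization.CQ E Q => φ y.1 y.2) (Set.Ioo (-ε) ε ×ˢ A) ∧
          (∀ h ∈ Set.Ioo (-ε) ε,
            (∀ z₀ ∈ A, φ h z₀ ∈ B ∧
              ∀ z₁ ∈ B, (z₀, z₁) ∈ Discretization.scheme R V H h ↔ z₁ = φ h z₀) ∧
            Set.InjOn (φ h) A ∧ Discretization.IsLocalSymplectomorphismOn (φ h) A) ∧
          ∀ z ∈ A, φ 0 z = z ∧
            (⟨φ 0 z, Discretization.velocityAtZero (fun h => φ h z)⟩ :
              TangentBundle (Discretization.cModel E) (Discretization.CQ E Q)) =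
              ⟨z, Discretization.hamiltonianVF H z⟩) :=
  ⟨Discretization.exists_isInvertibleOn hR, fun _ hV =>
    ⟨Discretization.scheme_isLagrangian hV hH,
      fun _ _ _ hD hφ hg =>
        Discretization.isLocalSymplectomorphismOn_of_graph_subset hV hH hD hφ hg,
      fun _ hx => Discretization.exists_discreteFlow hR hV hH hx⟩⟩
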